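/- Let $\alpha:P\to M$ be a smooth fiber bundle with $\dim M=n\ge 1$ (all manifolds Hausdorff, second countable, finite-dimensional). Put $A_0=C^\infty(M)$, viewed inside $C^\infty(P)$ through $\alpha^*$. For $p,k\ge 0$ let $\Lambda_p^k\subset\Lambda^k(P)$ be the space of $k$-forms on $P$ that vanish whenever $k-p+1$ of their arguments are $\alpha$-vertical vector fields (so $\Lambda_p^k=0$ for $p>k$). The de Rham differential maps $\Lambda_p^k$ into $\Lambda_p^{k+1}$. For $q\ge 0$ put $\Omega^q=\Lambda_{n-1}^{n-1+q}$ (the differential forms on $P$ that are canonically identified with the affine $q$-forms over $\alpha$), and let $\delta:\Omega^q\to\Omega^{q+1}$ be the restricted de Rham differential; $H^q(\Omega,\delta)$ denotes the cohomology of this complex. Let $V\!\Lambda^q=\Lambda^q(P)/\Lambda_1^q$ with the quotient differential $d^V$, which is $A_0$-linear, and let $V\!H^q=H^q(V\!\Lambda,d^V)$, with $V\!H^{-1}=0$. The $A_0$-module $V\!H^q$ carries a canonical connection (of Gauss–Manin type) $\nabla^q:V\!H^q\to\Lambda^1(M)\otimes_{A_0}V\!H^q$, the unique one such that $\nabla^q_X[\rho]=[L_Z\rho]$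 for every vector field $X$ on $M$, every vector field $Z$ on $P$ that is $\alpha$-projectable onto $X$, and every $[\rho]\in V\!H^q$. Correspondingly there are unique $\mathbb R$-linear maps $$d_1^{p,q}:\Lambda^p(M)\otimes_{A_0}V\!H^q\to\Lambda^{p+1}(M)\otimes_{A_0}V\!H^q,\qquad d_1^{p,q}(\eta\otimes c)=d\eta\otimes c+(-1)^p\,\eta\wedge\nabla^q c .$$ Let $E_2^{p,q}=\ker d_1^{p,q}/\operatorname{im}d_1^{p-1,q}$. Proposition. For each $q\ge 0$ there is a short exact sequence of real vector spaces $$0\to\operatorname{coker}d_1^{n-1,q-1}\to H^q(\Omega,\delta)\to\ker d_1^{n-1,q}\to 0 .$$ In particular, $H^q(\Omega,\delta)\approx\operatorname{coker}d_1^{n-1,q-1}\oplus\ker d_1^{n-1,q}$ and $H^q(\Omega,\delta)\approx E_2^{n,q-1}\oplus\ker d_1^{n-1,q}$. (For $q=0$ the first term is zero and $H^0(\Omega,\delta)\cong\ker d_1^{n-1,0}$.) -/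

import Mathlib

open scoped TensorProduct

/-! ### Vector fields and differential forms

For `A = C^∞(N)`, vector fields on `N` are the derivations of `A`, and differential `k`-forms on
`N` are the alternating `A`-multilinear `A`-valued functions of `k` vector fields. -/

/-- Vector fields: derivations `A → A`. -/
abbrev VField (A : Type*) [CommRing A] [Algebra ℝ A] : Type _ := Derivation ℝ A A

/-- Differential `k`-forms. -/
abbrev DForm (A : Type*) [CommRing A] [Algebra ℝ A] (k : ℕ) : Type _ :=
  AlternatingMap A (VField A) A (Fin k)

section Calculus

variable {A : Type*} [CommRing A] [Algebra ℝ A]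

theorem VField.lie_smul_right (X Y : VField A) (a : A) : ⁅X, a • Y⁆ = X a • Y + a • ⁅X, Y⁆ := by
  ext b
  simp only [Derivation.commutator_apply, Derivation.add_apply, Derivation.smul_apply, smul_eq_mul,
    Derivation.leibniz]
  ring

theorem VField.lie_smul_left (X Y : VField A) (a : A) : ⁅a • X, Y⁆ = a • ⁅X, Y⁆ - Y a • X := by
  ext b
  simp only [Derivation.commutator_apply, Derivation.sub_apply, Derivation.smul_apply, smul_eq_mul,
    Derivation.leibniz]
  ring

/-- The Lie derivative of a form along a vector field:
`(L_X ω)(v₁, …, v_k) = X (ω(v₁, …, v_k)) - ∑ j, ω(v₁, …, [X, v_j], …, v_k)`. -/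
def lieD {k : ℕ} (X : VField A) (ω : DForm A k) : DForm A k where
  toFun v := X (ω v) - ∑ j, ω (Function.update v j ⁅X, v j⁆)
  map_update_add' := by
    intro inst v i x y
    obtain rfl : inst = instDecidableEqFin k := Subsingleton.elim _ _
    have h : ∀ j, ω (Function.update (Function.update v i (x + y)) j
          ⁅X, Function.update v i (x + y) j⁆) =
        ω (Function.update (Function.update v i x) j ⁅X, Function.update v i x j⁆) +
        ω (Function.update (Function.update v i y) j ⁅X, Function.update v i y j⁆) := by
      intro j
      rcases eq_or_ne j i with rfl | hj
      · simp [AlternatingMap.map_update_add]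
      · simp only [Function.update_of_ne hj, Function.update_comm hj.symm]
        rw [AlternatingMap.map_update_add]
    simp only [h, AlternatingMap.map_update_add, map_add, Finset.sum_add_distrib]
    abel
  map_update_smul' := by
    intro inst v i a x
    obtain rfl : inst = instDecidableEqFin k := Subsingleton.elim _ _
    have h : ∀ j, ω (Function.update (Function.update v i (a • x)) j
          ⁅X, Function.update v i (a • x) j⁆) =
        a • ω (Function.update (Function.update v i x) j ⁅X, Function.update v i x j⁆) +
        if j = i then X a • ω (Function.update v i x) else 0 := by
      intro j
      rcases eq_or_ne j i with rfl | hj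
      · simp [AlternatingMap.map_update_add, AlternatingMap.map_update_smul]
      · simp only [Function.update_of_ne hj, Function.update_comm hj.symm, if_neg hj, add_zero]
        rw [AlternatingMap.map_update_smul]
    simp only [h, AlternatingMap.map_update_smul, Finset.sum_add_distrib, Finset.sum_ite_eq',
      Finset.mem_univ, if_true, smul_eq_mul, Derivation.leibniz, ← Finset.mul_sum, mul_sub]
    ring
  map_eq_zero_of_eq' := by
    intro v i j hv hij
    have h0 : ∀ l, l ≠ i → l ≠ j → ω (Function.update v l ⁅X, v l⁆) = 0 := by
      intro l hi hj
      refine ω.map_eq_zero_of_eq _ ?_ hij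
      rw [Function.update_of_ne hi.symm, Function.update_of_ne hj.symm, hv]
    have h1 : ω (Function.update v j ⁅X, v j⁆) = - ω (Function.update v i ⁅X, v i⁆) := by
      rw [← ω.map_swap _ hij]
      congr 1
      ext1 l
      simp only [Function.comp]
      rcases eq_or_ne l i with rfl | hi
      · simp [Function.update_of_ne hij, Function.update_of_ne hij.symm, hv]
      rcases eq_or_ne l j with rfl | hj
      · simp [hv]
      · rw [Equiv.swap_apply_of_ne_of_ne hi hj, Function.update_of_ne hi, Function.update_of_ne hj]
    have hs : ∑ l, ω (Function.update v l ⁅X, v l⁆) = 0 := by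
      rw [Fintype.sum_eq_add i j hij (fun l hl => h0 l hl.1 hl.2), h1]
      simp
    simp [ω.map_eq_zero_of_eq v hv hij, hs]

theorem lieD_apply {k : ℕ} (X : VField A) (ω : DForm A k) (v : Fin k → VField A) :
    lieD X ω v = X (ω v) - ∑ j, ω (Function.update v j ⁅X, v j⁆) := rfl

theorem lieD_cons {k : ℕ} (X : VField A) (ω : DForm A (k + 1)) (u : Fin k → VField A) :
    lieD X ω (Fin.cons X u) = lieD X (ω.curryLeft X) u := by
  simp only [lieD_apply, Fin.sum_univ_succ, Fin.cons_zero, lie_self, Fin.cons_succ,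
    ← Fin.cons_update, AlternatingMap.curryLeft_apply_apply, Matrix.vecCons]
  rw [ω.map_coord_zero (m := Function.update _ 0 0) 0 (Function.update_self ..), zero_add]

/-- The Koszul formula for the de Rham differential,
`(dω)(v₀, …, v_k) = ∑ i, (-1)^i v_i (ω(v₀, …, v̂_i, …, v_k))`
`  - ∑ i < j, (-1)^i ω(v₀, …, v̂_i, …, [v_i, v_j], …, v_k)`,
where the bracket stands in the place of `v_j`. -/
def koszul {k : ℕ} (ω : DForm A k) (v : Fin (k + 1) → VField A) : A :=
  ∑ i : Fin (k + 1), (-1 : A) ^ (i : ℕ) *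
    (v i (ω (i.removeNth v)) - ∑ j ∈ Finset.Ioi i, ω (i.removeNth (Function.update v j ⁅v i, v j⁆)))

theorem koszul_zero (ω : DForm A 0) (v : Fin 1 → VField A) :
    koszul ω v = v 0 (ω ![]) := by
  simp [koszul, Subsingleton.elim (Fin.removeNth 0 v) ![]]

theorem koszul_cons {k : ℕ} (ω : DForm A (k + 1)) (X : VField A) (w : Fin (k + 1) → VField A) :
    koszul ω (Fin.cons X w) = lieD X ω w - koszul (ω.curryLeft X) w := by
  have hr : ∀ (i : Fin (k + 1)) (u : Fin (k + 1) → VField A),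
      i.succ.removeNth (Fin.cons X u : Fin (k + 2) → VField A) = Matrix.vecCons X (i.removeNth u) := by
    intro i u
    ext1 l
    refine Fin.cases ?_ (fun l => ?_) l
    · simp [Fin.removeNth, Matrix.vecCons]
    · simp [Fin.removeNth, Matrix.vecCons]
  unfold koszul
  rw [Fin.sum_univ_succ]
  have hI : Finset.Ioi (0 : Fin (k + 2)) = Finset.univ.map (Fin.succEmb (k + 1)) := by
    ext l
    refine Fin.cases ?_ (fun l => ?_) l <;> simp
  have hI' : ∀ i : Fin (k + 1), Finset.Ioi i.succ = (Finset.Ioi i).map (Fin.succEmb (k + 1)) := by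
    intro i
    ext l
    refine Fin.cases ?_ (fun l => ?_) l <;> simp
  simp only [hI, hI', Finset.sum_map, Fin.coe_succEmb, Fin.cons_succ, Fin.cons_zero,
    ← Fin.cons_update, hr, AlternatingMap.curryLeft_apply_apply, Fin.val_zero, pow_zero, one_mul,
    Fin.val_succ, pow_succ, lieD_apply, mul_neg, mul_one, neg_mul, Finset.sum_neg_distrib, Fin.removeNth_zero,
    Fin.tail_cons]
  ring

theorem koszul_add {k : ℕ} (ω η : DForm A k) (v : Fin (k + 1) → VField A) :
    koszul (ω + η) v = koszul ω v + koszul η v := by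
  simp only [koszul, AlternatingMap.add_apply, map_add, Finset.sum_add_distrib]
  rw [← Finset.sum_add_distrib]
  refine Finset.sum_congr rfl fun i _ => ?_
  ring

theorem koszul_smul {k : ℕ} (a : A) (ω : DForm A k) (v : Fin (k + 1) → VField A) :
    koszul (a • ω) v = a * koszul ω v +
      ∑ i : Fin (k + 1), (-1 : A) ^ (i : ℕ) * (v i a * ω (i.removeNth v)) := by
  simp only [koszul, AlternatingMap.smul_apply, smul_eq_mul, Derivation.leibniz]
  rw [Finset.mul_sum, ← Finset.sum_add_distrib]
  refine Finset.sum_congr rfl fun i _ => ?_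
  rw [← Finset.mul_sum]
  ring

theorem koszul_algebraMap_smul {k : ℕ} (c : ℝ) (ω : DForm A k) (v : Fin (k + 1) → VField A) :
    koszul (c • ω) v = c • koszul ω v := by
  have h : c • ω = algebraMap ℝ A c • ω := by
    ext u
    simp [Algebra.smul_def]
  rw [h, koszul_smul]
  simp [Algebra.smul_def]

theorem lieD_add_left {k : ℕ} (X Y : VField A) (ω : DForm A k) (v : Fin k → VField A) :
    lieD (X + Y) ω v = lieD X ω v + lieD Y ω v := by
  simp only [lieD, AlternatingMap.coe_mk, MultilinearMap.coe_mk, Derivation.add_apply, add_lie,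
    AlternatingMap.map_update_add, Finset.sum_add_distrib]
  ring

theorem lieD_smul_left {k : ℕ} (a : A) (X : VField A) (ω : DForm A (k + 1))
    (v : Fin (k + 1) → VField A) :
    lieD (a • X) ω v = a * lieD X ω v +
      ∑ i : Fin (k + 1), (-1 : A) ^ (i : ℕ) * (v i a * ω (Matrix.vecCons X (i.removeNth v))) := by
  have h : ∀ i : Fin (k + 1), ω (Function.update v i X) =
      (-1 : A) ^ (i : ℕ) * ω (Matrix.vecCons X (i.removeNth v)) := by
    intro i
    rw [← Fin.insertNth_removeNth, AlternatingMap.map_insertNth]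
    simp [zsmul_eq_mul]
  simp only [lieD, AlternatingMap.coe_mk, MultilinearMap.coe_mk, Derivation.smul_apply,
    VField.lie_smul_left, AlternatingMap.map_update_sub, AlternatingMap.map_update_smul,
    Finset.sum_sub_distrib, smul_eq_mul, h, ← Finset.mul_sum]
  rw [mul_sub, sub_sub_eq_add_sub, sub_add_eq_add_sub]
  congr 2
  refine Finset.sum_congr rfl fun i _ => ?_
  ring


theorem koszul_cons_self {k : ℕ} (ω : DForm A (k + 1)) (X : VField A) (u : Fin (k + 1) → VField A)
    (hu : u 0 = X) : koszul ω (Fin.cons X u) = 0 := by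
  rw [koszul_cons]
  cases k with
  | zero =>
    obtain rfl : u = ![X] := by
      ext1 i
      exact Fin.cases hu (fun j => j.elim0) i
    rw [koszul_zero]
    have h := lieD_cons X ω ![]
    rw [show (Fin.cons X ![] : Fin 1 → VField A) = ![X] from rfl] at h
    simp [h, lieD_apply]
  | succ k =>
    obtain ⟨u, rfl⟩ : ∃ u', u = Fin.cons X u' := ⟨Fin.tail u, by rw [← hu, Fin.cons_self_tail]⟩
    have h0 : (ω.curryLeft X).curryLeft X = 0 := by
      ext w
      simp only [AlternatingMap.curryLeft_apply_apply, AlternatingMap.zero_apply]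
      exact ω.map_eq_zero_of_eq _ (i := 0) (j := 1) rfl (by simp)
    rw [lieD_cons, koszul_cons, h0]
    simp [koszul]

theorem exists_koszul {k : ℕ} (ω : DForm A k) : ∃ η : DForm A (k + 1), ∀ v, η v = koszul ω v := by
  induction k with
  | zero =>
    refine ⟨AlternatingMap.ofSubsingleton A (VField A) A (0 : Fin 1)
      { toFun := fun X => X (ω ![]), map_add' := fun _ _ => rfl, map_smul' := fun _ _ => rfl }, ?_⟩
    intro v
    simp [koszul_zero]
  | succ k ih =>
    choose d hd using fun η : DForm A k => ih η
    have hc : ∀ v : Fin (k + 2) → VField A, koszul ω v =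
        lieD (v 0) ω (Fin.tail v) - d (ω.curryLeft (v 0)) (Fin.tail v) := by
      intro v
      conv_lhs => rw [← Fin.cons_self_tail v]
      rw [koszul_cons, hd]
    have ht : ∀ (v : Fin (k + 2) → VField A) (i j : Fin (k + 1)), v i.succ = v j.succ →
        i ≠ j → koszul ω v = 0 := by
      intro v i j hv hij
      rw [hc, (lieD (v 0) ω).map_eq_zero_of_eq (Fin.tail v) hv hij,
        (d _).map_eq_zero_of_eq (Fin.tail v) hv hij, sub_zero]
    have h0 : ∀ (v : Fin (k + 2) → VField A) (j : Fin (k + 1)), v 0 = v j.succ →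
        koszul ω v = 0 := by
      intro v j hv
      have hd0 : ∀ u : Fin (k + 1) → VField A,
          (lieD (v 0) ω - d (ω.curryLeft (v 0))) u = koszul ω (Fin.cons (v 0) u) := by
        intro u
        rw [hc]
        simp
      have hs := AlternatingMap.map_perm (lieD (v 0) ω - d (ω.curryLeft (v 0))) (Fin.tail v)
        (Equiv.swap 0 j)
      rw [hd0, hd0, Fin.cons_self_tail, koszul_cons_self] at hs
      · have := congrArg (fun x => Equiv.Perm.sign (Equiv.swap 0 j) • x) hs
        rwa [smul_zero, smul_smul, Int.units_mul_self, one_smul, eq_comm] at this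
      · simp [Fin.tail, hv]
    refine ⟨{ toFun := koszul ω, map_update_add' := ?_, map_update_smul' := ?_,
              map_eq_zero_of_eq' := ?_ }, fun v => rfl⟩
    · intro inst v i x y
      obtain rfl : inst = instDecidableEqFin _ := Subsingleton.elim _ _
      refine Fin.cases ?_ (fun i => ?_) i
      · simp only [hc, Function.update_self, Fin.tail_update_zero, lieD_add_left, map_add, hd,
          koszul_add]
        ring
      · simp only [hc, Fin.tail_update_succ, AlternatingMap.map_update_add,
          Function.update_of_ne (Fin.succ_ne_zero i).symm]
        ring
    · intro inst v i a x
      obtain rfl : inst = instDecidableEqFin _ := Subsingleton.elim _ _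
      refine Fin.cases ?_ (fun i => ?_) i
      · simp only [hc, Function.update_self, Fin.tail_update_zero, lieD_smul_left, map_smul, hd,
          koszul_smul, AlternatingMap.curryLeft_apply_apply, smul_eq_mul]
        ring
      · simp only [hc, Fin.tail_update_succ, AlternatingMap.map_update_smul,
          Function.update_of_ne (Fin.succ_ne_zero i).symm, smul_eq_mul]
        ring
    · intro v i j hv hij
      induction i using Fin.cases with
      | zero =>
        induction j using Fin.cases with
        | zero => exact absurd rfl hij
        | succ j => exact h0 v j hv
      | succ i =>
        induction j using Fin.cases with
        | zero => exact h0 v i hv.symm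
        | succ j => exact ht v i j hv fun h => hij (by rw [h])

/-- The de Rham differential `d : Λ^k → Λ^{k+1}`, given by the Koszul formula. -/
noncomputable def extD (k : ℕ) : DForm A k →ₗ[ℝ] DForm A (k + 1) where
  toFun ω :=
    { toFun := koszul ω
      map_update_add' := by
        obtain ⟨η, h⟩ := exists_koszul ω
        simp only [← h]
        exact η.map_update_add'
      map_update_smul' := by
        obtain ⟨η, h⟩ := exists_koszul ω
        simp only [← h]
        exact η.map_update_smul'
      map_eq_zero_of_eq' := by
        obtain ⟨η, h⟩ := exists_koszul ω
        simp only [← h]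
        exact η.map_eq_zero_of_eq' }
  map_add' ω η := AlternatingMap.ext fun v => koszul_add ω η v
  map_smul' c ω := AlternatingMap.ext fun v => koszul_algebraMap_smul c ω v

theorem extD_apply {k : ℕ} (ω : DForm A k) (v : Fin (k + 1) → VField A) :
    extD k ω v = koszul ω v := rfl


/-- The wedge product `θ ∧ η` of a `1`-form and a `p`-form:
`(θ ∧ η)(v₀, …, v_p) = ∑ i, (-1)^i θ(v_i) η(v₀, …, v̂_i, …, v_p)`. -/
noncomputable def oneWedge {p : ℕ} (η : DForm A p) : DForm A 1 →ₗ[A] DForm A (p + 1) where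
  toFun θ := AlternatingMap.alternatizeUncurryFin
    (LinearMap.smulRight (AlternatingMap.ofSubsingleton A (VField A) A (0 : Fin 1)|>.symm θ) η)
  map_add' θ θ' := by
    ext v
    simp [AlternatingMap.alternatizeUncurryFin_apply, add_mul, Finset.sum_add_distrib]
  map_smul' a θ := by
    ext v
    simp [AlternatingMap.alternatizeUncurryFin_apply, Finset.mul_sum, mul_assoc, mul_left_comm]

theorem oneWedge_apply {p : ℕ} (η : DForm A p) (θ : DForm A 1) (v : Fin (p + 1) → VField A) :
    oneWedge η θ v =
      ∑ i : Fin (p + 1), (-1 : ℤ) ^ (i : ℕ) • (θ (fun _ => v i) * η (i.removeNth v)) := by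
  simp [oneWedge, AlternatingMap.alternatizeUncurryFin_apply]

end Calculus

/-! ### Cohomology of a sequence of modules -/

section Cohomology

variable {R : Type*} [Ring R] {C : ℕ → Type*} [∀ q, AddCommGroup (C q)] [∀ q, Module R (C q)]

/-- The coboundaries in degree `q` of `C 0 → C 1 → ⋯`. -/
def coboundaries (d : ∀ q, C q →ₗ[R] C (q + 1)) : (q : ℕ) → Submodule R (C q)
  | 0 => ⊥
  | q + 1 => LinearMap.range (d q)

/-- The cohomology in degree `q` of the cochain complex `C 0 → C 1 → ⋯`. -/
abbrev Cohom (d : ∀ q, C q →ₗ[R] C (q + 1)) (q : ℕ) : Type _ :=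
  ↥(LinearMap.ker (d q)) ⧸ (coboundaries d q).submoduleOf (LinearMap.ker (d q))

/-- The cokernel of a linear map. -/
abbrev Coker {V W : Type*} [AddCommGroup V] [Module R V] [AddCommGroup W] [Module R W]
    (f : V →ₗ[R] W) : Type _ :=
  W ⧸ LinearMap.range f

end Cohomology

/-! ### Forms on the total space of a bundle

Here `A₀ = C^∞(M)`, `A = C^∞(P)`, and `A` is an `A₀`-algebra through the pull-back `α^*`. -/

section Relative

variable (A₀ A : Type*) [CommRing A₀] [CommRing A] [Algebra ℝ A] [Algebra A₀ A]

/-- Vertical vector fields: those which vanish on functions pulled back from the base. -/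
def vertical : Submodule A (VField A) where
  carrier := {Y | ∀ f : A₀, Y (algebraMap A₀ A f) = 0}
  add_mem' hX hY f := by simp [hX f, hY f]
  zero_mem' f := by simp
  smul_mem' a Y hY f := by simp [hY f]

variable {A} in
theorem vertical_lie {X Y : VField A} (hX : X ∈ vertical A₀ A) (hY : Y ∈ vertical A₀ A) :
    ⁅X, Y⁆ ∈ vertical A₀ A := by
  intro f
  simp [Derivation.commutator_apply, hX f, hY f]

/-- The `k`-forms `Λ_p^k` of the `p`-th power of the ideal of forms vanishing on the fibres: those
which vanish as soon as `k - p + 1` of their arguments are vertical (so all `k`-forms if `p = 0`,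
and only `0` if `p > k`). -/
def filt (p k : ℕ) : Submodule A (DForm A k) where
  carrier := {ω | ∀ (v : Fin k → VField A) (S : Finset (Fin k)), k + 1 ≤ p + S.card →
    (∀ i ∈ S, v i ∈ vertical A₀ A) → ω v = 0}
  add_mem' h h' v S hS hv := by simp [h v S hS hv, h' v S hS hv]
  zero_mem' v S hS hv := rfl
  smul_mem' a ω h v S hS hv := by simp [h v S hS hv]

variable {A}

theorem extD_mem_filt {p k : ℕ} {ω : DForm A k} (hω : ω ∈ filt A₀ A p k) :
    extD k ω ∈ filt A₀ A p (k + 1) := by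
  intro v S hS hv
  have hcard : ∀ (i : Fin (k + 1)) (T : Finset (Fin (k + 1))), i ∉ T →
      (Finset.univ.filter fun l : Fin k => i.succAbove l ∈ T).card = T.card := by
    intro i T hT
    rw [← Finset.card_map i.succAboveEmb]
    congr 1
    ext l
    simp only [Finset.mem_map, Finset.mem_filter, Finset.mem_univ, true_and, Fin.succAboveEmb_apply]
    constructor
    · rintro ⟨m, hm, rfl⟩
      exact hm
    · intro hl
      obtain ⟨m, hm⟩ := Fin.exists_succAbove_eq (x := l) (y := i) fun h => hT (h ▸ hl)
      exact ⟨m, hm.symm ▸ hl, hm⟩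
  have key : ∀ (i : Fin (k + 1)) (u : Fin (k + 1) → VField A) (T : Finset (Fin (k + 1))), i ∉ T →
      S.card ≤ T.card + 1 → (∀ l ∈ T, u l ∈ vertical A₀ A) → ω (i.removeNth u) = 0 := by
    intro i u T hT hST hu
    refine hω _ (Finset.univ.filter fun l : Fin k => i.succAbove l ∈ T) ?_ ?_
    · rw [hcard i T hT]
      omega
    · intro l hl
      exact hu _ (Finset.mem_filter.1 hl).2
  have herase : ∀ i : Fin (k + 1), S.card ≤ (S.erase i).card + 1 := fun i => by
    have := Finset.pred_card_le_card_erase (s := S) (a := i)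
    omega
  rw [extD_apply, koszul]
  refine Finset.sum_eq_zero fun i _ => ?_
  rw [key i v (S.erase i) (Finset.notMem_erase i S) (herase i)
    fun l hl => hv l (Finset.mem_of_mem_erase hl), Finset.sum_eq_zero, map_zero, sub_zero, mul_zero]
  intro j hj
  have hij : i ≠ j := (Finset.mem_Ioi.1 hj).ne
  by_cases hi : i ∈ S
  · refine key i _ (S.erase i) (Finset.notMem_erase i S) (herase i) fun l hl => ?_
    rcases eq_or_ne l j with rfl | h
    · rw [Function.update_self]
      exact vertical_lie A₀ (hv _ hi) (hv _ (Finset.mem_of_mem_erase hl))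
    · rw [Function.update_of_ne h]
      exact hv _ (Finset.mem_of_mem_erase hl)
  · refine key i _ (S.erase j) (fun h => hi (Finset.mem_of_mem_erase h)) (herase j) fun l hl => ?_
    rw [Function.update_of_ne (Finset.ne_of_mem_erase hl)]
    exact hv _ (Finset.mem_of_mem_erase hl)

variable (A)

instance DForm.isScalarTower (R : Type*) [CommRing R] [Algebra R A] (k : ℕ) :
    IsScalarTower R A (DForm A k) :=
  ⟨fun f a ω => AlternatingMap.ext fun v => smul_assoc f a (ω v)⟩

/-- The affine `q`-forms `Ω^q`, as differential forms on the total space: over an `n`-dimensional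
base, `Ω^q = Λ_{n-1}^{n-1+q}`. Here `r` stands for `n - 1`. -/
abbrev Omega (r q : ℕ) : Type _ := ↥((filt A₀ A r (r + q)).restrictScalars ℝ)

/-- The restricted de Rham differential `δ : Ω^q → Ω^{q+1}`. -/
noncomputable def omegaD (r q : ℕ) : Omega A₀ A r q →ₗ[ℝ] Omega A₀ A r (q + 1) :=
  (extD (r + q)).restrict fun _ h => extD_mem_filt A₀ h

/-- `H^q(Ω, δ)`. -/
abbrev OmegaH (r q : ℕ) : Type _ := Cohom (C := Omega A₀ A r) (omegaD A₀ A r) q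

/-- Vertical forms: `VΛ^q = Λ^q / Λ_1^q`. -/
abbrev VForm (q : ℕ) : Type _ := DForm A q ⧸ (filt A₀ A 1 q).restrictScalars A₀

/-- The quotient differential `d^V : VΛ^q → VΛ^{q+1}`, which is linear over the base functions. -/
noncomputable def vertD (q : ℕ) : VForm A₀ A q →ₗ[A₀] VForm A₀ A (q + 1) :=
  Submodule.liftQ _
    { toFun := fun ω => Submodule.Quotient.mk (extD q ω)
      map_add' := fun ω η => by simp
      map_smul' := fun f ω => by
        rw [RingHom.id_apply, ← Submodule.Quotient.mk_smul, Submodule.Quotient.eq]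
        intro v S hS hv
        have hS' : S = Finset.univ := by
          rw [← Finset.card_eq_iff_eq_univ, Fintype.card_fin]
          have := Finset.card_le_univ S
          rw [Fintype.card_fin] at this
          omega
        rw [← algebraMap_smul A f ω, ← algebraMap_smul A f (extD q ω), AlternatingMap.sub_apply,
          AlternatingMap.smul_apply, extD_apply, koszul_smul, extD_apply, smul_eq_mul,
          add_sub_cancel_left]
        refine Finset.sum_eq_zero fun i _ => ?_
        rw [hv i (hS' ▸ Finset.mem_univ i) f, zero_mul, mul_zero] }
    (fun ω hω => (Submodule.Quotient.mk_eq_zero _).2 (extD_mem_filt A₀ hω))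

/-- Vertical cohomology `VH^q = H^q(VΛ, d^V)`, a module over the base functions. -/
abbrev VertH (q : ℕ) : Type _ := Cohom (C := VForm A₀ A) (vertD A₀ A) q

variable {A₀ A}

/-- The form `ρ` is closed along the fibres, with vertical cohomology class `c`. -/
def IsVertClass {q : ℕ} (ρ : DForm A q) (c : VertH A₀ A q) : Prop :=
  ∃ z : ↥(LinearMap.ker (vertD A₀ A q)),
    z.1 = Submodule.Quotient.mk ρ ∧ Submodule.Quotient.mk z = c

variable [Algebra ℝ A₀]

/-- `Z` is projectable, with projection `X`. -/
def IsLift (X : VField A₀) (Z : VField A) : Prop :=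
  ∀ f : A₀, Z (algebraMap A₀ A f) = algebraMap A₀ A (X f)

variable (A₀ A) in
/-- `Λ^p(M) ⊗ VH^q`, the forms on the base with values in the vertical cohomology. -/
abbrev E1 (p q : ℕ) : Type _ := DForm A₀ p ⊗[A₀] VertH A₀ A q

/-- Insertion of a vector field `X` on the base: `Λ^1(M) ⊗ VH^q → VH^q`, `θ ⊗ c ↦ θ(X) c`. -/
noncomputable def contract {q : ℕ} (X : VField A₀) : E1 A₀ A 1 q →ₗ[A₀] VertH A₀ A q :=
  TensorProduct.lift
    { toFun := fun θ => θ (fun _ => X) • LinearMap.id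
      map_add' := fun θ θ' => by simp [add_smul]
      map_smul' := fun f θ => by simp [mul_smul] }

/-- `D : VH^q → Λ^1(M) ⊗ VH^q` is the Gauss–Manin connection: `D_X [ρ] = [L_Z ρ]` for every vector
field `X` on the base, every projectable vector field `Z` over `X` and every vertical class `[ρ]`. -/
def IsGaussManin {q : ℕ} (D : VertH A₀ A q →+ E1 A₀ A 1 q) : Prop :=
  ∀ (X : VField A₀) (Z : VField A), IsLift X Z → ∀ (ρ : DForm A q) (c : VertH A₀ A q),
    IsVertClass ρ c → IsVertClass (lieD Z ρ) (contract X (D c))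

/-- `d` is the family of de Rham-like differentials `d_1^{p,q}` of the Gauss–Manin connections `D`:
`d (η ⊗ c) = dη ⊗ c + (-1)^p η ∧ D c`. The second summand is written `D c ∧ η`, where
`(θ ⊗ c') ∧ η = (θ ∧ η) ⊗ c'`. -/
def IsGaussManinD (d : ∀ p q : ℕ, E1 A₀ A p q →ₗ[ℝ] E1 A₀ A (p + 1) q) : Prop :=
  ∃ D : ∀ q : ℕ, VertH A₀ A q →+ E1 A₀ A 1 q, (∀ q, IsGaussManin (D q)) ∧
    ∀ (p q : ℕ) (η : DForm A₀ p) (c : VertH A₀ A q),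
      d p q (η ⊗ₜ c) = extD p η ⊗ₜ c + (oneWedge η).rTensor (VertH A₀ A q) (D q c)

/-- The cokernel of `d_1^{p,q}`. -/
abbrev CokerD (d : ∀ p q : ℕ, E1 A₀ A p q →ₗ[ℝ] E1 A₀ A (p + 1) q) (p q : ℕ) : Type _ :=
  Coker (R := ℝ) (V := E1 A₀ A p q) (W := E1 A₀ A (p + 1) q) (d p q)

/-- `E_2^{p,q}`, the cohomology of `⋯ → Λ^p(M) ⊗ VH^q → Λ^{p+1}(M) ⊗ VH^q → ⋯`. -/
abbrev E2 (d : ∀ p q : ℕ, E1 A₀ A p q →ₗ[ℝ] E1 A₀ A (p + 1) q) (p q : ℕ) : Type _ :=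
  Cohom (C := fun p => E1 A₀ A p q) (fun p => d p q) p

end Relative

/-! ### Smooth fibre bundles -/

open scoped Manifold ContDiff

section Bundle

variable {EM EP : Type*} [NormedAddCommGroup EM] [NormedSpace ℝ EM]
  [NormedAddCommGroup EP] [NormedSpace ℝ EP]
  {M P : Type*} [TopologicalSpace M] [ChartedSpace EM M] [TopologicalSpace P] [ChartedSpace EP P]

/-- The smooth map `α : P → M` is a fibre bundle with abstract fibre `F`: every point of `M` has an
open neighbourhood `U` with a diffeomorphism `α⁻¹(U) ≅ U × F` over `U`. -/
def IsSmoothFiberBundle (EF : Type*) [NormedAddCommGroup EF] [NormedSpace ℝ EF] (F : Type*)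
    [TopologicalSpace F] [ChartedSpace EF F] (α : C^∞⟮𝓘(ℝ, EP), P; 𝓘(ℝ, EM), M⟯) : Prop :=
  ∀ x : M, ∃ e : Bundle.Trivialization F α, x ∈ e.baseSet ∧
    ContMDiffOn 𝓘(ℝ, EP) (𝓘(ℝ, EM).prod 𝓘(ℝ, EF)) ∞ e e.source ∧
    ContMDiffOn (𝓘(ℝ, EM).prod 𝓘(ℝ, EF)) 𝓘(ℝ, EP) ∞ e.toOpenPartialHomeomorph.symm e.target

/-- `C^∞(P)`, tagged with `α : P → M` so that it is an algebra over `C^∞(M)` through pull-back. -/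
def TotalFun (_α : C^∞⟮𝓘(ℝ, EP), P; 𝓘(ℝ, EM), M⟯) : Type _ := C^∞⟮𝓘(ℝ, EP), P; ℝ⟯

variable (α : C^∞⟮𝓘(ℝ, EP), P; 𝓘(ℝ, EM), M⟯)

noncomputable instance TotalFun.instCommRing : CommRing (TotalFun α) :=
  inferInstanceAs (CommRing C^∞⟮𝓘(ℝ, EP), P; ℝ⟯)

noncomputable instance TotalFun.instAlgebraReal : Algebra ℝ (TotalFun α) :=
  inferInstanceAs (Algebra ℝ C^∞⟮𝓘(ℝ, EP), P; ℝ⟯)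

/-- The pull-back `α^* : C^∞(M) → C^∞(P)`. -/
noncomputable def pullbackHom : C^∞⟮𝓘(ℝ, EM), M; ℝ⟯ →+* TotalFun α where
  toFun f := (f.comp α : C^∞⟮𝓘(ℝ, EP), P; ℝ⟯)
  map_one' := rfl
  map_mul' _ _ := rfl
  map_zero' := rfl
  map_add' _ _ := rfl

noncomputable instance TotalFun.instAlgebra : Algebra C^∞⟮𝓘(ℝ, EM), M; ℝ⟯ (TotalFun α) :=
  (pullbackHom α).toAlgebra

end Bundle

/-! The argument is the spectral sequence of the filtration of the de Rham complex of `P` by base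
degree, carried out by hand on the two columns that matter. Over an `n`-dimensional base `Λ_{n+1} =
0`, so `Ω = Λ_{n-1}` sits in `0 → Λ_n → Λ_{n-1} → Λ_{n-1}/Λ_n → 0`. The graded piece `Λ_p/Λ_{p+1}`
is `Λ^p(M) ⊗ VΛ^q` with differential `(-1)^p id ⊗ d^V`; since `Λ^p(M)` is flat over `C^∞(M)`, its
cohomology is `Λ^p(M) ⊗ VH^q`. The connecting map of the long exact sequence is `d_1^{n-1,q}`, and
cutting that sequence at `H^q(Ω)` leaves a cokernel on the left and a kernel on the right. The
splitting is linear algebra over `ℝ`, and `E_2^{n,q-1}` is the cokernel because `Λ^{n+1}(M) = 0`.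

Forms are multilinear functions of derivations, so the algebra uses no coordinates. Their role is
played by a `LiftedFrame`: functions `f_j` and fields `X_j` on the base with `Y = ∑ Y(f_j) X_j`, and
lifts `H_j` of the `X_j`. The Euler operator `∑ df_j ∧ ι_{X_j}` is multiplication by `p` on
`Λ^p(M)`, and `∑ df_j ∧ ι_{H_j}` is multiplication by `p` on `Λ_p` modulo `Λ_{p+1}`. Dividing by `p`
gives a recursive definition of the symbol `LiftedFrame.symb`, and induction on `p` gives its
properties: multiplicativity (`symb_dwedge`), kernel (`mem_filt_succ`), surjectivity
(`exists_symb_eq`), behaviour under `d` (`symb_extD`). `LiftedFrame.IsClass.d1` identifies the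
differential of the first page; `exists_closedClass_eq`, `closedClass_eq_zero_iff` and
`topToClosed_mem_coboundaries` are the diagram chase.

Geometry enters through `exists_liftedFrame`: finitely many functions whose differentials span every
cotangent space (`exists_immersive`) give local frames, which are glued by a partition of unity and
lifted through local trivializations. Derivations at a point are directional derivatives, by
Hadamard's lemma; this also shows that forms of degree above `n` vanish. -/

/-! ### Cartan calculus for forms on derivations -/

section CartanCalculus

variable {A : Type*} [CommRing A] [Algebra ℝ A]

/-- Interior multiplication `ι_Z ζ = ζ(Z, ⋯)`. -/
def ins {k : ℕ} (Z : VField A) : DForm A (k + 1) →ₗ[A] DForm A k where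
  toFun ζ := ζ.curryLeft Z
  map_add' _ _ := rfl
  map_smul' _ _ := rfl

theorem ins_apply {k : ℕ} (Z : VField A) (ζ : DForm A (k + 1)) (v : Fin k → VField A) :
    ins Z ζ v = ζ (Fin.cons Z v) := rfl

/-- The engine of the Cartan identities below: inserting a field lowers the degree, so each identity
follows by induction on the degree from the commutation rules with `ins`. -/
theorem DForm.ext_ins {k : ℕ} {ζ ζ' : DForm A (k + 1)}
    (h : ∀ Z : VField A, ins Z ζ = ins Z ζ') : ζ = ζ' := by
  ext v
  have := congrArg (fun η : DForm A k => η (Fin.tail v)) (h (v 0))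
  simpa only [ins_apply, Fin.cons_self_tail] using this

theorem ins_sub_left {k : ℕ} (Y Z : VField A) (ζ : DForm A (k + 1)) :
    ins (Y - Z) ζ = ins Y ζ - ins Z ζ := map_sub ζ.curryLeft Y Z

theorem ins_smul_left {k : ℕ} (a : A) (Z : VField A) (ζ : DForm A (k + 1)) :
    ins (a • Z) ζ = a • ins Z ζ := map_smul ζ.curryLeft a Z

theorem ins_sum_left {k : ℕ} {ι : Type*} (s : Finset ι) (Z : ι → VField A) (ζ : DForm A (k + 1)) :
    ins (∑ i ∈ s, Z i) ζ = ∑ i ∈ s, ins (Z i) ζ := map_sum ζ.curryLeft Z s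

theorem ins_ins {k : ℕ} (Y Z : VField A) (ζ : DForm A (k + 2)) :
    ins Y (ins Z ζ) = - ins Z (ins Y ζ) := by
  ext v
  have h := ζ.map_swap (Fin.cons Y (Fin.cons Z v : Fin (k + 1) → VField A))
    (i := 0) (j := 1) (by simp)
  rw [AlternatingMap.neg_apply, ins_apply, ins_apply, ins_apply, ins_apply, ← h]
  congr 1
  ext1 i
  refine Fin.cases ?_ (fun i => ?_) i
  · simp
  · refine Fin.cases ?_ (fun i => ?_) i
    · simp
    · have hs : Equiv.swap (0 : Fin (k + 2)) 1 i.succ.succ = i.succ.succ :=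
        Equiv.swap_apply_of_ne_of_ne (Fin.succ_ne_zero _)
          fun h => Fin.succ_ne_zero i (Fin.succ_injective _ h)
      simp [hs]

theorem lieD_add {k : ℕ} (X : VField A) (ζ η : DForm A k) :
    lieD X (ζ + η) = lieD X ζ + lieD X η := by
  ext v
  simp only [lieD_apply, AlternatingMap.add_apply, map_add, Finset.sum_add_distrib]
  ring

theorem DForm.sum_apply {k : ℕ} {ι : Type*} (s : Finset ι) (ζ : ι → DForm A k)
    (v : Fin k → VField A) : (∑ i ∈ s, ζ i) v = ∑ i ∈ s, ζ i v := by
  classical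
  induction s using Finset.induction_on with
  | empty => simp
  | insert i s hi ih => rw [Finset.sum_insert hi, Finset.sum_insert hi, AlternatingMap.add_apply, ih]

/-- The Lie derivative as a real-linear map. -/
noncomputable def lieDₗ {k : ℕ} (X : VField A) : DForm A k →ₗ[ℝ] DForm A k where
  toFun := lieD X
  map_add' := lieD_add X
  map_smul' c ζ := by
    ext v
    simp only [lieD_apply, AlternatingMap.smul_apply, Derivation.map_smul, RingHom.id_apply, smul_sub,
      Finset.smul_sum]

theorem lieD_sub {k : ℕ} (X : VField A) (ζ η : DForm A k) :
    lieD X (ζ - η) = lieD X ζ - lieD X η := map_sub (lieDₗ X) ζ η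

theorem lieD_smul {k : ℕ} (X : VField A) (a : A) (ζ : DForm A k) :
    lieD X (a • ζ) = X a • ζ + a • lieD X ζ := by
  ext v
  simp only [lieD_apply, AlternatingMap.smul_apply, AlternatingMap.add_apply, smul_eq_mul,
    Derivation.leibniz, mul_sub, Finset.mul_sum]
  ring

theorem DForm.ext_zero {ζ ζ' : DForm A 0} (h : ζ ![] = ζ' ![]) : ζ = ζ' := by
  ext v
  rwa [Subsingleton.elim v ![]]

theorem lieD_zero_apply (X : VField A) (ζ : DForm A 0) (v : Fin 0 → VField A) :
    lieD X ζ v = X (ζ v) := by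
  simp [lieD_apply]

theorem ins_lieD {k : ℕ} (X Y : VField A) (ζ : DForm A (k + 1)) :
    ins Y (lieD X ζ) = lieD X (ins Y ζ) - ins ⁅X, Y⁆ ζ := by
  ext v
  simp only [AlternatingMap.sub_apply, ins_apply, lieD_apply, Fin.sum_univ_succ, Fin.cons_zero,
    Fin.cons_succ, ← Fin.cons_update]
  rw [show Function.update (Fin.cons Y v : Fin (k + 1) → VField A) 0 ⁅X, Y⁆ = Fin.cons ⁅X, Y⁆ v from
    Fin.update_cons_zero _ _ _]
  ring

theorem lieD_bracket {k : ℕ} (X Y : VField A) (ζ : DForm A k) :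
    lieD ⁅X, Y⁆ ζ = lieD X (lieD Y ζ) - lieD Y (lieD X ζ) := by
  induction k with
  | zero =>
    refine DForm.ext_zero ?_
    simp only [AlternatingMap.sub_apply, lieD_zero_apply, Derivation.commutator_apply]
  | succ k ih =>
    refine DForm.ext_ins fun W => ?_
    have hj : ⁅⁅X, Y⁆, W⁆ = ⁅X, ⁅Y, W⁆⁆ - ⁅Y, ⁅X, W⁆⁆ := by rw [lie_lie]
    simp only [map_sub, ins_lieD, lieD_sub, ih, hj, ins_sub_left]
    abel

/-- Cartan's formula. -/
theorem ins_extD {k : ℕ} (X : VField A) (ζ : DForm A (k + 1)) :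
    ins X (extD (k + 1) ζ) = lieD X ζ - extD k (ins X ζ) := by
  ext v
  exact koszul_cons ζ X v

theorem ins_extD_zero (X : VField A) (ζ : DForm A 0) :
    ins X (extD 0 ζ) = lieD X ζ := by
  refine DForm.ext_zero ?_
  rw [ins_apply, extD_apply, koszul_zero, lieD_zero_apply]
  rfl

theorem extD_lieD {k : ℕ} (X : VField A) (ζ : DForm A k) :
    extD k (lieD X ζ) = lieD X (extD k ζ) := by
  induction k with
  | zero =>
    refine DForm.ext_ins fun Y => ?_
    rw [ins_lieD, ins_extD_zero, ins_extD_zero, ins_extD_zero, lieD_bracket]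
    abel
  | succ k ih =>
    refine DForm.ext_ins fun Y => ?_
    rw [ins_lieD, ins_extD, ins_extD, ins_extD, lieD_bracket, ins_lieD, map_sub, ih, lieD_sub]
    abel

/-- By Cartan's formula `ι_Y d d ζ = L_Y dζ - d L_Y ζ + d d ι_Y ζ`; the first two terms cancel since
`d` commutes with Lie derivatives, and the last is the previous degree. -/
theorem extD_extD {k : ℕ} (ζ : DForm A k) : extD (k + 1) (extD k ζ) = 0 := by
  induction k with
  | zero =>
    refine DForm.ext_ins fun Y => ?_
    rw [ins_extD, ins_extD_zero, extD_lieD, sub_self, map_zero]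
  | succ k ih =>
    refine DForm.ext_ins fun Y => ?_
    rw [ins_extD, ins_extD, map_sub, ih, sub_zero, extD_lieD, sub_self, map_zero]

variable (A) in
/-- A function as a `0`-form. -/
def zeroForm : A →ₗ[A] DForm A 0 where
  toFun a := AlternatingMap.constOfIsEmpty A (VField A) (Fin 0) a
  map_add' _ _ := rfl
  map_smul' _ _ := rfl

@[simp] theorem zeroForm_apply (a : A) (v : Fin 0 → VField A) : zeroForm A a v = a := rfl

theorem zeroForm_eval (ζ : DForm A 0) : zeroForm A (ζ ![]) = ζ :=
  DForm.ext_zero rfl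

/-- The exact `1`-form `da`. -/
noncomputable def dfun (a : A) : DForm A 1 := extD 0 (zeroForm A a)

@[simp] theorem dfun_apply (a : A) (v : Fin 1 → VField A) : dfun a v = v 0 a := by
  rw [dfun, extD_apply, koszul_zero, zeroForm_apply]

/-- Left multiplication by the exact `1`-form `da`. -/
noncomputable def dwedge {k : ℕ} (a : A) : DForm A k →ₗ[A] DForm A (k + 1) where
  toFun ζ := oneWedge ζ (dfun a)
  map_add' ζ η := by
    ext v
    simp [oneWedge_apply, mul_add, Finset.sum_add_distrib]
  map_smul' b ζ := by
    ext v
    simp only [oneWedge_apply, AlternatingMap.smul_apply, smul_eq_mul, RingHom.id_apply,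
      Finset.mul_sum]
    refine Finset.sum_congr rfl fun i _ => ?_
    rw [mul_smul_comm, mul_left_comm]

theorem dwedge_apply {k : ℕ} (a : A) (ζ : DForm A k) : dwedge a ζ = oneWedge ζ (dfun a) := rfl

theorem dwedge_eval {k : ℕ} (a : A) (ζ : DForm A k) (v : Fin (k + 1) → VField A) :
    dwedge a ζ v = ∑ i : Fin (k + 1), (-1 : ℤ) ^ (i : ℕ) • (v i a * ζ (i.removeNth v)) := by
  simp only [dwedge_apply, oneWedge_apply, dfun_apply]

theorem ins_dwedge_zero (Z : VField A) (a : A) (ζ : DForm A 0) :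
    ins Z (dwedge a ζ) = Z a • ζ := by
  refine DForm.ext_zero ?_
  rw [ins_apply, dwedge_eval]
  simp only [Fin.sum_univ_succ, Finset.univ_eq_empty, Finset.sum_empty]
  simp

theorem ins_dwedge {k : ℕ} (Z : VField A) (a : A) (ζ : DForm A (k + 1)) :
    ins Z (dwedge a ζ) = Z a • ζ - dwedge a (ins Z ζ) := by
  have hr : ∀ (i : Fin (k + 1)) (u : Fin (k + 1) → VField A),
      i.succ.removeNth (Fin.cons Z u : Fin (k + 2) → VField A) = Fin.cons Z (i.removeNth u) := by
    intro i u
    ext1 l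
    refine Fin.cases ?_ (fun l => ?_) l
    · simp [Fin.removeNth]
    · simp [Fin.removeNth]
  ext v
  simp only [ins_apply, dwedge_eval, AlternatingMap.sub_apply, AlternatingMap.smul_apply]
  rw [Fin.sum_univ_succ]
  simp only [Fin.cons_succ, Fin.cons_zero, hr, Fin.val_succ, pow_succ, mul_neg, mul_one, neg_smul,
    Finset.sum_neg_distrib, Fin.val_zero, pow_zero, one_smul, Fin.removeNth_zero, Fin.tail_cons,
    smul_eq_mul]
  ring

theorem lieD_dwedge {k : ℕ} (X : VField A) (a : A) (ζ : DForm A k) :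
    lieD X (dwedge a ζ) = dwedge (X a) ζ + dwedge a (lieD X ζ) := by
  have hb : ∀ (k : ℕ) (Y : VField A) (η : DForm A k),
      (⁅X, Y⁆ a) • η = X (Y a) • η - Y (X a) • η := fun k Y η => by
    rw [Derivation.commutator_apply]
    exact sub_smul _ _ η
  induction k with
  | zero =>
    refine DForm.ext_ins fun Y => ?_
    simp only [ins_lieD, ins_dwedge_zero, map_add, lieD_smul, hb]
    abel
  | succ k ih =>
    refine DForm.ext_ins fun Y => ?_
    simp only [ins_lieD, ins_dwedge, map_add, map_sub, lieD_smul, lieD_sub, ih, hb]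
    abel

theorem extD_smul {k : ℕ} (a : A) (ζ : DForm A k) :
    extD k (a • ζ) = dwedge a ζ + a • extD k ζ := by
  ext v
  rw [extD_apply, koszul_smul, AlternatingMap.add_apply, dwedge_eval, AlternatingMap.smul_apply,
    extD_apply, smul_eq_mul, add_comm]
  congr 1
  refine Finset.sum_congr rfl fun i _ => ?_
  simp [zsmul_eq_mul]

theorem extD_dwedge {k : ℕ} (a : A) (ζ : DForm A k) :
    extD (k + 1) (dwedge a ζ) = - dwedge a (extD k ζ) := by
  induction k with
  | zero =>
    refine DForm.ext_ins fun Y => ?_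
    simp only [ins_extD, ins_dwedge, ins_dwedge_zero, lieD_dwedge, map_neg, extD_smul,
      ins_extD_zero]
    abel
  | succ k ih =>
    refine DForm.ext_ins fun Y => ?_
    simp only [ins_extD, ins_dwedge, lieD_dwedge, map_neg, map_sub, extD_smul, ih]
    abel

theorem dwedge_dwedge {k : ℕ} (a b : A) (ζ : DForm A k) :
    dwedge a (dwedge b ζ) = - dwedge b (dwedge a ζ) := by
  induction k with
  | zero =>
    refine DForm.ext_ins fun Y => ?_
    simp only [ins_dwedge, ins_dwedge_zero, map_neg, map_smul]
    abel
  | succ k ih =>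
    refine DForm.ext_ins fun Y => ?_
    simp only [ins_dwedge, map_neg, map_smul, map_sub, ih (ζ := ins Y ζ)]
    abel

theorem dwedge_sum_eq {k : ℕ} {ι : Type*} (s : Finset ι) (c f : ι → A) (a : A)
    (h : ∀ Y : VField A, Y a = ∑ i ∈ s, c i * Y (f i)) (ζ : DForm A k) :
    dwedge a ζ = ∑ i ∈ s, c i • dwedge (f i) ζ := by
  have h' : dfun a = ∑ i ∈ s, c i • dfun (f i) := by
    ext v
    simp [DForm.sum_apply, h]
  simp only [dwedge_apply, h', map_sum, map_smul]

/-- The derivation of the algebra of forms extending `v ↦ ∑ i, (v a_i) Z_i`. -/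
theorem sum_dwedge_ins_apply {k : ℕ} {ι : Type*} [Fintype ι] (a : ι → A) (Z : ι → VField A)
    (ζ : DForm A (k + 1)) (v : Fin (k + 1) → VField A) :
    (∑ i, dwedge (a i) (ins (Z i) ζ)) v =
      ∑ l, ζ (Function.update v l (∑ i, v l (a i) • Z i)) := by
  have h : ∀ (l : Fin (k + 1)) (Y : VField A), ζ (Function.update v l Y) =
      (-1 : ℤ) ^ (l : ℕ) • ζ (Fin.cons Y (l.removeNth v)) := by
    intro l Y
    rw [← Fin.insertNth_removeNth, AlternatingMap.map_insertNth]
    rfl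
  simp only [DForm.sum_apply, dwedge_eval, ins_apply, AlternatingMap.map_update_sum,
    AlternatingMap.map_update_smul]
  simp only [h]
  rw [Finset.sum_comm]
  refine Finset.sum_congr rfl fun l _ => Finset.sum_congr rfl fun i _ => ?_
  rw [smul_eq_mul, mul_smul_comm]

end CartanCalculus


/-! ### The filtration by base degree -/

section Filtration

variable {A₀ A : Type*} [CommRing A₀] [CommRing A] [Algebra ℝ A] [Algebra A₀ A]

theorem filt_zero (k : ℕ) : filt A₀ A 0 k = ⊤ := by
  refine eq_top_iff.2 fun ζ _ v S hS hv => ?_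
  have := Finset.card_le_univ S
  rw [Fintype.card_fin] at this
  omega

theorem filt_eq_bot {p k : ℕ} (h : k < p) : filt A₀ A p k = ⊥ := by
  refine eq_bot_iff.2 fun ζ hζ => ?_
  rw [Submodule.mem_bot]
  ext v
  exact hζ v ∅ (by simp; omega) (by simp)

theorem filt_succ_le (p k : ℕ) : filt A₀ A (p + 1) k ≤ filt A₀ A p k :=
  fun _ hζ v S hS hv => hζ v S (by omega) hv

theorem ins_mem_filt {p k : ℕ} {ζ : DForm A (k + 1)} (hζ : ζ ∈ filt A₀ A (p + 1) (k + 1))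
    (Z : VField A) : ins Z ζ ∈ filt A₀ A p k := by
  intro v S hS hv
  refine hζ _ (S.map (Fin.succEmb k)) ?_ ?_
  · rw [Finset.card_map]
    omega
  · intro i hi
    obtain ⟨j, hj, rfl⟩ := Finset.mem_map.1 hi
    simpa using hv j hj

/-- Unlike a general insertion, which can cost one step of the filtration, a vertical one costs
nothing: the inserted field counts among the vertical arguments. -/
theorem ins_vertical_mem_filt {p k : ℕ} {ζ : DForm A (k + 1)} (hζ : ζ ∈ filt A₀ A p (k + 1))
    {Z : VField A} (hZ : Z ∈ vertical A₀ A) : ins Z ζ ∈ filt A₀ A p k := by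
  intro v S hS hv
  refine hζ _ (insert 0 (S.map (Fin.succEmb k))) ?_ ?_
  · rw [Finset.card_insert_of_notMem (by simp), Finset.card_map]
    omega
  · intro i hi
    rcases Finset.mem_insert.1 hi with rfl | hi
    · simpa using hZ
    · obtain ⟨j, hj, rfl⟩ := Finset.mem_map.1 hi
      simpa using hv j hj

theorem dwedge_mem_filt {p k : ℕ} {ζ : DForm A k} (hζ : ζ ∈ filt A₀ A p k) (g : A₀) :
    dwedge (algebraMap A₀ A g) ζ ∈ filt A₀ A (p + 1) (k + 1) := by
  intro v S hS hv
  rw [dwedge_eval]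
  refine Finset.sum_eq_zero fun i _ => ?_
  by_cases hi : i ∈ S
  · rw [hv i hi g, zero_mul, smul_zero]
  · rw [hζ (i.removeNth v) (Finset.univ.filter fun l : Fin k => i.succAbove l ∈ S) ?_ ?_, mul_zero,
      smul_zero]
    · have : (Finset.univ.filter fun l : Fin k => i.succAbove l ∈ S).card = S.card := by
        rw [← Finset.card_map i.succAboveEmb]
        congr 1
        ext l
        simp only [Finset.mem_map, Finset.mem_filter, Finset.mem_univ, true_and,
          Fin.succAboveEmb_apply]
        constructor
        · rintro ⟨m, hm, rfl⟩
          exact hm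
        · intro hl
          obtain ⟨m, hm⟩ := Fin.exists_succAbove_eq (x := l) (y := i) fun h => hi (h ▸ hl)
          exact ⟨m, hm.symm ▸ hl, hm⟩
      omega
    · intro l hl
      exact hv _ (Finset.mem_filter.1 hl).2

/-- The bracket of a projectable field with a vertical one is vertical, so no term of `L_Z ζ` has
fewer vertical arguments. -/
theorem lieD_mem_filt [Algebra ℝ A₀] {p k : ℕ} {ζ : DForm A k} (hζ : ζ ∈ filt A₀ A p k)
    {X : VField A₀} {Z : VField A} (hZ : IsLift X Z) : lieD Z ζ ∈ filt A₀ A p k := by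
  intro v S hS hv
  rw [lieD_apply, hζ v S hS hv, map_zero, zero_sub, neg_eq_zero]
  refine Finset.sum_eq_zero fun j _ => hζ _ S hS fun i hi => ?_
  rcases eq_or_ne i j with rfl | hij
  · rw [Function.update_self]
    intro g
    rw [Derivation.commutator_apply, hv i hi g, map_zero, hZ g, hv i hi, sub_zero]
  · rw [Function.update_of_ne hij]
    exact hv i hi

variable (A₀ A) in
/-- The class of a form modulo forms which vanish on the fibres. -/
noncomputable def vmk (q : ℕ) : DForm A q →ₗ[A₀] VForm A₀ A q :=
  Submodule.mkQ _

theorem vmk_eq_zero {q : ℕ} {ζ : DForm A q} : vmk A₀ A q ζ = 0 ↔ ζ ∈ filt A₀ A 1 q :=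
  Submodule.Quotient.mk_eq_zero _

theorem vmk_surjective (q : ℕ) : Function.Surjective (vmk A₀ A q) :=
  Submodule.mkQ_surjective _

theorem vertD_vmk {q : ℕ} (ζ : DForm A q) :
    vertD A₀ A q (vmk A₀ A q ζ) = vmk A₀ A (q + 1) (extD q ζ) := rfl

theorem vertD_vertD {q : ℕ} (x : VForm A₀ A q) : vertD A₀ A (q + 1) (vertD A₀ A q x) = 0 := by
  obtain ⟨ζ, rfl⟩ := vmk_surjective q x
  rw [vertD_vmk, vertD_vmk, extD_extD, map_zero]

end Filtration

/-! ### Lifted frames and the Euler operator on forms with coefficients -/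

/-- A finite system of functions `f` and vector fields `X` on the base with `Y = ∑ j, Y(f_j) X_j`
for every vector field `Y` along the projection, and lifts `H` of the `X`. -/
structure LiftedFrame (A₀ A ι : Type*) [CommRing A₀] [CommRing A] [Algebra ℝ A₀] [Algebra ℝ A]
    [Algebra A₀ A] [Fintype ι] where
  f : ι → A₀
  X : ι → VField A₀
  H : ι → VField A
  base_expand : ∀ (Y : VField A₀) (g : A₀), Y g = ∑ j, Y (f j) * X j g
  total_expand : ∀ (W : VField A) (g : A₀),
    W (algebraMap A₀ A g) = ∑ j, W (algebraMap A₀ A (f j)) * algebraMap A₀ A (X j g)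
  lift : ∀ j, IsLift (X j) (H j)

theorem natCast_succ_smul_cancel {R N : Type*} [CommRing R] [Algebra ℝ R] [AddCommGroup N]
    [Module R N] (p : ℕ) {x y : N} (h : ((p + 1 : ℕ) : R) • x = ((p + 1 : ℕ) : R) • y) : x = y := by
  have hi : algebraMap ℝ R ((p + 1 : ℕ) : ℝ)⁻¹ * ((p + 1 : ℕ) : R) = 1 := by
    rw [← map_natCast (algebraMap ℝ R), ← map_mul, inv_mul_cancel₀ (by positivity), map_one]
  have := congrArg (algebraMap ℝ R ((p + 1 : ℕ) : ℝ)⁻¹ • ·) h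
  simpa only [smul_smul, hi, one_smul] using this

section BaseTensor

variable {R : Type*} [CommRing R] [Algebra ℝ R] (N : Type*) [AddCommGroup N] [Module R N]

/-- Multiplication by `dg` on forms with coefficients. -/
noncomputable abbrev dwedgeT {p : ℕ} (g : R) : DForm R p ⊗[R] N →ₗ[R] DForm R (p + 1) ⊗[R] N :=
  (dwedge g).rTensor N

/-- Interior multiplication on forms with coefficients. -/
noncomputable abbrev insT {p : ℕ} (Y : VField R) : DForm R (p + 1) ⊗[R] N →ₗ[R] DForm R p ⊗[R] N :=
  (ins Y).rTensor N

variable {N}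

theorem dwedgeT_dwedgeT {p : ℕ} (g h : R) (t : DForm R p ⊗[R] N) :
    dwedgeT N g (dwedgeT N h t) + dwedgeT N h (dwedgeT N g t) = 0 := by
  induction t with
  | zero => simp
  | add x y hx hy =>
    rw [map_add, map_add, map_add, map_add, add_add_add_comm, hx, hy, add_zero]
  | tmul η n =>
    rw [LinearMap.rTensor_tmul, LinearMap.rTensor_tmul, LinearMap.rTensor_tmul,
      LinearMap.rTensor_tmul, ← TensorProduct.add_tmul, dwedge_dwedge, neg_add_cancel,
      TensorProduct.zero_tmul]

theorem insT_dwedgeT_zero (Y : VField R) (g : R) (t : DForm R 0 ⊗[R] N) :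
    insT N Y (dwedgeT N g t) = Y g • t := by
  induction t with
  | zero => simp
  | add x y hx hy => simp only [map_add, hx, hy, smul_add]
  | tmul η n =>
    rw [LinearMap.rTensor_tmul, LinearMap.rTensor_tmul, ins_dwedge_zero, TensorProduct.smul_tmul']

theorem insT_dwedgeT {p : ℕ} (Y : VField R) (g : R) (t : DForm R (p + 1) ⊗[R] N) :
    insT N Y (dwedgeT N g t) + dwedgeT N g (insT N Y t) = Y g • t := by
  induction t with
  | zero => simp
  | add x y hx hy =>
    rw [map_add, map_add, map_add, map_add, add_add_add_comm, hx, hy, smul_add]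
  | tmul η n =>
    rw [LinearMap.rTensor_tmul, LinearMap.rTensor_tmul, LinearMap.rTensor_tmul,
      LinearMap.rTensor_tmul, ← TensorProduct.add_tmul, ins_dwedge, sub_add_cancel,
      TensorProduct.smul_tmul']

theorem eq_add_of_add_eq_of_add_eq_zero {G : Type*} [AddMonoid G] {a b c d : G} (h : a + b = c)
    (h' : b + d = 0) : a = c + d := by
  rw [← h, add_assoc, h', add_zero]

variable {A ι : Type*} [CommRing A] [Algebra ℝ A] [Algebra R A] [Fintype ι]
  (Φ : LiftedFrame R A ι)

theorem LiftedFrame.sum_smul_X (Y : VField R) : ∑ j, Y (Φ.f j) • Φ.X j = Y := by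
  ext g
  rw [Φ.base_expand Y g, ← Derivation.coeFnAddMonoidHom_apply, map_sum, Finset.sum_apply]
  rfl

/-- The Euler identity: the operator replaces each of the `p + 1` arguments in turn by its frame
expansion, which is the argument itself. -/
theorem LiftedFrame.sum_dwedge_ins {p : ℕ} (η : DForm R (p + 1)) :
    ∑ j, dwedge (Φ.f j) (ins (Φ.X j) η) = ((p + 1 : ℕ) : R) • η := by
  ext v
  rw [sum_dwedge_ins_apply]
  simp [Φ.sum_smul_X]

theorem LiftedFrame.sum_dwedgeT_insT {p : ℕ} (t : DForm R (p + 1) ⊗[R] N) :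
    ∑ j, dwedgeT N (Φ.f j) (insT N (Φ.X j) t) = ((p + 1 : ℕ) : R) • t := by
  induction t with
  | zero => simp
  | add x y hx hy => simp only [map_add, Finset.sum_add_distrib, hx, hy, smul_add]
  | tmul η n =>
    simp only [LinearMap.rTensor_tmul]
    rw [← TensorProduct.sum_tmul, Φ.sum_dwedge_ins, TensorProduct.smul_tmul']

/-- This is `dg = ∑ (X_j g) df_j`, the frame expansion read on differentials. -/
theorem LiftedFrame.sum_smul_dwedgeT {p : ℕ} (g : R) (t : DForm R p ⊗[R] N) :
    ∑ j, Φ.X j g • dwedgeT N (Φ.f j) t = dwedgeT N g t := by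
  induction t with
  | zero => simp
  | add x y hx hy => simp only [map_add, smul_add, Finset.sum_add_distrib, hx, hy]
  | tmul η n =>
    simp only [LinearMap.rTensor_tmul, TensorProduct.smul_tmul']
    rw [← TensorProduct.sum_tmul]
    congr 1
    refine (dwedge_sum_eq Finset.univ (fun j => Φ.X j g) Φ.f g (fun Y => ?_) η).symm
    rw [Φ.base_expand Y g]
    exact Finset.sum_congr rfl fun j _ => mul_comm _ _

end BaseTensor

/-! ### The symbol: graded pieces of the filtration -/

section Symbol

variable {A₀ A ι : Type*} [CommRing A₀] [CommRing A] [Algebra ℝ A₀] [Algebra ℝ A] [Algebra A₀ A]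
  [Fintype ι] (Φ : LiftedFrame A₀ A ι)

theorem LiftedFrame.sub_vertical (W : VField A) :
    W - ∑ j, W (algebraMap A₀ A (Φ.f j)) • Φ.H j ∈ vertical A₀ A := by
  intro g
  have h : (∑ j, W (algebraMap A₀ A (Φ.f j)) • Φ.H j) (algebraMap A₀ A g) =
      ∑ j, W (algebraMap A₀ A (Φ.f j)) * Φ.H j (algebraMap A₀ A g) := by
    rw [← Derivation.coeFnAddMonoidHom_apply, map_sum, Finset.sum_apply]
    rfl
  rw [Derivation.sub_apply, h, Φ.total_expand W g, sub_eq_zero]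
  exact Finset.sum_congr rfl fun j _ => by rw [Φ.lift j g]

/-- The operator replaces one argument at a time by its horizontal part. In a vertical slot this
gives zero. In any other slot the error is a vertical argument, one more than `ζ` tolerates, so the
value is unchanged. The operator thus counts the slots outside `S`: there are `p` of them when `S`
is as small as allowed, and otherwise `ζ v = 0`. -/
theorem LiftedFrame.euler_mem_filt {p k : ℕ} {ζ : DForm A (k + 1)}
    (hζ : ζ ∈ filt A₀ A p (k + 1)) :
    ∑ j, dwedge (algebraMap A₀ A (Φ.f j)) (ins (Φ.H j) ζ) - (p : A) • ζ ∈
      filt A₀ A (p + 1) (k + 1) := by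
  intro v S hS hv
  rw [AlternatingMap.sub_apply, sum_dwedge_ins_apply, AlternatingMap.smul_apply]
  set h : VField A → VField A := fun W => ∑ j, W (algebraMap A₀ A (Φ.f j)) • Φ.H j with hh
  have h1 : ∀ l ∈ S, ζ (Function.update v l (h (v l))) = 0 := by
    intro l hl
    refine ζ.map_coord_zero (m := Function.update v l (h (v l))) l ?_
    rw [Function.update_self, hh]
    exact Finset.sum_eq_zero fun j _ => by rw [hv l hl (Φ.f j), zero_smul]
  have h2 : ∀ l, l ∉ S → ζ (Function.update v l (h (v l))) = ζ v := by
    intro l hl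
    have h3 : ζ (Function.update v l (v l - h (v l))) = 0 := by
      refine hζ _ (insert l S) ?_ ?_
      · rw [Finset.card_insert_of_notMem hl]
        omega
      · intro i hi
        rcases eq_or_ne i l with rfl | hil
        · rw [Function.update_self]
          exact Φ.sub_vertical _
        · rw [Function.update_of_ne hil]
          exact hv i (Finset.mem_of_mem_insert_of_ne hi hil)
    rw [AlternatingMap.map_update_sub, Function.update_eq_self, sub_eq_zero] at h3
    exact h3.symm
  have h4 : ∑ l, ζ (Function.update v l (h (v l))) = (Sᶜ.card : A) * ζ v := by
    rw [← Finset.sum_add_sum_compl S, Finset.sum_eq_zero h1, zero_add,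
      Finset.sum_congr rfl fun l hl => h2 l (Finset.mem_compl.1 hl), Finset.sum_const, nsmul_eq_mul]
  rw [h4, smul_eq_mul]
  have hc := Finset.card_compl_add_card S
  rw [Fintype.card_fin] at hc
  by_cases hp : Sᶜ.card = p
  · rw [hp, sub_self]
  · rw [hζ v S (by omega) hv, mul_zero, mul_zero, sub_zero]

/-- The symbol of a form of filtration `p`: its part of base degree `p`, with vertical forms as
coefficients. -/
noncomputable def LiftedFrame.symb : (p q k : ℕ) → k = q + p →
    (DForm A k →ₗ[A₀] DForm A₀ p ⊗[A₀] VForm A₀ A q)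
  | 0, _, k, h => by
    subst h
    exact TensorProduct.mk A₀ (DForm A₀ 0) (VForm A₀ A k) (zeroForm A₀ 1) ∘ₗ vmk A₀ A k
  | p + 1, q, _, h => by
    subst h
    -- The scalar undoes the eigenvalue `p + 1` of the Euler operator. The total degree is a
    -- separate variable `k` with a proof of `k = q + p`, so that sums of degrees need not agree
    -- definitionally.
    exact algebraMap ℝ A₀ ((p + 1 : ℕ) : ℝ)⁻¹ • ∑ j,
      dwedgeT (VForm A₀ A q) (Φ.f j) ∘ₗ LiftedFrame.symb p q (q + p) rfl ∘ₗ
        (ins (Φ.H j)).restrictScalars A₀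

theorem LiftedFrame.symb_zero {q : ℕ} (ζ : DForm A q) :
    Φ.symb 0 q q rfl ζ = zeroForm A₀ 1 ⊗ₜ vmk A₀ A q ζ := rfl

theorem LiftedFrame.symb_succ {p q k : ℕ} (h : k = q + p) (h' : k + 1 = q + (p + 1))
    (ζ : DForm A (k + 1)) :
    ((p + 1 : ℕ) : A₀) • Φ.symb (p + 1) q (k + 1) h' ζ =
      ∑ j, dwedgeT (VForm A₀ A q) (Φ.f j) (Φ.symb p q k h (ins (Φ.H j) ζ)) := by
  subst h
  have hi : ((p + 1 : ℕ) : A₀) * algebraMap ℝ A₀ ((p + 1 : ℕ) : ℝ)⁻¹ = 1 := by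
    rw [← map_natCast (algebraMap ℝ A₀), ← map_mul, mul_inv_cancel₀ (by positivity), map_one]
  rw [LiftedFrame.symb]
  simp only [LinearMap.smul_apply, smul_smul, hi, one_smul, LinearMap.sum_apply]
  rfl

theorem zeroForm_one_tmul_injective {N : Type*} [AddCommGroup N] [Module A₀ N] {x y : N}
    (h : zeroForm A₀ 1 ⊗ₜ[A₀] x = zeroForm A₀ 1 ⊗ₜ[A₀] y) : x = y := by
  let e : DForm A₀ 0 →ₗ[A₀] N →ₗ[A₀] N :=
    { toFun := fun η => η ![] • LinearMap.id
      map_add' := fun _ _ => by simp [add_smul]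
      map_smul' := fun _ _ => by simp [mul_smul] }
  simpa [e] using congrArg (TensorProduct.lift e) h

theorem exists_zeroForm_one_tmul {N : Type*} [AddCommGroup N] [Module A₀ N]
    (t : DForm A₀ 0 ⊗[A₀] N) : ∃ x : N, zeroForm A₀ 1 ⊗ₜ[A₀] x = t := by
  induction t with
  | zero => exact ⟨0, by simp⟩
  | add t t' ht ht' =>
    obtain ⟨x, rfl⟩ := ht
    obtain ⟨y, rfl⟩ := ht'
    exact ⟨x + y, by rw [TensorProduct.tmul_add]⟩
  | tmul η n =>
    refine ⟨η ![] • n, ?_⟩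
    rw [← TensorProduct.smul_tmul, ← map_smul, smul_eq_mul, mul_one, zeroForm_eval]

theorem LiftedFrame.symb_eq_zero {p q k : ℕ} (h : k = q + p) {ζ : DForm A k}
    (hζ : ζ ∈ filt A₀ A (p + 1) k) : Φ.symb p q k h ζ = 0 := by
  induction p generalizing k with
  | zero =>
    obtain rfl : k = q := h
    rw [Φ.symb_zero, vmk_eq_zero.2 hζ, TensorProduct.tmul_zero]
  | succ p ih =>
    obtain ⟨k, rfl⟩ : ∃ k', k = k' + 1 := ⟨q + p, h⟩
    have hk : k = q + p := by omega
    refine natCast_succ_smul_cancel (R := A₀) p ?_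
    rw [smul_zero, Φ.symb_succ hk]
    exact Finset.sum_eq_zero fun j _ => by rw [ih hk (ins_mem_filt hζ _), map_zero]

/-- Multiply by `p + 1` and use `ι_{H_j}(dg ∧ ζ) = (X_j g) ζ - dg ∧ ι_{H_j} ζ`. After wedging with
`df_j` and summing, the first terms give one copy of `dg ∧ symb ζ`; in the second, `df_j` is moved
past `dg` and the recursion gives `p` more copies. -/
theorem LiftedFrame.symb_dwedge {p q k : ℕ} (h : k = q + p) (h' : k + 1 = q + (p + 1)) (g : A₀)
    {ζ : DForm A k} (hζ : ζ ∈ filt A₀ A p k) :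
    Φ.symb (p + 1) q (k + 1) h' (dwedge (algebraMap A₀ A g) ζ) =
      dwedgeT _ g (Φ.symb p q k h ζ) := by
  have hs : ∀ (a : A₀) (ζ : DForm A k),
      Φ.symb p q k h (algebraMap A₀ A a • ζ) = a • Φ.symb p q k h ζ := by
    intro a ζ
    rw [algebraMap_smul, map_smul]
  refine natCast_succ_smul_cancel (R := A₀) p ?_
  rw [Φ.symb_succ h]
  induction p generalizing k with
  | zero =>
    obtain rfl : k = q := h
    have : ∀ j, Φ.symb 0 k k rfl (ins (Φ.H j) (dwedge (algebraMap A₀ A g) ζ)) =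
        Φ.X j g • Φ.symb 0 k k rfl ζ := by
      intro j
      cases k with
      | zero => rw [ins_dwedge_zero, Φ.lift, hs]
      | succ k =>
        -- In base degree `0` the correction term contains `dg`, so it vanishes on the fibres and
        -- dies in `VΛ`.
        have h0 : Φ.symb 0 (k + 1) (k + 1) rfl
            (dwedge (algebraMap A₀ A g) (ins (Φ.H j) ζ)) = 0 :=
          Φ.symb_eq_zero _ (dwedge_mem_filt (p := 0) (by rw [filt_zero]; trivial) g)
        rw [← hs, ← Φ.lift, ← add_zero (Φ.symb 0 (k + 1) (k + 1) rfl (ins (Φ.H j) _)), ← h0, ← map_add, ins_dwedge,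
          sub_add_cancel]
    simp only [this, map_smul, Φ.sum_smul_dwedgeT]
    simp
  | succ p ih =>
    obtain ⟨k, rfl⟩ : ∃ k', k = k' + 1 := ⟨q + p, h⟩
    have hk : k = q + p := by omega
    have h1 : ∀ j, Φ.symb (p + 1) q (k + 1) h
        (ins (Φ.H j) (dwedge (algebraMap A₀ A g) ζ)) +
          dwedgeT _ g (Φ.symb p q k hk (ins (Φ.H j) ζ)) =
        Φ.X j g • Φ.symb (p + 1) q (k + 1) h ζ := by
      intro j
      have hj := ins_mem_filt hζ (Φ.H j)
      have h2 : Φ.symb (p + 1) q (k + 1) h (dwedge (algebraMap A₀ A g) (ins (Φ.H j) ζ)) =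
          dwedgeT _ g (Φ.symb p q k hk (ins (Φ.H j) ζ)) := by
        refine natCast_succ_smul_cancel (R := A₀) p ?_
        refine (Φ.symb_succ hk h _).trans (ih hk h hj fun a ζ => ?_)
        rw [algebraMap_smul, map_smul]
      rw [← h2, ← map_add, ins_dwedge, sub_add_cancel, Φ.lift, hs]
    have h3 : ∀ j, dwedgeT _ (Φ.f j) (Φ.symb (p + 1) q (k + 1) h
        (ins (Φ.H j) (dwedge (algebraMap A₀ A g) ζ))) =
        Φ.X j g • dwedgeT _ (Φ.f j) (Φ.symb (p + 1) q (k + 1) h ζ) +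
          dwedgeT _ g (dwedgeT _ (Φ.f j) (Φ.symb p q k hk (ins (Φ.H j) ζ))) := by
      intro j
      refine eq_add_of_add_eq_of_add_eq_zero ?_ (dwedgeT_dwedgeT _ _ _)
      rw [← map_add, h1, map_smul]
    simp only [h3, Finset.sum_add_distrib, Φ.sum_smul_dwedgeT]
    rw [← map_sum, ← Φ.symb_succ hk h, map_smul]
    push_cast
    simp only [add_smul, one_smul]
    abel

/-- The same count as for `symb_dwedge`. The one copy comes from `∑ X_l(f_j) H_j`, which may replace
`H_l`: they differ by a vertical field, whose insertion keeps the filtration degree and so has zero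
symbol one step lower. -/
theorem LiftedFrame.insT_symb {p q k : ℕ} (h : k = q + p) (h' : k + 1 = q + (p + 1)) (l : ι)
    {ζ : DForm A (k + 1)} (hζ : ζ ∈ filt A₀ A (p + 1) (k + 1)) :
    insT _ (Φ.X l) (Φ.symb (p + 1) q (k + 1) h' ζ) = Φ.symb p q k h (ins (Φ.H l) ζ) := by
  have key : ∑ j, Φ.X l (Φ.f j) • Φ.symb p q k h (ins (Φ.H j) ζ) =
      Φ.symb p q k h (ins (Φ.H l) ζ) := by
    have hv := Φ.symb_eq_zero h (ins_vertical_mem_filt hζ (Φ.sub_vertical (Φ.H l)))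
    rw [ins_sub_left, map_sub, sub_eq_zero] at hv
    rw [hv, ins_sum_left, map_sum]
    refine Finset.sum_congr rfl fun j _ => ?_
    rw [ins_smul_left, Φ.lift, algebraMap_smul, map_smul]
  refine natCast_succ_smul_cancel (R := A₀) p ?_
  rw [← map_smul, Φ.symb_succ h, map_sum]
  induction p generalizing k with
  | zero =>
    simp only [insT_dwedgeT_zero, key]
    simp
  | succ p ih =>
    obtain ⟨k, rfl⟩ : ∃ k', k = k' + 1 := ⟨q + p, h⟩
    have hk : k = q + p := by omega
    have h1 : ∀ j, insT _ (Φ.X l) (Φ.symb (p + 1) q (k + 1) h (ins (Φ.H j) ζ)) =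
        Φ.symb p q k hk (ins (Φ.H l) (ins (Φ.H j) ζ)) := by
      intro j
      refine natCast_succ_smul_cancel (R := A₀) p ?_
      have hj := ins_mem_filt hζ (Φ.H j)
      have hv := Φ.symb_eq_zero hk (ins_vertical_mem_filt hj (Φ.sub_vertical (Φ.H l)))
      rw [ins_sub_left, map_sub, sub_eq_zero] at hv
      rw [← map_smul, Φ.symb_succ hk h, map_sum]
      refine ih hk h hj ?_
      rw [hv, ins_sum_left, map_sum]
      refine Finset.sum_congr rfl fun j _ => ?_
      rw [ins_smul_left, Φ.lift, algebraMap_smul, map_smul]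
    have h2 : ∀ j, insT _ (Φ.X l) (dwedgeT _ (Φ.f j)
        (Φ.symb (p + 1) q (k + 1) h (ins (Φ.H j) ζ))) =
        Φ.X l (Φ.f j) • Φ.symb (p + 1) q (k + 1) h (ins (Φ.H j) ζ) +
          dwedgeT _ (Φ.f j) (Φ.symb p q k hk (ins (Φ.H j) (ins (Φ.H l) ζ))) := by
      intro j
      refine eq_add_of_add_eq_of_add_eq_zero (insT_dwedgeT _ _ _) ?_
      rw [h1, ← map_add, ← map_add, ins_ins, neg_add_cancel, map_zero, map_zero]
    simp only [h2, Finset.sum_add_distrib, key]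
    rw [← Φ.symb_succ hk h]
    push_cast
    simp only [add_smul, one_smul]
    abel

/-- Injectivity of the symbol on graded pieces. For positive `p`, if the symbol vanishes then so do
those of all `ι_{H_j} ζ`, which by induction lie one step deeper; then so does `∑ df_j ∧ ι_{H_j} ζ`,
and by `euler_mem_filt` this is `p ζ` up to `Λ_{p+1}`. -/
theorem LiftedFrame.mem_filt_succ {p q k : ℕ} (h : k = q + p) {ζ : DForm A k}
    (hζ : ζ ∈ filt A₀ A p k) (h0 : Φ.symb p q k h ζ = 0) : ζ ∈ filt A₀ A (p + 1) k := by
  induction p generalizing k with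
  | zero =>
    obtain rfl : k = q := h
    rw [Φ.symb_zero] at h0
    refine vmk_eq_zero.1 (zeroForm_one_tmul_injective (A₀ := A₀) ?_)
    rw [h0, TensorProduct.tmul_zero]
  | succ p ih =>
    obtain ⟨k, rfl⟩ : ∃ k', k = k' + 1 := ⟨q + p, h⟩
    have hk : k = q + p := by omega
    have hj : ∀ j, ins (Φ.H j) ζ ∈ filt A₀ A (p + 1) k := fun j =>
      ih hk (ins_mem_filt hζ _) (by rw [← Φ.insT_symb hk h j hζ, h0, map_zero])
    have he := Φ.euler_mem_filt hζ
    have hs : ∑ j, dwedge (algebraMap A₀ A (Φ.f j)) (ins (Φ.H j) ζ) ∈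
        filt A₀ A (p + 1 + 1) (k + 1) :=
      Submodule.sum_mem _ fun j _ => dwedge_mem_filt (hj j) _
    have hm := Submodule.sub_mem _ hs he
    rw [sub_sub_cancel] at hm
    have hi : algebraMap ℝ A ((p + 1 : ℕ) : ℝ)⁻¹ * ((p + 1 : ℕ) : A) = 1 := by
      rw [← map_natCast (algebraMap ℝ A), ← map_mul, inv_mul_cancel₀ (by positivity), map_one]
    have := Submodule.smul_mem _ (algebraMap ℝ A ((p + 1 : ℕ) : ℝ)⁻¹) hm
    rwa [smul_smul, hi, one_smul] at this

/-- In positive base degree `p`, the Euler identity writes `t` as `(1/p) ∑ df_j ∧ ι_{X_j} t`: lift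
the contractions by induction and wedge back with the pulled-back `df_j`. -/
theorem LiftedFrame.exists_symb_eq {p q k : ℕ} (h : k = q + p)
    (t : DForm A₀ p ⊗[A₀] VForm A₀ A q) : ∃ ζ ∈ filt A₀ A p k, Φ.symb p q k h ζ = t := by
  induction p generalizing k with
  | zero =>
    obtain rfl : k = q := h
    obtain ⟨x, rfl⟩ := exists_zeroForm_one_tmul t
    obtain ⟨ζ, rfl⟩ := vmk_surjective k x
    exact ⟨ζ, by rw [filt_zero]; trivial, rfl⟩
  | succ p ih =>
    obtain ⟨k, rfl⟩ : ∃ k', k = k' + 1 := ⟨q + p, h⟩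
    have hk : k = q + p := by omega
    choose ζ hζ hζt using fun j => ih hk (insT _ (Φ.X j) t)
    have hi : algebraMap ℝ A₀ ((p + 1 : ℕ) : ℝ)⁻¹ * ((p + 1 : ℕ) : A₀) = 1 := by
      rw [← map_natCast (algebraMap ℝ A₀), ← map_mul, inv_mul_cancel₀ (by positivity), map_one]
    refine ⟨algebraMap A₀ A (algebraMap ℝ A₀ ((p + 1 : ℕ) : ℝ)⁻¹) •
      ∑ j, dwedge (algebraMap A₀ A (Φ.f j)) (ζ j), Submodule.smul_mem _ _
        (Submodule.sum_mem _ fun j _ => dwedge_mem_filt (hζ j) _), ?_⟩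
    rw [algebraMap_smul, map_smul, map_sum]
    have : ∀ j, Φ.symb (p + 1) q (k + 1) h (dwedge (algebraMap A₀ A (Φ.f j)) (ζ j)) =
        dwedgeT _ (Φ.f j) (insT _ (Φ.X j) t) := fun j => by
      rw [← hζt j]
      exact Φ.symb_dwedge hk h _ (hζ j)
    simp only [this, Φ.sum_dwedgeT_insT, smul_smul, hi, one_smul]

theorem lTensor_dwedgeT {N N' : Type*} [AddCommGroup N] [Module A₀ N] [AddCommGroup N']
    [Module A₀ N'] (φ : N →ₗ[A₀] N') {p : ℕ} (g : A₀) (t : DForm A₀ p ⊗[A₀] N) :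
    φ.lTensor _ (dwedgeT N g t) = dwedgeT N' g (φ.lTensor _ t) := by
  induction t with
  | zero => simp
  | add x y hx hy => simp only [map_add, hx, hy]
  | tmul η n => simp only [LinearMap.rTensor_tmul, LinearMap.lTensor_tmul]

/-- The differential of the zeroth page. In `ι_{H_j} dζ = L_{H_j} ζ - d ι_{H_j} ζ` the Lie
derivative keeps the filtration degree, so its symbol one step lower is zero; the other term
contributes one sign for each base degree. -/
theorem LiftedFrame.symb_extD {p q k : ℕ} (h : k = q + p) (h' : k + 1 = q + 1 + p)
    {ζ : DForm A k} (hζ : ζ ∈ filt A₀ A p k) :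
    Φ.symb p (q + 1) (k + 1) h' (extD k ζ) =
      (-1 : A₀) ^ p • (vertD A₀ A q).lTensor _ (Φ.symb p q k h ζ) := by
  induction p generalizing k with
  | zero =>
    obtain rfl : k = q := h
    rw [pow_zero, one_smul]
    rfl
  | succ p ih =>
    obtain ⟨k, rfl⟩ : ∃ k', k = k' + 1 := ⟨q + p, h⟩
    have hk : k = q + p := by omega
    refine natCast_succ_smul_cancel (R := A₀) p ?_
    have hj : ∀ j, Φ.symb p (q + 1) (k + 1) (by omega) (ins (Φ.H j) (extD (k + 1) ζ)) =
        (-1 : A₀) ^ (p + 1) • (vertD A₀ A q).lTensor _ (Φ.symb p q k hk (ins (Φ.H j) ζ)) := by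
      intro j
      have he : ins (Φ.H j) (extD (k + 1) ζ) =
          lieD (Φ.H j) ζ + (-1 : A₀) • extD k (ins (Φ.H j) ζ) := by
        rw [ins_extD]
        ext v
        simp [sub_eq_add_neg]
      rw [he, map_add, Φ.symb_eq_zero _ (lieD_mem_filt hζ (Φ.lift j)), map_smul,
        ih hk _ (ins_mem_filt hζ (Φ.H j)), zero_add, smul_smul, pow_succ']
    rw [Φ.symb_succ (q := q + 1) (k := k + 1) (by omega), smul_comm, ← map_smul,
      Φ.symb_succ hk h, map_sum, Finset.smul_sum]
    refine Finset.sum_congr rfl fun j _ => ?_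
    rw [hj, map_smul, lTensor_dwedgeT]

end Symbol


/-! ### Flatness of the forms on the base -/

section Flat

variable {A₀ A ι : Type*} [CommRing A₀] [CommRing A] [Algebra ℝ A₀] [Algebra ℝ A] [Algebra A₀ A]
  [Fintype ι]

/-- By the Euler identity `Λ^{p+1}` is a retract of finitely many copies of `Λ^p`, through the
contractions with the `X_j` and the products with the `df_j`. -/
theorem LiftedFrame.flat_dForm (Φ : LiftedFrame A₀ A ι) (p : ℕ) : Module.Flat A₀ (DForm A₀ p) := by
  induction p with
  | zero =>
    refine Module.Flat.of_linearEquiv (M := A₀) (LinearEquiv.ofBijective (zeroForm A₀) ⟨?_, ?_⟩).symm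
    · intro a b h
      simpa using congrArg (fun η : DForm A₀ 0 => η ![]) h
    · exact fun η => ⟨η ![], zeroForm_eval η⟩
  | succ p ih =>
    have hi : algebraMap ℝ A₀ ((p + 1 : ℕ) : ℝ)⁻¹ * ((p + 1 : ℕ) : A₀) = 1 := by
      rw [← map_natCast (algebraMap ℝ A₀), ← map_mul, inv_mul_cancel₀ (by positivity), map_one]
    have : Module.Flat A₀ (ι → DForm A₀ p) :=
      Module.Flat.of_linearEquiv (DFinsupp.linearEquivFunOnFintype (R := A₀) (M := fun _ : ι => DForm A₀ p)).symm
    refine Module.Flat.of_retract (M := ι → DForm A₀ p)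
      (LinearMap.pi fun j => ins (Φ.X j))
      (algebraMap ℝ A₀ ((p + 1 : ℕ) : ℝ)⁻¹ • ∑ j, dwedge (Φ.f j) ∘ₗ LinearMap.proj j) ?_
    refine LinearMap.ext fun η => ?_
    simp only [LinearMap.comp_apply, LinearMap.smul_apply, LinearMap.sum_apply, LinearMap.proj_apply,
      LinearMap.pi_apply, Φ.sum_dwedge_ins, smul_smul, hi, one_smul, LinearMap.id_apply]

end Flat

/-! ### Vertical cohomology classes and Lie derivatives -/

section VerticalClasses

variable {A₀ A : Type*} [CommRing A₀] [CommRing A] [Algebra ℝ A] [Algebra A₀ A] {q : ℕ}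

theorem IsVertClass.extD_mem {ρ : DForm A q} {c : VertH A₀ A q} (h : IsVertClass ρ c) :
    extD q ρ ∈ filt A₀ A 1 (q + 1) := by
  obtain ⟨z, hz, -⟩ := h
  have := z.2
  rw [LinearMap.mem_ker, hz] at this
  exact vmk_eq_zero.1 this

theorem exists_isVertClass_of_extD_mem {ρ : DForm A q} (h : extD q ρ ∈ filt A₀ A 1 (q + 1)) :
    ∃ c : VertH A₀ A q, IsVertClass ρ c :=
  ⟨_, ⟨vmk A₀ A q ρ, vmk_eq_zero.2 h⟩, rfl, rfl⟩

theorem exists_isVertClass (c : VertH A₀ A q) : ∃ ρ : DForm A q, IsVertClass ρ c := by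
  obtain ⟨z, rfl⟩ := Submodule.mkQ_surjective _ c
  obtain ⟨ρ, hρ⟩ := vmk_surjective q z.1
  exact ⟨ρ, z, hρ.symm, rfl⟩

theorem IsVertClass.unique {ρ : DForm A q} {c c' : VertH A₀ A q} (h : IsVertClass ρ c)
    (h' : IsVertClass ρ c') : c = c' := by
  obtain ⟨z, hz, rfl⟩ := h
  obtain ⟨z', hz', rfl⟩ := h'
  rw [Subtype.ext (hz.trans hz'.symm)]

theorem IsVertClass.add {ρ ρ' : DForm A q} {c c' : VertH A₀ A q} (h : IsVertClass ρ c)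
    (h' : IsVertClass ρ' c') : IsVertClass (ρ + ρ') (c + c') := by
  obtain ⟨z, hz, rfl⟩ := h
  obtain ⟨z', hz', rfl⟩ := h'
  exact ⟨z + z', by rw [Submodule.coe_add, hz, hz']; rfl, rfl⟩

theorem IsVertClass.smul (a : A₀) {ρ : DForm A q} {c : VertH A₀ A q} (h : IsVertClass ρ c) :
    IsVertClass (a • ρ) (a • c) := by
  obtain ⟨z, hz, rfl⟩ := h
  exact ⟨a • z, by rw [Submodule.coe_smul, hz]; rfl, rfl⟩

theorem IsVertClass.sub {ρ ρ' : DForm A q} {c c' : VertH A₀ A q} (h : IsVertClass ρ c)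
    (h' : IsVertClass ρ' c') : IsVertClass (ρ - ρ') (c - c') := by
  obtain ⟨z, hz, rfl⟩ := h
  obtain ⟨z', hz', rfl⟩ := h'
  exact ⟨z - z', by rw [Submodule.coe_sub, hz, hz']; rfl, rfl⟩

theorem isVertClass_zero_of_mem {ρ : DForm A q} (h : ρ ∈ filt A₀ A 1 q) :
    IsVertClass ρ (0 : VertH A₀ A q) :=
  ⟨0, (vmk_eq_zero.2 h).symm, rfl⟩

theorem isVertClass_extD (κ : DForm A q) : IsVertClass (extD q κ) (0 : VertH A₀ A (q + 1)) := by
  refine ⟨⟨vmk A₀ A (q + 1) (extD q κ), ?_⟩, rfl, ?_⟩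
  · rw [LinearMap.mem_ker, vertD_vmk, extD_extD, map_zero]
  · rw [Submodule.Quotient.mk_eq_zero]
    exact ⟨vmk A₀ A q κ, rfl⟩

theorem IsVertClass.eq_zero_iff {ρ : DForm A (q + 1)} :
    IsVertClass ρ (0 : VertH A₀ A (q + 1)) ↔ ∃ κ, ρ - extD q κ ∈ filt A₀ A 1 (q + 1) := by
  constructor
  · rintro ⟨z, hz, h0⟩
    rw [Submodule.Quotient.mk_eq_zero] at h0
    obtain ⟨x, hx⟩ := h0
    obtain ⟨κ, rfl⟩ := vmk_surjective q x
    refine ⟨κ, vmk_eq_zero.1 ?_⟩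
    have h1 : vmk A₀ A (q + 1) (extD q κ) = vmk A₀ A (q + 1) ρ := hx.trans hz
    rw [map_sub, h1, sub_self]
  · rintro ⟨κ, h⟩
    have := (isVertClass_zero_of_mem h).add (isVertClass_extD κ)
    rwa [sub_add_cancel, add_zero] at this

theorem IsVertClass.mem_filt_of_zero {ρ : DForm A 0} (h : IsVertClass ρ (0 : VertH A₀ A 0)) :
    ρ ∈ filt A₀ A 1 0 := by
  obtain ⟨z, hz, h0⟩ := h
  rw [Submodule.Quotient.mk_eq_zero] at h0
  have h1 : z.1 = 0 := h0
  exact vmk_eq_zero.1 (hz.symm.trans h1)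

theorem IsVertClass.lieD_zero [Algebra ℝ A₀] {X : VField A₀} {Z : VField A} (hZ : IsLift X Z)
    {ρ : DForm A q} (h : IsVertClass ρ (0 : VertH A₀ A q)) :
    IsVertClass (lieD Z ρ) (0 : VertH A₀ A q) := by
  cases q with
  | zero => exact isVertClass_zero_of_mem (lieD_mem_filt h.mem_filt_of_zero hZ)
  | succ q =>
    obtain ⟨κ, hκ⟩ := IsVertClass.eq_zero_iff.1 h
    refine IsVertClass.eq_zero_iff.2 ⟨lieD Z κ, ?_⟩
    rw [extD_lieD, ← lieD_sub]
    exact lieD_mem_filt hκ hZ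

/-- The reason why the connection does not depend on the lift. In `L_Y ρ = ι_Y dρ + d ι_Y ρ` the
first term vanishes on the fibres, since `dρ` does and `Y` is vertical, and the second is exact. -/
theorem isVertClass_lieD_vertical {Y : VField A} (hY : Y ∈ vertical A₀ A)
    {ρ : DForm A q} (h : extD q ρ ∈ filt A₀ A 1 (q + 1)) :
    IsVertClass (lieD Y ρ) (0 : VertH A₀ A q) := by
  cases q with
  | zero =>
    rw [← ins_extD_zero]
    exact isVertClass_zero_of_mem (ins_vertical_mem_filt h hY)
  | succ q =>
    refine IsVertClass.eq_zero_iff.2 ⟨ins Y ρ, ?_⟩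
    rw [← ins_extD]
    exact ins_vertical_mem_filt h hY

/-- In positive degree the difference is `da ∧ ι_Z ρ` with `a` a base function; in degree `0` it is
zero. Hence Lie derivatives are linear over base functions in the direction, modulo forms vanishing
on the fibres. -/
theorem lieD_smul_left_sub_mem (a : A₀) (Z : VField A) (ρ : DForm A q) :
    lieD (algebraMap A₀ A a • Z) ρ - a • lieD Z ρ ∈ filt A₀ A 1 q := by
  cases q with
  | zero =>
    have : lieD (algebraMap A₀ A a • Z) ρ - a • lieD Z ρ = 0 := by
      refine DForm.ext_zero ?_
      rw [AlternatingMap.sub_apply, AlternatingMap.smul_apply, lieD_zero_apply, lieD_zero_apply,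
        Derivation.smul_apply, algebraMap_smul, sub_self, AlternatingMap.zero_apply]
    rw [this]
    exact Submodule.zero_mem _
  | succ q =>
    have : lieD (algebraMap A₀ A a • Z) ρ - a • lieD Z ρ =
        dwedge (algebraMap A₀ A a) (ins Z ρ) := by
      have h := ins_extD (algebraMap A₀ A a • Z) ρ
      rw [ins_smul_left, ins_smul_left, extD_smul, ins_extD] at h
      rw [← algebraMap_smul A a (lieD Z ρ)]
      rw [smul_sub, eq_sub_iff_add_eq] at h
      rw [← h]
      abel
    rw [this]
    exact dwedge_mem_filt (p := 0) (by rw [filt_zero]; trivial) a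

theorem lieD_sum_left {ι : Type*} (s : Finset ι) (Z : ι → VField A) (ρ : DForm A q) :
    lieD (∑ j ∈ s, Z j) ρ = ∑ j ∈ s, lieD (Z j) ρ := by
  let L : VField A →+ DForm A q :=
    AddMonoidHom.mk' (fun Z => lieD Z ρ) fun X Y => AlternatingMap.ext (lieD_add_left X Y ρ)
  exact map_sum L Z s

theorem IsVertClass.sum {ι : Type*} (s : Finset ι) {ρ : ι → DForm A q} {c : ι → VertH A₀ A q}
    (h : ∀ j, IsVertClass (ρ j) (c j)) : IsVertClass (∑ j ∈ s, ρ j) (∑ j ∈ s, c j) := by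
  classical
  induction s using Finset.induction_on with
  | empty => exact isVertClass_zero_of_mem (Submodule.zero_mem _)
  | insert i s hi ih =>
    rw [Finset.sum_insert hi, Finset.sum_insert hi]
    exact (h i).add ih

end VerticalClasses

/-! ### The Gauss–Manin connection and its exterior covariant derivative -/

section GaussManin

variable {A₀ A ι : Type*} [CommRing A₀] [CommRing A] [Algebra ℝ A₀] [Algebra ℝ A] [Algebra A₀ A]
  [Fintype ι] (Φ : LiftedFrame A₀ A ι)

theorem exists_isVertClass_lieD {q : ℕ} {X : VField A₀} {Z : VField A} (hZ : IsLift X Z)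
    {ρ : DForm A q} {c : VertH A₀ A q} (h : IsVertClass ρ c) :
    ∃ c' : VertH A₀ A q, IsVertClass (lieD Z ρ) c' := by
  refine exists_isVertClass_of_extD_mem ?_
  rw [extD_lieD]
  exact lieD_mem_filt h.extD_mem hZ

/-- The class of `L_Z ρ` depends only on that of `ρ`, because `L_Z` commutes with `d` and preserves
the forms vanishing on the fibres. This makes the choices in `covD` harmless. -/
theorem IsVertClass.lieD_congr {q : ℕ} {X : VField A₀} {Z : VField A} (hZ : IsLift X Z)
    {ρ ρ' : DForm A q} {c d d' : VertH A₀ A q} (h : IsVertClass ρ c) (h' : IsVertClass ρ' c)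
    (hd : IsVertClass (lieD Z ρ) d) (hd' : IsVertClass (lieD Z ρ') d') : d = d' := by
  have h0 := h.sub h'
  rw [sub_self] at h0
  have h1 := hd.sub hd'
  rw [← lieD_sub] at h1
  exact sub_eq_zero.1 (h1.unique (h0.lieD_zero hZ))

/-- The covariant derivative of vertical classes along `X j`. -/
noncomputable def LiftedFrame.covD (j : ι) (q : ℕ) : VertH A₀ A q →+ VertH A₀ A q :=
  AddMonoidHom.mk'
    (fun c => (exists_isVertClass_lieD (Φ.lift j) (exists_isVertClass c).choose_spec).choose)
    (fun c c' => by
      have h := fun c : VertH A₀ A q =>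
        (exists_isVertClass_lieD (Φ.lift j) (exists_isVertClass c).choose_spec).choose_spec
      refine IsVertClass.lieD_congr (Φ.lift j) (exists_isVertClass _).choose_spec
        ((exists_isVertClass c).choose_spec.add (exists_isVertClass c').choose_spec) (h _) ?_
      rw [lieD_add]
      exact (h c).add (h c'))

theorem LiftedFrame.isVertClass_covD (j : ι) {q : ℕ} {ρ : DForm A q} {c : VertH A₀ A q}
    (h : IsVertClass ρ c) : IsVertClass (lieD (Φ.H j) ρ) (Φ.covD j q c) := by
  obtain ⟨d, hd⟩ := exists_isVertClass_lieD (Φ.lift j) h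
  have : d = Φ.covD j q c := IsVertClass.lieD_congr (Φ.lift j) h (exists_isVertClass c).choose_spec hd
    (exists_isVertClass_lieD (Φ.lift j) (exists_isVertClass c).choose_spec).choose_spec
  exact this ▸ hd

theorem contract_tmul {q : ℕ} (X : VField A₀) (θ : DForm A₀ 1) (c : VertH A₀ A q) :
    contract X (θ ⊗ₜ c) = θ (fun _ => X) • c := rfl

/-- The Gauss–Manin connection. -/
noncomputable def LiftedFrame.gaussManin (q : ℕ) : VertH A₀ A q →+ E1 A₀ A 1 q :=
  ∑ j, (TensorProduct.mk A₀ (DForm A₀ 1) (VertH A₀ A q) (dfun (Φ.f j))).toAddMonoidHom.comp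
    (Φ.covD j q)

theorem LiftedFrame.gaussManin_apply {q : ℕ} (c : VertH A₀ A q) :
    Φ.gaussManin q c = ∑ j, dfun (Φ.f j) ⊗ₜ Φ.covD j q c := by
  rw [LiftedFrame.gaussManin, AddMonoidHom.finsetSum_apply]
  rfl

/-- A lift `Z` of `X` differs from `∑ X(f_j) H_j` by a vertical field, which acts trivially on
classes, and the coefficients `X(f_j)` come out of the Lie derivative modulo forms vanishing on the
fibres. -/
theorem LiftedFrame.isGaussManin_gaussManin (q : ℕ) : IsGaussManin (Φ.gaussManin q) := by
  intro X Z hZ ρ c h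
  have h1 : IsVertClass (∑ j, X (Φ.f j) • lieD (Φ.H j) ρ) (contract X (Φ.gaussManin q c)) := by
    rw [Φ.gaussManin_apply, map_sum]
    refine IsVertClass.sum _ fun j => ?_
    rw [contract_tmul, dfun_apply]
    exact (Φ.isVertClass_covD j h).smul _
  have h2 : ∀ j, IsVertClass
      (lieD (algebraMap A₀ A (X (Φ.f j)) • Φ.H j) ρ - X (Φ.f j) • lieD (Φ.H j) ρ)
      (0 : VertH A₀ A q) := fun j => isVertClass_zero_of_mem (lieD_smul_left_sub_mem _ _ _)
  have h3 := isVertClass_lieD_vertical (Φ.sub_vertical Z) h.extD_mem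
  have h4 := (h3.add (IsVertClass.sum Finset.univ h2)).add h1
  rw [Finset.sum_const_zero, add_zero, zero_add, Finset.sum_sub_distrib, ← lieD_sum_left] at h4
  convert h4 using 1
  have h5 : lieD Z ρ = lieD (Z - ∑ j, Z (algebraMap A₀ A (Φ.f j)) • Φ.H j) ρ +
      lieD (∑ j, algebraMap A₀ A (X (Φ.f j)) • Φ.H j) ρ := by
    simp only [hZ (Φ.f _)]
    conv_lhs => rw [← sub_add_cancel Z (∑ j, algebraMap A₀ A (X (Φ.f j)) • Φ.H j)]
    exact AlternatingMap.ext (lieD_add_left _ _ ρ)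
  rw [h5]
  abel

/-- Since `θ = ∑ θ(X_j) df_j`, an element of `Λ^1(M) ⊗ VH^q` is determined by its contractions;
uniqueness of the connection follows. -/
theorem LiftedFrame.sum_dfun_tmul_contract {q : ℕ} (t : E1 A₀ A 1 q) :
    ∑ j, dfun (Φ.f j) ⊗ₜ contract (Φ.X j) t = t := by
  induction t using TensorProduct.induction_on with
  | zero => simp
  | add x y hx hy => simp only [map_add, TensorProduct.tmul_add, Finset.sum_add_distrib, hx, hy]
  | tmul θ c =>
    simp only [contract_tmul, ← TensorProduct.smul_tmul]
    rw [← TensorProduct.sum_tmul]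
    congr 1
    ext v
    have hc : ∀ u : Fin 1 → VField A₀, θ u = ins (u 0) θ ![] := fun u => by
      rw [ins_apply]
      congr 1
      ext1 i
      rw [Subsingleton.elim i 0, Fin.cons_zero]
    rw [hc v]
    conv_rhs => rw [← Φ.sum_smul_X (v 0)]
    rw [ins_sum_left, DForm.sum_apply, DForm.sum_apply]
    refine Finset.sum_congr rfl fun j _ => ?_
    rw [ins_smul_left, AlternatingMap.smul_apply, AlternatingMap.smul_apply, dfun_apply, hc,
      smul_eq_mul, smul_eq_mul, mul_comm]

theorem LiftedFrame.gaussManin_unique {q : ℕ} {D : VertH A₀ A q →+ E1 A₀ A 1 q}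
    (hD : IsGaussManin D) : D = Φ.gaussManin q := by
  ext1 c
  rw [← Φ.sum_dfun_tmul_contract (D c), ← Φ.sum_dfun_tmul_contract (Φ.gaussManin q c)]
  refine Finset.sum_congr rfl fun j _ => ?_
  obtain ⟨ρ, h⟩ := exists_isVertClass c
  rw [(hD (Φ.X j) (Φ.H j) (Φ.lift j) ρ c h).unique
    (Φ.isGaussManin_gaussManin q (Φ.X j) (Φ.H j) (Φ.lift j) ρ c h)]

theorem LiftedFrame.gaussManin_smul {q : ℕ} (a : A₀) (c : VertH A₀ A q) :
    Φ.gaussManin q (a • c) = dfun a ⊗ₜ c + a • Φ.gaussManin q c := by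
  obtain ⟨ρ, h⟩ := exists_isVertClass c
  have h1 : ∀ j, Φ.covD j q (a • c) = Φ.X j a • c + a • Φ.covD j q c := by
    intro j
    refine (Φ.isVertClass_covD j (h.smul a)).unique ?_
    rw [← algebraMap_smul A a ρ, lieD_smul, Φ.lift j, algebraMap_smul, algebraMap_smul]
    exact (h.smul _).add ((Φ.isVertClass_covD j h).smul _)
  rw [← Φ.sum_dfun_tmul_contract (dfun a ⊗ₜ[A₀] c)]
  simp only [Φ.gaussManin_apply, h1, TensorProduct.tmul_add, Finset.sum_add_distrib, contract_tmul,
    dfun_apply, TensorProduct.tmul_smul, Finset.smul_sum]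

section CovariantExterior

variable {R N : Type*} [CommRing R] [Algebra ℝ R] [AddCommGroup N] [Module R N]

theorem oneWedge_add {p : ℕ} (η η' : DForm R p) :
    oneWedge (η + η') = oneWedge η + oneWedge η' := by
  refine LinearMap.ext fun θ => ?_
  ext v
  simp [oneWedge_apply, mul_add, Finset.sum_add_distrib]

theorem oneWedge_smul {p : ℕ} (a : R) (η : DForm R p) :
    oneWedge (a • η) = a • oneWedge η := by
  refine LinearMap.ext fun θ => ?_
  ext v
  simp only [oneWedge_apply, AlternatingMap.smul_apply, LinearMap.smul_apply, smul_eq_mul,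
    Finset.mul_sum]
  refine Finset.sum_congr rfl fun i _ => ?_
  rw [mul_smul_comm, mul_left_comm]

/-- The value of the exterior covariant derivative on `η ⊗ c`. -/
noncomputable def covExtFun (D : N →+ DForm R 1 ⊗[R] N) {p : ℕ} (η : DForm R p) :
    N →+ DForm R (p + 1) ⊗[R] N where
  toFun c := extD p η ⊗ₜ c + (oneWedge η).rTensor N (D c)
  map_zero' := by simp
  map_add' c c' := by
    rw [TensorProduct.tmul_add, map_add, map_add, add_add_add_comm]

theorem covExtFun_apply (D : N →+ DForm R 1 ⊗[R] N) {p : ℕ} (η : DForm R p) (c : N) :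
    covExtFun D η c = extD p η ⊗ₜ c + (oneWedge η).rTensor N (D c) := rfl

theorem covExtFun_add (D : N →+ DForm R 1 ⊗[R] N) {p : ℕ} (η η' : DForm R p) :
    covExtFun D (η + η') = covExtFun D η + covExtFun D η' := by
  refine AddMonoidHom.ext fun c => ?_
  rw [AddMonoidHom.add_apply, covExtFun_apply, covExtFun_apply, covExtFun_apply, map_add,
    TensorProduct.add_tmul, oneWedge_add, LinearMap.rTensor_add, LinearMap.add_apply,
    add_add_add_comm]

/-- Neither summand of `covExtFun` is balanced over the base functions. The term `da ∧ η ⊗ c` from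
`d(aη)` is exactly the one that the Leibniz rule of `D` produces on the other side, so the sum
descends to the tensor product. -/
theorem covExtFun_smul {D : N →+ DForm R 1 ⊗[R] N}
    (hD : ∀ (a : R) (c : N), D (a • c) = dfun a ⊗ₜ c + a • D c) {p : ℕ} (a : R) (η : DForm R p)
    (c : N) : covExtFun D (a • η) c = covExtFun D η (a • c) := by
  rw [covExtFun_apply, covExtFun_apply, extD_smul, TensorProduct.add_tmul, oneWedge_smul,
    LinearMap.rTensor_smul, LinearMap.smul_apply, hD, map_add, map_smul, LinearMap.rTensor_tmul,
    TensorProduct.tmul_smul, ← dwedge_apply, TensorProduct.smul_tmul']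
  abel

/-- The exterior covariant derivative of a connection, as an additive map. -/
noncomputable def covExtAdd (D : N →+ DForm R 1 ⊗[R] N)
    (hD : ∀ (a : R) (c : N), D (a • c) = dfun a ⊗ₜ c + a • D c) (p : ℕ) :
    DForm R p ⊗[R] N →+ DForm R (p + 1) ⊗[R] N :=
  TensorProduct.liftAddHom
    { toFun := fun η => covExtFun D η
      map_zero' := by
        refine AddMonoidHom.ext fun c => ?_
        have h := covExtFun_smul hD 0 (0 : DForm R p) c
        rwa [zero_smul, zero_smul, map_zero] at h
      map_add' := covExtFun_add D }
    fun a η c => covExtFun_smul hD a η c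

theorem covExtAdd_tmul (D : N →+ DForm R 1 ⊗[R] N)
    (hD : ∀ (a : R) (c : N), D (a • c) = dfun a ⊗ₜ c + a • D c) {p : ℕ} (η : DForm R p) (c : N) :
    covExtAdd D hD p (η ⊗ₜ c) = extD p η ⊗ₜ c + (oneWedge η).rTensor N (D c) := rfl

/-- The exterior covariant derivative of a connection. -/
noncomputable def covExt (D : N →+ DForm R 1 ⊗[R] N)
    (hD : ∀ (a : R) (c : N), D (a • c) = dfun a ⊗ₜ c + a • D c) (p : ℕ) :
    DForm R p ⊗[R] N →ₗ[ℝ] DForm R (p + 1) ⊗[R] N where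
  toFun := covExtAdd D hD p
  map_add' := map_add _
  map_smul' r t := by
    rw [RingHom.id_apply]
    induction t using TensorProduct.induction_on with
    | zero => simp
    | add x y hx hy => simp only [smul_add, map_add, hx, hy]
    | tmul η c =>
      have : oneWedge (r • η) = algebraMap ℝ R r • oneWedge η := by
        rw [← oneWedge_smul, algebraMap_smul]
      rw [TensorProduct.smul_tmul', covExtAdd_tmul, covExtAdd_tmul, this, map_smul, smul_add,
        LinearMap.rTensor_smul, LinearMap.smul_apply, algebraMap_smul, TensorProduct.smul_tmul']

end CovariantExterior

/-- The differential `d_1^{p,q}`. -/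
noncomputable def LiftedFrame.d1 (p q : ℕ) : E1 A₀ A p q →ₗ[ℝ] E1 A₀ A (p + 1) q :=
  covExt (Φ.gaussManin q) Φ.gaussManin_smul p

theorem LiftedFrame.d1_tmul_eq {p q : ℕ} (η : DForm A₀ p) (c : VertH A₀ A q) :
    Φ.d1 p q (η ⊗ₜ c) =
      extD p η ⊗ₜ c + (oneWedge η).rTensor (VertH A₀ A q) (Φ.gaussManin q c) := rfl

theorem LiftedFrame.isGaussManinD_d1 : IsGaussManinD Φ.d1 :=
  ⟨Φ.gaussManin, Φ.isGaussManin_gaussManin, fun _ _ η c => Φ.d1_tmul_eq η c⟩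

theorem LiftedFrame.eq_d1 {d : ∀ p q : ℕ, E1 A₀ A p q →ₗ[ℝ] E1 A₀ A (p + 1) q}
    (h : IsGaussManinD d) : d = Φ.d1 := by
  obtain ⟨D, hD, hd⟩ := h
  funext p q
  refine LinearMap.ext fun t => ?_
  induction t using TensorProduct.induction_on with
  | zero => simp
  | add x y hx hy => rw [map_add, map_add, hx, hy]
  | tmul η c =>
    rw [hd, Φ.gaussManin_unique (hD q)]
    exact (Φ.d1_tmul_eq η c).symm

theorem LiftedFrame.existsUnique_isGaussManinD (Ψ : LiftedFrame A₀ A ι) :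
    ∃! d : ∀ p q : ℕ, E1 A₀ A p q →ₗ[ℝ] E1 A₀ A (p + 1) q, IsGaussManinD d := by
  exact ⟨Ψ.d1, Ψ.isGaussManinD_d1, fun d hd => Ψ.eq_d1 hd⟩

theorem LiftedFrame.d1_tmul {p q : ℕ} (η : DForm A₀ p) (c : VertH A₀ A q) :
    Φ.d1 p q (η ⊗ₜ c) = extD p η ⊗ₜ c + ∑ j, dwedge (Φ.f j) η ⊗ₜ Φ.covD j q c := by
  refine (Φ.d1_tmul_eq η c).trans ?_
  rw [Φ.gaussManin_apply, map_sum]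
  rfl

/-- Like `d`, `d_1` anticommutes with multiplication by an exact `1`-form; the comparison of the two
is propagated from base degree `0` in this way. -/
theorem LiftedFrame.d1_dwedgeT {p q : ℕ} (g : A₀) (t : E1 A₀ A p q) :
    Φ.d1 (p + 1) q (dwedgeT _ g t) + dwedgeT _ g (Φ.d1 p q t) = 0 := by
  induction t using TensorProduct.induction_on with
  | zero => simp
  | add x y hx hy =>
    rw [map_add, map_add, map_add, map_add, add_add_add_comm, hx, hy, add_zero]
  | tmul η c =>
    rw [LinearMap.rTensor_tmul, Φ.d1_tmul, Φ.d1_tmul, map_add, map_sum, add_add_add_comm,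
      ← Finset.sum_add_distrib, LinearMap.rTensor_tmul, ← TensorProduct.add_tmul, extD_dwedge,
      neg_add_cancel, TensorProduct.zero_tmul, zero_add]
    refine Finset.sum_eq_zero fun j _ => ?_
    rw [LinearMap.rTensor_tmul, ← TensorProduct.add_tmul, dwedge_dwedge, neg_add_cancel,
      TensorProduct.zero_tmul]

/-- Multiplication by `-1` stands in for subtraction, so that only the additive monoid structure of
a tensor product is needed. -/
theorem add_neg_one_smul_eq_zero {R M : Type*} [Ring R] [AddCommMonoid M] [Module R M] (x : M) :
    x + (-1 : R) • x = 0 := by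
  conv_lhs => rw [← one_smul R x, smul_smul, ← add_smul, mul_one, add_neg_cancel, zero_smul]

theorem eq_neg_one_smul_of_add_eq_zero {R M : Type*} [Ring R] [AddCommMonoid M] [Module R M]
    {x y : M} (h : x + y = 0) : x = (-1 : R) • y := by
  rw [← zero_add ((-1 : R) • y), ← h, add_assoc, add_neg_one_smul_eq_zero, add_zero]

theorem LinearMap.map_sub_eq_zero_of_eq {R M N : Type*} [Ring R] [AddCommGroup M] [Module R M]
    [AddCommMonoid N] [Module R N] (φ : M →ₗ[R] N) {x y : M} (h : φ x = φ y) : φ (x - y) = 0 := by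
  have : x - y = x + (-1 : R) • y := by rw [neg_smul, one_smul, sub_eq_add_neg]
  rw [this, map_add, map_smul, h, add_neg_one_smul_eq_zero]

theorem LiftedFrame.d1_dwedgeT_eq {p q : ℕ} (g : A₀) (t : E1 A₀ A p q) :
    Φ.d1 (p + 1) q (dwedgeT _ g t) = (-1 : A₀) • dwedgeT _ g (Φ.d1 p q t) :=
  eq_neg_one_smul_of_add_eq_zero (Φ.d1_dwedgeT g t)

end GaussManin


/-! ### The first page: classes in `Λ^p(M) ⊗ VH^q` -/

section VerticalCohomology

variable {A₀ A : Type*} [CommRing A₀] [CommRing A] [Algebra ℝ A] [Algebra A₀ A]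

variable (A₀ A) in
/-- The cohomology class of a vertically closed vertical form. -/
noncomputable def vertClass (q : ℕ) :
    ↥(LinearMap.ker (vertD A₀ A q)) →ₗ[A₀] VertH A₀ A q :=
  Submodule.mkQ _

theorem vertClass_surjective (q : ℕ) : Function.Surjective (vertClass A₀ A q) :=
  Submodule.mkQ_surjective _

theorem vertClass_eq_zero {q : ℕ} {x : ↥(LinearMap.ker (vertD A₀ A q))} :
    vertClass A₀ A q x = 0 ↔ x.1 ∈ coboundaries (C := VForm A₀ A) (vertD A₀ A) q :=
  Submodule.Quotient.mk_eq_zero _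

variable (A₀ A) in
/-- The vertical differential, with values in the closed vertical forms. -/
noncomputable def vertDClosed (q : ℕ) :
    VForm A₀ A q →ₗ[A₀] ↥(LinearMap.ker (vertD A₀ A (q + 1))) :=
  (vertD A₀ A q).codRestrict _ fun x => vertD_vertD x

theorem subtype_comp_vertDClosed (q : ℕ) :
    (LinearMap.ker (vertD A₀ A (q + 1))).subtype ∘ₗ vertDClosed A₀ A q = vertD A₀ A q := rfl

theorem exact_vertDClosed_vertClass (q : ℕ) :
    Function.Exact (vertDClosed A₀ A q) (vertClass A₀ A (q + 1)) := by
  intro x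
  rw [vertClass_eq_zero]
  constructor
  · rintro ⟨y, hy⟩
    exact ⟨y, Subtype.ext hy⟩
  · rintro ⟨y, rfl⟩
    exact ⟨y, rfl⟩

theorem vertClass_zero_injective : Function.Injective (vertClass A₀ A 0) := by
  rw [injective_iff_map_eq_zero]
  intro x hx
  exact Subtype.ext (vertClass_eq_zero.1 hx)

theorem isVertClass_iff {q : ℕ} {ρ : DForm A q} {c : VertH A₀ A q} :
    IsVertClass ρ c ↔ ∃ x : ↥(LinearMap.ker (vertD A₀ A q)), x.1 = vmk A₀ A q ρ ∧
      vertClass A₀ A q x = c := Iff.rfl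

end VerticalCohomology

section FirstPage

variable {A₀ A ι : Type*} [CommRing A₀] [CommRing A] [Algebra ℝ A₀] [Algebra ℝ A] [Algebra A₀ A]
  [Fintype ι] (Φ : LiftedFrame A₀ A ι)

variable (A₀ A) in
/-- The class of a vertically closed form with coefficients. -/
noncomputable abbrev toE1 (p q : ℕ) :
    DForm A₀ p ⊗[A₀] ↥(LinearMap.ker (vertD A₀ A q)) →ₗ[A₀] E1 A₀ A p q :=
  (vertClass A₀ A q).lTensor (DForm A₀ p)

variable (A₀ A) in
/-- The inclusion of vertically closed forms with coefficients. -/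
noncomputable abbrev closedIncl (p q : ℕ) :
    DForm A₀ p ⊗[A₀] ↥(LinearMap.ker (vertD A₀ A q)) →ₗ[A₀] DForm A₀ p ⊗[A₀] VForm A₀ A q :=
  (LinearMap.ker (vertD A₀ A q)).subtype.lTensor (DForm A₀ p)

/-- The form `ζ` has vertically closed symbol, with class `e` in `Λ^p(M) ⊗ VH^q`. -/
def LiftedFrame.IsClass {p q k : ℕ} (h : k = q + p) (ζ : DForm A k) (e : E1 A₀ A p q) : Prop :=
  ∃ z, closedIncl A₀ A p q z = Φ.symb p q k h ζ ∧ toE1 A₀ A p q z = e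

variable {Φ}

theorem LiftedFrame.IsClass.sub {p q k : ℕ} {h : k = q + p} {ζ ζ' : DForm A k}
    {e : E1 A₀ A p q} (hζ : Φ.IsClass h ζ e) (hζ' : Φ.IsClass h ζ' e) :
    Φ.IsClass h (ζ - ζ') 0 := by
  obtain ⟨z, hz, hze⟩ := hζ
  obtain ⟨z', hz', hze'⟩ := hζ'
  refine ⟨z + (-1 : A₀) • z', ?_, ?_⟩
  · have : ζ - ζ' = ζ + (-1 : A₀) • ζ' := by
      ext v
      simp [sub_eq_add_neg]
    rw [this, map_add, map_add, map_smul, map_smul, hz, hz']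
  · rw [map_add, map_smul, hze, hze', add_neg_one_smul_eq_zero]

theorem LiftedFrame.IsClass.add {p q k : ℕ} {h : k = q + p} {ζ ζ' : DForm A k}
    {e e' : E1 A₀ A p q} (hζ : Φ.IsClass h ζ e) (hζ' : Φ.IsClass h ζ' e') :
    Φ.IsClass h (ζ + ζ') (e + e') := by
  obtain ⟨z, hz, rfl⟩ := hζ
  obtain ⟨z', hz', rfl⟩ := hζ'
  exact ⟨z + z', by rw [map_add, map_add, hz, hz'], map_add _ _ _⟩

theorem LiftedFrame.IsClass.smul {p q k : ℕ} {h : k = q + p} {ζ : DForm A k}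
    {e : E1 A₀ A p q} (a : A₀) (hζ : Φ.IsClass h ζ e) : Φ.IsClass h (a • ζ) (a • e) := by
  obtain ⟨z, hz, rfl⟩ := hζ
  exact ⟨a • z, by rw [map_smul, map_smul, hz], map_smul _ _ _⟩

theorem LiftedFrame.IsClass.smul_real {p q k : ℕ} {h : k = q + p} {ζ : DForm A k}
    {e : E1 A₀ A p q} (r : ℝ) (hζ : Φ.IsClass h ζ e) :
    Φ.IsClass h (algebraMap ℝ A₀ r • ζ) (r • e) := by
  rw [← algebraMap_smul A₀ r e]
  exact hζ.smul _

theorem LiftedFrame.isClass_zero_of_mem {p q k : ℕ} {h : k = q + p} {ζ : DForm A k}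
    (hζ : ζ ∈ filt A₀ A (p + 1) k) : Φ.IsClass h ζ 0 :=
  ⟨0, by rw [map_zero, Φ.symb_eq_zero h hζ], map_zero _⟩

theorem LiftedFrame.IsClass.sum {p q k : ℕ} {h : k = q + p} (s : Finset ι) {ζ : ι → DForm A k}
    {e : ι → E1 A₀ A p q} (hζ : ∀ j, Φ.IsClass h (ζ j) (e j)) :
    Φ.IsClass h (∑ j ∈ s, ζ j) (∑ j ∈ s, e j) := by
  choose z hz hz' using hζ
  exact ⟨∑ j ∈ s, z j, by simp only [map_sum, hz], by simp only [map_sum, hz']⟩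

theorem LiftedFrame.IsClass.dwedge_form {p q k : ℕ} {h : k = q + p} (h' : k + 1 = q + (p + 1))
    {ζ : DForm A k} (hζ : ζ ∈ filt A₀ A p k) {e : E1 A₀ A p q} (he : Φ.IsClass h ζ e) (g : A₀) :
    Φ.IsClass h' (dwedge (algebraMap A₀ A g) ζ) (dwedgeT _ g e) := by
  obtain ⟨z, hz, rfl⟩ := he
  refine ⟨dwedgeT _ g z, ?_, lTensor_dwedgeT _ g z⟩
  rw [lTensor_dwedgeT, hz, Φ.symb_dwedge h h' g hζ]

/-- Flatness of `Λ^p(M)` keeps the inclusion of the closed vertical forms injective after tensoring,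
so the symbol determines its closed representative. -/
theorem LiftedFrame.IsClass.unique {p q k : ℕ} {h : k = q + p} {ζ : DForm A k}
    {e e' : E1 A₀ A p q} (hζ : Φ.IsClass h ζ e) (hζ' : Φ.IsClass h ζ e') : e = e' := by
  obtain ⟨z, hz, rfl⟩ := hζ
  obtain ⟨z', hz', rfl⟩ := hζ'
  have := Φ.flat_dForm p
  have hi := Module.Flat.lTensor_preserves_injective_linearMap (M := DForm A₀ p)
    (LinearMap.ker (vertD A₀ A q)).subtype Subtype.val_injective
  rw [hi (hz.trans hz'.symm)]

/-- The symbol of `dζ` vanishes, so `id ⊗ d^V` kills that of `ζ`; by flatness the kernel of `id ⊗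
d^V` is the image of `Λ^p(M) ⊗ ker d^V`. -/
theorem LiftedFrame.exists_isClass_of_extD_mem {p q k : ℕ} (h : k = q + p) {ζ : DForm A k}
    (hζ : ζ ∈ filt A₀ A p k) (hd : extD k ζ ∈ filt A₀ A (p + 1) (k + 1)) :
    ∃ e : E1 A₀ A p q, Φ.IsClass h ζ e := by
  have := Φ.flat_dForm p
  have hex := Module.Flat.lTensor_exact (M := DForm A₀ p)
    (LinearMap.exact_subtype_ker_map (vertD A₀ A q))
  have h1 := Φ.symb_extD h (by omega) hζ
  rw [Φ.symb_eq_zero _ hd] at h1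
  have h2 : (vertD A₀ A q).lTensor (DForm A₀ p) (Φ.symb p q k h ζ) = 0 := by
    have h3 := congrArg (fun t => (-1 : A₀) ^ p • t) h1
    simpa only [smul_zero, smul_smul, ← mul_pow, neg_mul_neg, one_mul, one_pow, one_smul,
      eq_comm] using h3
  obtain ⟨z, hz⟩ := (hex _).1 h2
  exact ⟨_, z, hz, rfl⟩

theorem LiftedFrame.IsClass.extD_mem {p q k : ℕ} {h : k = q + p} {ζ : DForm A k}
    (hζ : ζ ∈ filt A₀ A p k) {e : E1 A₀ A p q} (he : Φ.IsClass h ζ e) :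
    extD k ζ ∈ filt A₀ A (p + 1) (k + 1) := by
  obtain ⟨z, hz, -⟩ := he
  refine Φ.mem_filt_succ (q := q + 1) (by omega) (extD_mem_filt A₀ hζ) ?_
  rw [Φ.symb_extD h (by omega) hζ, ← hz, ← LinearMap.comp_apply, ← LinearMap.lTensor_comp]
  have : vertD A₀ A q ∘ₗ (LinearMap.ker (vertD A₀ A q)).subtype = 0 := by
    ext x
    exact x.2
  rw [this, LinearMap.lTensor_zero, LinearMap.zero_apply, smul_zero]

variable (Φ) in
theorem LiftedFrame.exists_isClass_eq {p q k : ℕ} (h : k = q + p) (e : E1 A₀ A p q) :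
    ∃ ζ ∈ filt A₀ A p k, Φ.IsClass h ζ e := by
  obtain ⟨z, rfl⟩ := LinearMap.lTensor_surjective (DForm A₀ p) (vertClass_surjective q) e
  obtain ⟨ζ, hζ, h1⟩ := Φ.exists_symb_eq h (closedIncl A₀ A p q z)
  exact ⟨ζ, hζ, z, h1.symm, rfl⟩

/-- Exact forms have class zero. -/
theorem LiftedFrame.isClass_extD {p q k : ℕ} (h : k = q + p) (h' : k + 1 = q + 1 + p)
    {ζ : DForm A k} (hζ : ζ ∈ filt A₀ A p k) :
    Φ.IsClass h' (extD k ζ) (0 : E1 A₀ A p (q + 1)) := by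
  refine ⟨(-1 : A₀) ^ p • (vertDClosed A₀ A q).lTensor (DForm A₀ p) (Φ.symb p q k h ζ), ?_, ?_⟩
  · rw [Φ.symb_extD h h' hζ, map_smul, ← LinearMap.comp_apply, ← LinearMap.lTensor_comp,
      subtype_comp_vertDClosed]
  · rw [map_smul, ← LinearMap.comp_apply, ← LinearMap.lTensor_comp,
      (exact_vertDClosed_vertClass q).linearMap_comp_eq_zero, LinearMap.lTensor_zero,
      LinearMap.zero_apply, smul_zero]

theorem lTensor_exact_vertDClosed (p q : ℕ) :
    Function.Exact ((vertDClosed A₀ A q).lTensor (DForm A₀ p)) (toE1 A₀ A p (q + 1)) :=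
  lTensor_exact (DForm A₀ p) (exact_vertDClosed_vertClass q) (vertClass_surjective _)

theorem exists_of_toE1_eq_zero {p q : ℕ}
    {z : DForm A₀ p ⊗[A₀] ↥(LinearMap.ker (vertD A₀ A (q + 1)))} (h : toE1 A₀ A p (q + 1) z = 0) :
    ∃ t, (vertDClosed A₀ A q).lTensor (DForm A₀ p) t = z :=
  (lTensor_exact_vertDClosed p q z).1 h

/-- By right exactness of the tensor product, class zero means that the symbol is `id ⊗ d^V` of some
`t`. A form with symbol `(-1)^p t` then works, the sign cancelling the one in `symb_extD`. -/
theorem LiftedFrame.IsClass.exists_extD {p q k : ℕ} {h : k + 1 = q + 1 + p} {ζ : DForm A (k + 1)}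
    (hζ : ζ ∈ filt A₀ A p (k + 1)) (he : Φ.IsClass h ζ (0 : E1 A₀ A p (q + 1))) :
    ∃ κ ∈ filt A₀ A p k, ζ - extD k κ ∈ filt A₀ A (p + 1) (k + 1) := by
  obtain ⟨z, hz, h0⟩ := he
  obtain ⟨t, rfl⟩ := exists_of_toE1_eq_zero h0
  have hk : k = q + p := by omega
  obtain ⟨κ, hκ, hκt⟩ := Φ.exists_symb_eq hk ((-1 : A₀) ^ p • t)
  refine ⟨κ, hκ, Φ.mem_filt_succ h (Submodule.sub_mem _ hζ (extD_mem_filt A₀ hκ)) ?_⟩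
  rw [← LinearMap.comp_apply, ← LinearMap.lTensor_comp, subtype_comp_vertDClosed] at hz
  refine LinearMap.map_sub_eq_zero_of_eq _ ?_
  rw [Φ.symb_extD hk h hκ, hκt, map_smul, smul_smul, ← mul_pow, neg_mul_neg, one_mul,
    one_pow, one_smul, ← hz]

theorem LiftedFrame.IsClass.mem_filt_of_zero {p k : ℕ} {h : k = 0 + p} {ζ : DForm A k}
    (hζ : ζ ∈ filt A₀ A p k) (he : Φ.IsClass h ζ (0 : E1 A₀ A p 0)) :
    ζ ∈ filt A₀ A (p + 1) k := by
  obtain ⟨z, hz, h0⟩ := he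
  have := Φ.flat_dForm p
  have hi := Module.Flat.lTensor_preserves_injective_linearMap (M := DForm A₀ p)
    (vertClass A₀ A 0) vertClass_zero_injective
  have hz0 : z = 0 := hi (h0.trans (map_zero _).symm)
  exact Φ.mem_filt_succ h hζ (by rw [← hz, hz0, map_zero])

/-- The map induced by `d` on classes is well defined. For `q > 0`, `ζ` is `dκ` plus a form one step
deeper, so `dζ` is the differential of that deeper form. For `q = 0` the form itself is zero, as its
degree is only `p`. -/
theorem LiftedFrame.IsClass.extD_zero {p q k : ℕ} {h : k = q + p} (h' : k + 1 = q + (p + 1))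
    {ζ : DForm A k} (hζ : ζ ∈ filt A₀ A p k) (he : Φ.IsClass h ζ 0) :
    Φ.IsClass h' (extD k ζ) 0 := by
  cases q with
  | zero =>
    have h1 := he.mem_filt_of_zero hζ
    rw [filt_eq_bot (by omega), Submodule.mem_bot] at h1
    rw [h1, map_zero]
    exact LiftedFrame.isClass_zero_of_mem (Submodule.zero_mem _)
  | succ q =>
    obtain ⟨k, rfl⟩ : ∃ k', k = k' + 1 := ⟨q + p, by omega⟩
    obtain ⟨κ, hκ, h1⟩ := he.exists_extD hζ
    have h2 := LiftedFrame.isClass_extD (Φ := Φ) (q := q) (by omega) h' h1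
    rwa [map_sub, extD_extD, sub_zero] at h2

theorem LiftedFrame.IsClass.of_natCast_smul {p q k n : ℕ} {h : k = q + p}
    {ζ : DForm A k} {e : E1 A₀ A p q}
    (he : Φ.IsClass h (((n + 1 : ℕ) : A₀) • ζ) (((n + 1 : ℕ) : A₀) • e)) : Φ.IsClass h ζ e := by
  have hi : algebraMap ℝ A₀ ((n + 1 : ℕ) : ℝ)⁻¹ * ((n + 1 : ℕ) : A₀) = 1 := by
    rw [← map_natCast (algebraMap ℝ A₀), ← map_mul, inv_mul_cancel₀ (by positivity), map_one]
  have h7 := he.smul (algebraMap ℝ A₀ ((n + 1 : ℕ) : ℝ)⁻¹)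
  rw [smul_smul, smul_smul, hi] at h7
  have e1 : (1 : A₀) • ζ = ζ := one_smul _ _
  have e2 : (1 : A₀) • e = e := one_smul _ _
  rwa [e1, e2] at h7

/-- The differential on the first page is induced by the de Rham differential. -/
theorem LiftedFrame.IsClass.d1 {p q k : ℕ} {h : k = q + p} (h' : k + 1 = q + (p + 1))
    {ζ : DForm A k} (hζ : ζ ∈ filt A₀ A p k) {e : E1 A₀ A p q} (he : Φ.IsClass h ζ e) :
    Φ.IsClass h' (extD k ζ) (Φ.d1 p q e) := by
  induction p generalizing k with
  | zero =>
    obtain rfl : k = q := h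
    obtain ⟨z, hz, rfl⟩ := he
    obtain ⟨x, rfl⟩ := exists_zeroForm_one_tmul z
    rw [LinearMap.lTensor_tmul, Φ.symb_zero] at hz
    have hx : x.1 = vmk A₀ A k ζ := zeroForm_one_tmul_injective hz
    have hc : IsVertClass ζ (vertClass A₀ A k x) := isVertClass_iff.2 ⟨x, hx, rfl⟩
    -- By Cartan's formula `ι_{H_j} dζ` is `L_{H_j} ζ` up to an exact form, so its class is the
    -- covariant derivative.
    have hj : ∀ j, IsVertClass (ins (Φ.H j) (extD k ζ))
        (Φ.covD j k (vertClass A₀ A k x)) := by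
      intro j
      have h1 := Φ.isVertClass_covD j hc
      cases k with
      | zero => rwa [ins_extD_zero]
      | succ k =>
        have h2 := h1.sub (isVertClass_extD (A₀ := A₀) (ins (Φ.H j) ζ))
        rwa [sub_zero, ← ins_extD] at h2
    choose y hy hy' using fun j => isVertClass_iff.1 (hj j)
    have h0 : extD 0 (zeroForm A₀ 1) = 0 := by
      ext v
      rw [extD_apply, koszul_zero, zeroForm_apply, Derivation.map_one_eq_zero]
      rfl
    refine ⟨∑ j, dwedge (Φ.f j) (zeroForm A₀ 1) ⊗ₜ y j, ?_, ?_⟩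
    · refine natCast_succ_smul_cancel (R := A₀) 0 ?_
      rw [Φ.symb_succ rfl, show ((0 + 1 : ℕ) : A₀) = 1 by simp, one_smul, map_sum]
      refine Finset.sum_congr rfl fun j _ => ?_
      rw [LinearMap.lTensor_tmul, Submodule.subtype_apply, hy]
      rfl
    · rw [LinearMap.lTensor_tmul, Φ.d1_tmul, h0, TensorProduct.zero_tmul, map_sum]
      refine Eq.trans (Finset.sum_congr rfl fun j _ => ?_) (zero_add _).symm
      rw [LinearMap.lTensor_tmul, hy']
  | succ p ih =>
    obtain ⟨k, rfl⟩ : ∃ k', k = k' + 1 := ⟨q + p, h⟩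
    have hk : k = q + p := by omega
    -- By the Euler identity `∑ df_j ∧ ζ'_j` has the same class as `(p + 1) ζ`. The claim for it
    -- follows from the induction hypothesis, as `d` and `d_1` both anticommute with `df_j ∧`;
    -- `extD_zero` takes care of the difference.
    choose ζ' hζ' hc using fun j => Φ.exists_isClass_eq hk (insT _ (Φ.X j) e)
    have h1 := LiftedFrame.IsClass.sum Finset.univ fun j => (hc j).dwedge_form h (hζ' j) (Φ.f j)
    have h2 : ∀ j, Φ.IsClass h' (extD (k + 1) (dwedge (algebraMap A₀ A (Φ.f j)) (ζ' j)))
        (Φ.d1 (p + 1) q (dwedgeT _ (Φ.f j) (insT _ (Φ.X j) e))) := by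
      intro j
      have h3 := ((ih h (hζ' j) (hc j)).dwedge_form h' ((hc j).extD_mem (hζ' j)) (Φ.f j)).smul (-1)
      have h4 : extD (k + 1) (dwedge (algebraMap A₀ A (Φ.f j)) (ζ' j)) =
          (-1 : A₀) • dwedge (algebraMap A₀ A (Φ.f j)) (extD k (ζ' j)) := by
        rw [extD_dwedge]
        ext v
        simp
      rw [h4, Φ.d1_dwedgeT_eq]
      exact h3
    have h3 := LiftedFrame.IsClass.sum Finset.univ h2
    rw [Φ.sum_dwedgeT_insT] at h1
    rw [← map_sum, ← map_sum, Φ.sum_dwedgeT_insT] at h3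
    have hm : ∑ j, dwedge (algebraMap A₀ A (Φ.f j)) (ζ' j) ∈ filt A₀ A (p + 1) (k + 1) :=
      Submodule.sum_mem _ fun j _ => dwedge_mem_filt (hζ' j) _
    have h4 := he.smul ((p + 1 : ℕ) : A₀)
    have hm' : ((p + 1 : ℕ) : A₀) • ζ ∈ filt A₀ A (p + 1) (k + 1) := by
      rw [← algebraMap_smul A]
      exact Submodule.smul_mem _ _ hζ
    have h5 := (h4.sub h1).extD_zero h' (Submodule.sub_mem _ hm' hm)
    have h6 := h5.add h3
    rw [← map_add, sub_add_cancel, zero_add] at h6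
    -- The maps `d` and `d_1` are not linear over base functions, but they commute with natural
    -- number scalars.
    have h8 := map_natCast_smul (extD (k + 1)) A₀ A₀ (p + 1) ζ
    have h9 := map_natCast_smul (Φ.d1 (p + 1) q) A₀ A₀ (p + 1) e
    rw [h8, h9] at h6
    exact h6.of_natCast_smul

end FirstPage


/-! ### Linear algebra of extensions and cohomology -/

section LinearAlgebra

variable {R V W W' : Type*} [Ring R] [AddCommGroup V] [AddCommGroup W] [AddCommGroup W']
  [Module R V] [Module R W] [Module R W']

theorem LinearMap.exists_comp_eq_of_ker_eq {φ : V →ₗ[R] W'} {ψ : V →ₗ[R] W}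
    (hψ : Function.Surjective ψ) (h : LinearMap.ker φ = LinearMap.ker ψ) :
    ∃ f : W →ₗ[R] W', (∀ v, f (ψ v) = φ v) ∧ Function.Injective f := by
  let f := (LinearMap.ker ψ).liftQ φ h.ge ∘ₗ (ψ.quotKerEquivOfSurjective hψ).symm.toLinearMap
  have hf : ∀ v, f (ψ v) = φ v := by
    intro v
    have : (ψ.quotKerEquivOfSurjective hψ).symm (ψ v) = Submodule.Quotient.mk v :=
      (LinearEquiv.symm_apply_eq _).2 rfl
    change (LinearMap.ker ψ).liftQ φ h.ge ((ψ.quotKerEquivOfSurjective hψ).symm (ψ v)) = φ v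
    rw [this]
    rfl
  refine ⟨f, hf, (injective_iff_map_eq_zero f).2 fun w hw => ?_⟩
  obtain ⟨v, rfl⟩ := hψ w
  rw [hf] at hw
  exact LinearMap.mem_ker.1 (h ▸ LinearMap.mem_ker.2 hw)

theorem nonempty_linearEquiv_prod_of_exact {K U : Type*} [Field K] [Module K V] [Module K W]
    [AddCommMonoid U] [Module K U] {f : V →ₗ[K] W} {g : W →ₗ[K] U} (hf : Function.Injective f)
    (hfg : Function.Exact f g) (hg : Function.Surjective g) : Nonempty (W ≃ₗ[K] V × U) := by
  let := Module.addCommMonoidToAddCommGroup K (M := U)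
  obtain ⟨l, hl⟩ := g.exists_rightInverse_of_surjective (LinearMap.range_eq_top.2 hg)
  exact ⟨(hfg.splitSurjectiveEquiv hf ⟨l, hl⟩).1⟩

theorem nonempty_cohom_equiv_coker {C : ℕ → Type*} [∀ q, AddCommGroup (C q)]
    [∀ q, Module R (C q)] (d : ∀ q, C q →ₗ[R] C (q + 1)) (q : ℕ) (h : d (q + 1) = 0) :
    Nonempty (Cohom d (q + 1) ≃ₗ[R] Coker (d q)) := by
  let π : ↥(LinearMap.ker (d (q + 1))) →ₗ[R] Coker (d q) :=
    (LinearMap.range (d q)).mkQ ∘ₗ (LinearMap.ker (d (q + 1))).subtype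
  have hπ : Function.Surjective π := by
    intro x
    obtain ⟨y, rfl⟩ := Submodule.mkQ_surjective _ x
    exact ⟨⟨y, by rw [LinearMap.mem_ker, h, LinearMap.zero_apply]⟩, rfl⟩
  have hk : (coboundaries d (q + 1)).submoduleOf (LinearMap.ker (d (q + 1))) =
      LinearMap.ker π := by
    rw [LinearMap.ker_comp, Submodule.ker_mkQ]
    rfl
  exact ⟨(Submodule.quotEquivOfEq _ _ hk).trans (π.quotKerEquivOfSurjective hπ)⟩

theorem nonempty_cohom_zero_equiv {U U' : Type*} [AddCommMonoid U] [AddCommMonoid U'] [Module R U]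
    [Module R U'] {C : ℕ → Type*} [∀ q, AddCommGroup (C q)] [∀ q, Module R (C q)]
    (d : ∀ q, C q →ₗ[R] C (q + 1)) (δ : U →ₗ[R] U') (c : ↥(LinearMap.ker (d 0)) →ₗ[R] U)
    (hc : ∀ z, δ (c z) = 0) (hi : ∀ z, c z = 0 → z = 0)
    (hs : ∀ e, δ e = 0 → ∃ z, c z = e) :
    Nonempty (Cohom d 0 ≃ₗ[R] ↥(LinearMap.ker δ)) := by
  let := Module.addCommMonoidToAddCommGroup R (M := U)
  have h0 : (coboundaries d 0).submoduleOf (LinearMap.ker (d 0)) = ⊥ :=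
    eq_bot_iff.2 fun z hz => Subtype.ext hz
  refine ⟨(Submodule.quotEquivOfEqBot _ h0).trans
    (LinearEquiv.ofBijective (c.codRestrict (LinearMap.ker δ) hc) ⟨?_, ?_⟩)⟩
  · exact (injective_iff_map_eq_zero _).2 fun z hz => hi z (congrArg Subtype.val hz)
  · rintro ⟨e, he⟩
    obtain ⟨z, hz⟩ := hs e he
    exact ⟨z, Subtype.ext hz⟩

/-- The cohomology is an extension of a kernel by a cokernel, given a module `T` of cocycles which
exhausts the cocycles of class zero up to coboundaries. -/
theorem exists_cohom_shortExact {U U' : Type*} [AddCommMonoid U] [AddCommMonoid U'] [Module R U]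
    [Module R U'] {C : ℕ → Type*} [∀ q, AddCommGroup (C q)] [∀ q, Module R (C q)]
    (d : ∀ q, C q →ₗ[R] C (q + 1)) {q : ℕ} {T : Type*} [AddCommGroup T] [Module R T]
    (δ : V →ₗ[R] W) (δ' : U →ₗ[R] U')
    (c : ↥(LinearMap.ker (d q)) →ₗ[R] U) (hc : ∀ z, δ' (c z) = 0)
    (hs : ∀ e, δ' e = 0 → ∃ z, c z = e) (τ : T →ₗ[R] ↥(LinearMap.ker (d q)))
    (ρ : T →ₗ[R] W) (hρ : Function.Surjective ρ)
    (hcτ : ∀ z, c z = 0 ↔ ∃ t, z.1 - (τ t).1 ∈ coboundaries d q)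
    (hτρ : ∀ t, (τ t).1 ∈ coboundaries d q ↔ ∃ e, δ e = ρ t) :
    ∃ (f : Coker δ →ₗ[R] Cohom d q) (g : Cohom d q →ₗ[R] ↥(LinearMap.ker δ')),
      Function.Injective f ∧ Function.Exact f g ∧ Function.Surjective g := by
  let := Module.addCommMonoidToAddCommGroup R (M := U)
  let B := (coboundaries d q).submoduleOf (LinearMap.ker (d q))
  let c' : ↥(LinearMap.ker (d q)) →ₗ[R] ↥(LinearMap.ker δ') := c.codRestrict _ hc
  have hle : B ≤ LinearMap.ker c' := by
    intro z hz
    -- The case `t = 0` of `hcτ` says that coboundaries have class zero.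
    refine LinearMap.mem_ker.2 (Subtype.ext ((hcτ z).2 ⟨0, ?_⟩))
    rw [map_zero]
    exact (sub_zero z.1).symm ▸ hz
  -- Both the cohomology class and the class in the cokernel are functions on `T` with the same
  -- kernel, so the second determines the first injectively; this is the map `f`.
  have hker : LinearMap.ker (B.mkQ ∘ₗ τ) = LinearMap.ker ((LinearMap.range δ).mkQ ∘ₗ ρ) := by
    rw [LinearMap.ker_comp, LinearMap.ker_comp, Submodule.ker_mkQ, Submodule.ker_mkQ]
    exact Submodule.ext hτρ
  have hsurj : Function.Surjective ((LinearMap.range δ).mkQ ∘ₗ ρ) :=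
    (Submodule.mkQ_surjective _).comp hρ
  obtain ⟨f, hf, hi⟩ := LinearMap.exists_comp_eq_of_ker_eq hsurj hker
  refine ⟨f, B.liftQ c' hle, hi, fun x => ?_, ?_⟩
  · obtain ⟨z, rfl⟩ := Submodule.mkQ_surjective _ x
    have h1 : B.liftQ c' hle (B.mkQ z) = 0 ↔ c z = 0 :=
      ⟨fun h => congrArg Subtype.val h, fun h => Subtype.ext h⟩
    rw [h1, hcτ]
    constructor
    · rintro ⟨t, ht⟩
      refine ⟨(LinearMap.range δ).mkQ (ρ t), (hf t).trans ?_⟩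
      exact ((Submodule.Quotient.eq B).2 ht).symm
    · rintro ⟨y, hy⟩
      obtain ⟨t, rfl⟩ := hsurj y
      refine ⟨t, (Submodule.Quotient.eq B).1 ?_⟩
      exact hy.symm.trans (hf t)
  · rintro ⟨e, he⟩
    obtain ⟨z, hz⟩ := hs e he
    exact ⟨B.mkQ z, Subtype.ext hz⟩

end LinearAlgebra

/-! ### Cohomology of the affine forms: the two-step filtration -/

section AffineForms

variable {A₀ A ι : Type*} [CommRing A₀] [CommRing A] [Algebra ℝ A₀] [Algebra ℝ A] [Algebra A₀ A]

variable (A₀ A) in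
/-- The forms in the `p`-th filtration step whose differential lies in the next one. -/
noncomputable def relCocycles (p k : ℕ) : Submodule ℝ (DForm A k) :=
  (filt A₀ A p k).restrictScalars ℝ ⊓
    ((filt A₀ A (p + 1) (k + 1)).restrictScalars ℝ).comap (extD k)

theorem mem_relCocycles {p k : ℕ} {ζ : DForm A k} : ζ ∈ relCocycles A₀ A p k ↔
    ζ ∈ filt A₀ A p k ∧ extD k ζ ∈ filt A₀ A (p + 1) (k + 1) := Iff.rfl

variable [Fintype ι] [IsScalarTower ℝ A₀ A]

theorem real_smul_dForm (c : ℝ) {k : ℕ} (ζ : DForm A k) : c • ζ = algebraMap ℝ A₀ c • ζ :=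
  AlternatingMap.ext fun v => (algebraMap_smul A₀ c (ζ v)).symm

variable (Φ : LiftedFrame A₀ A ι)

theorem LiftedFrame.exists_isClass_relCocycles {p q k : ℕ} (h : k = q + p)
    (ζ : relCocycles A₀ A p k) : ∃ e : E1 A₀ A p q, Φ.IsClass h ζ.1 e :=
  Φ.exists_isClass_of_extD_mem h (mem_relCocycles.1 ζ.2).1 (mem_relCocycles.1 ζ.2).2

/-- The class in `Λ^p(M) ⊗ VH^q` of a relative cocycle. -/
noncomputable def LiftedFrame.relClass {p q k : ℕ} (h : k = q + p) :
    relCocycles A₀ A p k →ₗ[ℝ] E1 A₀ A p q where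
  toFun ζ := (Φ.exists_isClass_relCocycles h ζ).choose
  map_add' ζ η := (Φ.exists_isClass_relCocycles h (ζ + η)).choose_spec.unique
    ((Φ.exists_isClass_relCocycles h ζ).choose_spec.add
      (Φ.exists_isClass_relCocycles h η).choose_spec)
  map_smul' c ζ := by
    have h1 := (Φ.exists_isClass_relCocycles h ζ).choose_spec.smul_real c
    rw [← real_smul_dForm] at h1
    exact (Φ.exists_isClass_relCocycles h (c • ζ)).choose_spec.unique h1

theorem LiftedFrame.isClass_relClass {p q k : ℕ} (h : k = q + p) (ζ : relCocycles A₀ A p k) :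
    Φ.IsClass h ζ.1 (Φ.relClass h ζ) :=
  (Φ.exists_isClass_relCocycles h ζ).choose_spec

theorem LiftedFrame.IsClass.relClass_eq {Φ : LiftedFrame A₀ A ι} {p q k : ℕ} {h : k = q + p}
    {ζ : relCocycles A₀ A p k} {e : E1 A₀ A p q} (he : Φ.IsClass h ζ.1 e) : Φ.relClass h ζ = e :=
  (Φ.isClass_relClass h ζ).unique he

variable {r : ℕ}

theorem subsingleton_E1 {m : ℕ} (q : ℕ) (h : Subsingleton (DForm A₀ m)) :
    Subsingleton (E1 A₀ A m q) := by
  refine subsingleton_of_forall_eq 0 fun t => ?_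
  induction t using TensorProduct.induction_on with
  | zero => rfl
  | add x y hx hy => rw [hx, hy, add_zero]
  | tmul η c => rw [Subsingleton.elim η 0, TensorProduct.zero_tmul]

/-- Above the base dimension all symbols are zero, so each step is contained in the next; the chain
ends at zero once the filtration index exceeds the degree. The variable `s` bounds the remaining
steps. -/
theorem LiftedFrame.filt_eq_bot_of_lt {m k : ℕ} (Ψ : LiftedFrame A₀ A ι)
    (hs : ∀ m, r + 1 < m → Subsingleton (DForm A₀ m)) (hm : r + 1 < m) :
    filt A₀ A m k = ⊥ := by
  obtain ⟨s, hs'⟩ : ∃ s, k < m + s := ⟨k + 1, by omega⟩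
  induction s generalizing m with
  | zero => exact filt_eq_bot hs'
  | succ s ih =>
    rcases lt_or_ge k m with h | h
    · exact filt_eq_bot h
    obtain ⟨q, rfl⟩ := Nat.exists_eq_add_of_le' h
    rw [eq_bot_iff, ← ih (m := m + 1) (by omega) (by omega)]
    intro ζ hζ
    refine Ψ.mem_filt_succ rfl hζ ?_
    have := hs m hm
    generalize Ψ.symb m q (q + m) rfl ζ = t
    induction t using TensorProduct.induction_on with
    | zero => rfl
    | add x y hx hy => rw [hx, hy, add_zero]
    | tmul η c => rw [Subsingleton.elim η 0, TensorProduct.zero_tmul]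

variable {Φ}

theorem LiftedFrame.IsClass.eq_extD_of_top {q k : ℕ} {h : k + 1 = q + (r + 1)}
    {ζ : DForm A (k + 1)} (hs : ∀ m, r + 1 < m → Subsingleton (DForm A₀ m))
    (hζ : ζ ∈ filt A₀ A (r + 1) (k + 1)) (he : Φ.IsClass h ζ 0) :
    ∃ κ ∈ filt A₀ A (r + 1) k, ζ = extD k κ := by
  have hb : ∀ k, filt A₀ A (r + 1 + 1) k = ⊥ :=
    fun k => Φ.filt_eq_bot_of_lt hs (Nat.lt_succ_self _)
  cases q with
  | zero =>
    have h1 := he.mem_filt_of_zero hζ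
    rw [hb, Submodule.mem_bot] at h1
    exact ⟨0, Submodule.zero_mem _, by rw [h1, map_zero]⟩
  | succ q =>
    obtain ⟨κ, hκ, h1⟩ := he.exists_extD hζ
    rw [hb, Submodule.mem_bot] at h1
    exact ⟨κ, hκ, sub_eq_zero.1 h1⟩

/-- The relative cocycle given by a closed affine form. -/
noncomputable def closedToRel (r q : ℕ) :
    ↥(LinearMap.ker (omegaD A₀ A r q)) →ₗ[ℝ] relCocycles A₀ A r (r + q) :=
  LinearMap.codRestrict _ ((Submodule.subtype _) ∘ₗ (Submodule.subtype _)) fun z =>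
    mem_relCocycles.2 ⟨z.1.2, by
      have h : extD (r + q) z.1.1 = 0 := congrArg Subtype.val (LinearMap.mem_ker.1 z.2)
      change extD (r + q) z.1.1 ∈ _
      rw [h]
      exact Submodule.zero_mem _⟩

theorem extD_closedToRel {r q : ℕ} (z : ↥(LinearMap.ker (omegaD A₀ A r q))) :
    extD (r + q) (closedToRel r q z).1 = 0 :=
  congrArg Subtype.val (LinearMap.mem_ker.1 z.2)

theorem LiftedFrame.d1_relClass_closedToRel (Ψ : LiftedFrame A₀ A ι) {r q : ℕ}
    (z : ↥(LinearMap.ker (omegaD A₀ A r q))) :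
    Ψ.d1 r q (Ψ.relClass (q := q) (Nat.add_comm r q) (closedToRel r q z)) = 0 := by
  have h1 := (Ψ.isClass_relClass (q := q) (Nat.add_comm r q) (closedToRel r q z)).d1 (by omega)
    (mem_relCocycles.1 (closedToRel r q z).2).1
  rw [extD_closedToRel] at h1
  exact h1.unique (LiftedFrame.isClass_zero_of_mem (Submodule.zero_mem _))

/-- The class of a closed affine form. -/
noncomputable def LiftedFrame.closedClass (Ψ : LiftedFrame A₀ A ι) (r q : ℕ) :
    ↥(LinearMap.ker (omegaD A₀ A r q)) →ₗ[ℝ] E1 A₀ A r q :=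
  Ψ.relClass (q := q) (Nat.add_comm r q) ∘ₗ closedToRel r q

theorem LiftedFrame.isClass_closedClass (Ψ : LiftedFrame A₀ A ι) (r q : ℕ)
    (z : ↥(LinearMap.ker (omegaD A₀ A r q))) :
    Ψ.IsClass (Nat.add_comm r q) z.1.1 (Ψ.closedClass r q z) :=
  Ψ.isClass_relClass (q := q) (Nat.add_comm r q) (closedToRel r q z)

theorem LiftedFrame.IsClass.closedClass_eq {Ψ : LiftedFrame A₀ A ι} {r q : ℕ}
    {z : ↥(LinearMap.ker (omegaD A₀ A r q))} {e : E1 A₀ A r q}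
    (he : Ψ.IsClass (Nat.add_comm r q) z.1.1 e) : Ψ.closedClass r q z = e :=
  (Ψ.isClass_closedClass r q z).unique he

theorem LiftedFrame.closedClass_eq_zero {Ψ : LiftedFrame A₀ A ι} {r q : ℕ}
    {z : ↥(LinearMap.ker (omegaD A₀ A r q))} :
    Ψ.closedClass r q z = 0 ↔ Ψ.IsClass (q := q) (Nat.add_comm r q) z.1.1 0 :=
  ⟨fun h => h ▸ Ψ.isClass_closedClass r q z, fun h => h.closedClass_eq⟩

/-- A form `ζ` of class `e` has `dζ` in the top step, with class `d_1 e = 0`. Hence `dζ = dκ` with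
`κ` in the top step; `ζ - κ` is closed and still has class `e`. -/
theorem LiftedFrame.exists_closedClass_eq (Ψ : LiftedFrame A₀ A ι)
    (hs : ∀ m, r + 1 < m → Subsingleton (DForm A₀ m)) (q : ℕ) {e : E1 A₀ A r q}
    (he : Ψ.d1 r q e = 0) : ∃ z, Ψ.closedClass r q z = e := by
  obtain ⟨ζ, hζ, h1⟩ := Ψ.exists_isClass_eq (Nat.add_comm r q) e
  have h2 := h1.d1 (by omega) hζ
  rw [he] at h2
  obtain ⟨κ, hκ, h3⟩ := h2.eq_extD_of_top hs (h1.extD_mem hζ)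
  have h4 := h1.add ((LiftedFrame.isClass_zero_of_mem (h := Nat.add_comm r q) hκ).smul (-1))
  have h5 : (-1 : A₀) • (0 : E1 A₀ A r q) = 0 := smul_zero _
  have h6 : ζ + (-1 : A₀) • κ = ζ - κ := by
    ext v
    simp [sub_eq_add_neg]
  rw [h5, add_zero, h6] at h4
  have h7 : ζ - κ ∈ filt A₀ A r (r + q) := Submodule.sub_mem _ hζ (filt_succ_le _ _ hκ)
  have h8 : (⟨ζ - κ, h7⟩ : Omega A₀ A r q) ∈ LinearMap.ker (omegaD A₀ A r q) := by
    refine LinearMap.mem_ker.2 (Subtype.ext ?_)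
    change extD (r + q) (ζ - κ) = 0
    rw [map_sub, h3]
    exact sub_self _
  exact ⟨⟨⟨ζ - κ, h7⟩, h8⟩, LiftedFrame.IsClass.closedClass_eq (z := ⟨⟨ζ - κ, h7⟩, h8⟩) h4⟩

theorem LiftedFrame.closedClass_zero_injective (Ψ : LiftedFrame A₀ A ι) (r : ℕ)
    (z : ↥(LinearMap.ker (omegaD A₀ A r 0))) (hz : Ψ.closedClass r 0 z = 0) : z = 0 := by
  have h1 := (LiftedFrame.closedClass_eq_zero.1 hz).mem_filt_of_zero z.1.2
  rw [filt_eq_bot (by omega), Submodule.mem_bot] at h1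
  exact Subtype.ext (Subtype.ext h1)

theorem LiftedFrame.extD_eq_zero_of_mem_relCocycles (Ψ : LiftedFrame A₀ A ι)
    (hs : ∀ m, r + 1 < m → Subsingleton (DForm A₀ m)) {k : ℕ} {ζ : DForm A k}
    (hζ : ζ ∈ relCocycles A₀ A (r + 1) k) : extD k ζ = 0 := by
  have h := (mem_relCocycles.1 hζ).2
  rwa [Ψ.filt_eq_bot_of_lt hs (Nat.lt_succ_self _), Submodule.mem_bot] at h

/-- A closed form of top filtration, as a closed affine form. -/
noncomputable def LiftedFrame.topToClosed (Ψ : LiftedFrame A₀ A ι)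
    (hs : ∀ m, r + 1 < m → Subsingleton (DForm A₀ m)) (q : ℕ) :
    relCocycles A₀ A (r + 1) (r + q) →ₗ[ℝ] ↥(LinearMap.ker (omegaD A₀ A r q)) :=
  LinearMap.codRestrict (LinearMap.ker (omegaD A₀ A r q))
    (Submodule.inclusion (p := relCocycles A₀ A (r + 1) (r + q))
      (p' := (filt A₀ A r (r + q)).restrictScalars ℝ)
      fun _ h => filt_succ_le _ _ (mem_relCocycles.1 h).1)
    fun ζ => Subtype.ext (Ψ.extD_eq_zero_of_mem_relCocycles hs ζ.2)

theorem mem_coboundaries_omegaD_succ {q : ℕ} {ζ : Omega A₀ A r (q + 1)} :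
    ζ ∈ coboundaries (C := Omega A₀ A r) (omegaD A₀ A r) (q + 1) ↔
      ∃ κ ∈ filt A₀ A r (r + q), extD (r + q) κ = ζ.1 := by
  constructor
  · rintro ⟨κ, hκ⟩
    exact ⟨κ.1, κ.2, congrArg Subtype.val hκ⟩
  · rintro ⟨κ, hκ, h⟩
    exact ⟨⟨κ, hκ⟩, Subtype.ext h⟩

/-- The connecting map is `d_1`: a primitive `κ` of a top form has a class `e` with `d_1 e` the
class of the form. Conversely, if `κ` has class `e`, the form minus `dκ` has class zero and is exact
within the top step. -/
theorem LiftedFrame.topToClosed_mem_coboundaries (Ψ : LiftedFrame A₀ A ι)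
    (hs : ∀ m, r + 1 < m → Subsingleton (DForm A₀ m)) {q : ℕ} (hq : r + (q + 1) = q + (r + 1))
    (ζ : relCocycles A₀ A (r + 1) (r + (q + 1))) :
    (Ψ.topToClosed hs (q + 1) ζ).1 ∈ coboundaries (C := Omega A₀ A r) (omegaD A₀ A r) (q + 1) ↔
      ∃ e, Ψ.d1 r q e = Ψ.relClass hq ζ := by
  have hζ := (mem_relCocycles.1 ζ.2).1
  have hc := Ψ.isClass_relClass hq ζ
  rw [mem_coboundaries_omegaD_succ]
  constructor
  · rintro ⟨κ, hκ, h⟩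
    have h' : extD (r + q) κ = ζ.1 := h
    have hd : extD (r + q) κ ∈ filt A₀ A (r + 1) (r + q + 1) := by
      rw [h']
      exact hζ
    obtain ⟨e, he⟩ := Ψ.exists_isClass_of_extD_mem (q := q) (k := r + q) (Nat.add_comm r q) hκ hd
    have h1 : Ψ.IsClass hq (extD (r + q) κ) (Ψ.d1 r q e) := he.d1 hq hκ
    rw [h'] at h1
    exact ⟨e, h1.unique hc⟩
  · rintro ⟨e, he⟩
    obtain ⟨κ, hκ, h1⟩ := Ψ.exists_isClass_eq (k := r + q) (Nat.add_comm r q) e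
    have h2 : Ψ.IsClass hq (extD (r + q) κ) (Ψ.d1 r q e) := h1.d1 hq hκ
    rw [he] at h2
    obtain ⟨l, hl, h3⟩ := (hc.sub h2).eq_extD_of_top (k := r + q) hs
      (Submodule.sub_mem _ hζ (h1.extD_mem hκ))
    refine ⟨l + κ, Submodule.add_mem _ (filt_succ_le _ _ hl) hκ, ?_⟩
    rw [map_add]
    exact (sub_eq_iff_eq_add.1 h3).symm

theorem LiftedFrame.relClass_surjective (Ψ : LiftedFrame A₀ A ι) {p q k : ℕ} (h : k = q + p) :
    Function.Surjective (Ψ.relClass h) := by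
  intro e
  obtain ⟨ζ, hζ, h1⟩ := Ψ.exists_isClass_eq h e
  exact ⟨⟨ζ, mem_relCocycles.2 ⟨hζ, h1.extD_mem hζ⟩⟩, LiftedFrame.IsClass.relClass_eq h1⟩

/-- Exactness in the middle: a closed affine form has class zero precisely when a coboundary of
affine forms moves it into the top step. -/
theorem LiftedFrame.closedClass_eq_zero_iff (Ψ : LiftedFrame A₀ A ι)
    (hs : ∀ m, r + 1 < m → Subsingleton (DForm A₀ m)) (q : ℕ)
    (z : ↥(LinearMap.ker (omegaD A₀ A r (q + 1)))) :
    Ψ.closedClass r (q + 1) z = 0 ↔ ∃ ζ, z.1 - (Ψ.topToClosed hs (q + 1) ζ).1 ∈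
      coboundaries (C := Omega A₀ A r) (omegaD A₀ A r) (q + 1) := by
  rw [LiftedFrame.closedClass_eq_zero]
  constructor
  · intro hz
    obtain ⟨κ, hκ, h1⟩ := hz.exists_extD (k := r + q) (ζ := z.1.1) z.1.2
    have h2 : extD (r + q + 1) (z.1.1 - extD (r + q) κ) = 0 := by
      rw [map_sub, extD_extD, sub_zero]
      exact congrArg Subtype.val (LinearMap.mem_ker.1 z.2)
    have h3 : extD (r + (q + 1)) (z.1.1 - extD (r + q) κ) ∈
        filt A₀ A (r + 1 + 1) (r + (q + 1) + 1) := by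
      have h3 : extD (r + (q + 1)) (z.1.1 - extD (r + q) κ) = 0 := h2
      rw [h3]
      exact Submodule.zero_mem _
    refine ⟨⟨z.1.1 - extD (r + q) κ, mem_relCocycles.2 ⟨h1, h3⟩⟩, ?_⟩
    exact mem_coboundaries_omegaD_succ.2 ⟨κ, hκ, (sub_sub_cancel _ _).symm⟩
  · rintro ⟨ζ, hζ⟩
    obtain ⟨κ, hκ, h⟩ := mem_coboundaries_omegaD_succ.1 hζ
    have h1 : z.1.1 = extD (r + q) κ + ζ.1 := by
      rw [h]
      exact (sub_add_cancel _ _).symm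
    rw [h1]
    have h2 := (LiftedFrame.isClass_extD (Φ := Ψ) (q := q) (k := r + q) (Nat.add_comm r q)
      (Nat.add_comm r (q + 1)) hκ).add
      (LiftedFrame.isClass_zero_of_mem (mem_relCocycles.1 ζ.2).1)
    rwa [add_zero] at h2

theorem nonempty_equiv_prod_of_equiv {K V W W' U : Type*} [Field K] [AddCommGroup V]
    [AddCommGroup W] [AddCommGroup W'] [AddCommMonoid U] [Module K V] [Module K W] [Module K W']
    [Module K U] (h : Nonempty (V ≃ₗ[K] W × U)) (h' : Nonempty (W' ≃ₗ[K] W)) :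
    Nonempty (V ≃ₗ[K] W' × U) :=
  ⟨h.some.trans (h'.some.symm.prodCongr (LinearEquiv.refl K U))⟩

theorem eq_zero_of_subsingleton_dForm
    (d : ∀ p q : ℕ, E1 A₀ A p q →ₗ[ℝ] E1 A₀ A (p + 1) q) (p q : ℕ)
    (hs : Subsingleton (DForm A₀ (p + 1))) : d p q = 0 := by
  have := subsingleton_E1 (A₀ := A₀) (A := A) q hs
  exact LinearMap.ext fun _ => Subsingleton.elim _ _

theorem nonempty_E2_equiv_cokerD (d : ∀ p q : ℕ, E1 A₀ A p q →ₗ[ℝ] E1 A₀ A (p + 1) q) (q : ℕ)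
    (h : d (r + 1) q = 0) : Nonempty (E2 d (r + 1) q ≃ₗ[ℝ] CokerD d r q) := by
  refine nonempty_cohom_equiv_coker _ _ ?_
  exact h

theorem LiftedFrame.nonempty_omegaH_zero_equiv (Ψ : LiftedFrame A₀ A ι)
    (hs : ∀ m, r + 1 < m → Subsingleton (DForm A₀ m))
    {d : ∀ p q : ℕ, E1 A₀ A p q →ₗ[ℝ] E1 A₀ A (p + 1) q} (hd : d = Ψ.d1) :
    Nonempty (OmegaH A₀ A r 0 ≃ₗ[ℝ] LinearMap.ker (d r 0)) := by
  have h1 : ∀ z, d r 0 (Ψ.closedClass r 0 z) = 0 := by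
    rw [hd]
    exact Ψ.d1_relClass_closedToRel
  have h2 : ∀ e, d r 0 e = 0 → ∃ z, Ψ.closedClass r 0 z = e := by
    rw [hd]
    exact fun e he => Ψ.exists_closedClass_eq hs 0 he
  refine nonempty_cohom_zero_equiv _ _ ?_ ?_ ?_ ?_
  · exact Ψ.closedClass r 0
  · exact h1
  · exact Ψ.closedClass_zero_injective r
  · exact h2

theorem LiftedFrame.exists_shortExact (Ψ : LiftedFrame A₀ A ι)
    (hs : ∀ m, r + 1 < m → Subsingleton (DForm A₀ m))
    {d : ∀ p q : ℕ, E1 A₀ A p q →ₗ[ℝ] E1 A₀ A (p + 1) q} (hd : d = Ψ.d1) (q : ℕ) :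
    ∃ (f : CokerD d r q →ₗ[ℝ] OmegaH A₀ A r (q + 1))
      (g : OmegaH A₀ A r (q + 1) →ₗ[ℝ] LinearMap.ker (d r (q + 1))),
      Function.Injective f ∧ Function.Exact f g ∧ Function.Surjective g := by
  have hq : r + (q + 1) = q + (r + 1) := by omega
  have h1 : ∀ z, d r (q + 1) (Ψ.closedClass r (q + 1) z) = 0 := by
    rw [hd]
    exact Ψ.d1_relClass_closedToRel
  have h2 : ∀ e, d r (q + 1) e = 0 → ∃ z, Ψ.closedClass r (q + 1) z = e := by
    rw [hd]
    exact fun e he => Ψ.exists_closedClass_eq hs (q + 1) he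
  have h3 : ∀ ζ, (Ψ.topToClosed hs (q + 1) ζ).1 ∈
      coboundaries (C := Omega A₀ A r) (omegaD A₀ A r) (q + 1) ↔
        ∃ e, d r q e = Ψ.relClass hq ζ := by
    rw [hd]
    exact Ψ.topToClosed_mem_coboundaries hs hq
  refine exists_cohom_shortExact (T := relCocycles A₀ A (r + 1) (r + (q + 1)))
    _ _ _ ?_ ?_ ?_ ?_ ?_ ?_ ?_ ?_
  · exact Ψ.closedClass r (q + 1)
  · exact h1
  · exact h2
  · exact Ψ.topToClosed hs (q + 1)
  · exact Ψ.relClass hq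
  · exact Ψ.relClass_surjective hq
  · exact Ψ.closedClass_eq_zero_iff hs q
  · exact h3

theorem LiftedFrame.nonempty_omegaH_equiv_prod (Ψ : LiftedFrame A₀ A ι)
    (hs : ∀ m, r + 1 < m → Subsingleton (DForm A₀ m))
    {d : ∀ p q : ℕ, E1 A₀ A p q →ₗ[ℝ] E1 A₀ A (p + 1) q} (hd : d = Ψ.d1) (q : ℕ) :
    Nonempty (OmegaH A₀ A r (q + 1) ≃ₗ[ℝ] CokerD d r q × LinearMap.ker (d r (q + 1))) := by
  obtain ⟨f, g, hf, hfg, hg⟩ := Ψ.exists_shortExact hs hd q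
  refine nonempty_linearEquiv_prod_of_exact (f := ?_) (g := ?_) ?_ ?_ ?_
  · exact f
  · exact g
  · exact hf
  · exact hfg
  · exact hg

theorem LiftedFrame.nonempty_omegaH_equiv_E2_prod (Ψ : LiftedFrame A₀ A ι)
    (hs : ∀ m, r + 1 < m → Subsingleton (DForm A₀ m))
    {d : ∀ p q : ℕ, E1 A₀ A p q →ₗ[ℝ] E1 A₀ A (p + 1) q} (hd : d = Ψ.d1) (q : ℕ) :
    Nonempty (OmegaH A₀ A r (q + 1) ≃ₗ[ℝ] E2 d (r + 1) q × LinearMap.ker (d r (q + 1))) := by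
  refine nonempty_equiv_prod_of_equiv (W := CokerD d r q) ?_ ?_
  · exact Ψ.nonempty_omegaH_equiv_prod hs hd q
  · exact nonempty_E2_equiv_cokerD d q
      (eq_zero_of_subsingleton_dForm d _ q (hs _ (Nat.lt_succ_self _)))

end AffineForms


/-! ### Hadamard's lemma and point derivations -/

section Hadamard

variable {E : Type*} [NormedAddCommGroup E] [NormedSpace ℝ E]

/-- Smooth dependence of the integral on `u` is drawn from the smoothness of convolutions with
parameters: the integral is the value at `0` of the convolution of the indicator of `[-1, 0]` with
`s ↦ G'(y + s(u - y))`, cut off in `s`. The cut-off is `1` for `|s| ≤ 2`, hence on the range of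
integration. -/
theorem exists_contDiff_eq_integral_fderiv [FiniteDimensional ℝ E] {G : E → ℝ}
    (hG : ContDiff ℝ ∞ G) (y : E) :
    ∃ H : E → E →L[ℝ] ℝ, ContDiff ℝ ∞ H ∧
      ∀ u, H u = ∫ t in (0 : ℝ)..1, fderiv ℝ G (y + t • (u - y)) := by
  let θ : ContDiffBump (0 : ℝ) := ⟨2, 3, by norm_num, by norm_num⟩
  let g : E → ℝ → E →L[ℝ] ℝ := fun p s => θ s • fderiv ℝ G (y + s • (p - y))
  let f : ℝ → ℝ := Set.indicator (Set.Icc (-1) 0) 1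
  have hG' : ContDiff ℝ ∞ (fderiv ℝ G) := hG.fderiv_right (by norm_cast)
  have hg : ContDiff ℝ ∞ (Function.uncurry g) := by
    have h1 : ContDiff ℝ ∞ fun q : E × ℝ => θ q.2 := θ.contDiff.comp contDiff_snd
    have h2 : ContDiff ℝ ∞ fun q : E × ℝ => y + q.2 • (q.1 - y) := by fun_prop
    exact h1.smul (hG'.comp h2)
  have hf : MeasureTheory.LocallyIntegrable f := by
    have : MeasureTheory.Integrable f :=
      (MeasureTheory.integrable_indicator_iff measurableSet_Icc).2
        (MeasureTheory.integrableOn_const (by simp))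
    exact this.locallyIntegrable
  have hc := MeasureTheory.contDiffOn_convolution_right_with_param_comp (n := ⊤)
    (ContinuousLinearMap.lsmul ℝ ℝ : ℝ →L[ℝ] (E →L[ℝ] ℝ) →L[ℝ] E →L[ℝ] ℝ)
    (μ := MeasureTheory.volume) (s := Set.univ) (v := fun _ : E => (0 : ℝ)) contDiffOn_const
    (f := f) (g := g) (k := Metric.closedBall 0 3) isOpen_univ (isCompact_closedBall _ _)
    (fun p x _ hx => by
      have : θ x = 0 := θ.zero_of_le_dist (by
        rw [Metric.mem_closedBall, not_le] at hx
        exact hx.le)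
      simp [g, this]) hf hg.contDiffOn
  refine ⟨_, contDiffOn_univ.1 hc, fun u => ?_⟩
  have h1 : ∀ t, ContinuousLinearMap.lsmul ℝ ℝ (f t) (g u (0 - t)) =
      Set.indicator (Set.Icc (-1) 0) (fun t : ℝ => fderiv ℝ G (y + (-t) • (u - y))) t := by
    intro t
    by_cases ht : t ∈ Set.Icc (-1 : ℝ) 0
    · have hθ : θ (0 - t) = 1 := θ.one_of_mem_closedBall (by
        rw [Metric.mem_closedBall, dist_zero_right, Real.norm_eq_abs, abs_le]
        change -2 ≤ 0 - t ∧ 0 - t ≤ 2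
        constructor <;> linarith [ht.1, ht.2])
      rw [ContinuousLinearMap.lsmul_apply, Set.indicator_of_mem ht]
      simp only [f, g, hθ, Set.indicator_of_mem ht, Pi.one_apply, one_smul]
      rw [zero_sub]
    · rw [ContinuousLinearMap.lsmul_apply, Set.indicator_of_notMem ht]
      simp only [f, Set.indicator_of_notMem ht, zero_smul]
  rw [MeasureTheory.convolution_def]
  simp only [h1]
  rw [MeasureTheory.integral_indicator measurableSet_Icc, MeasureTheory.integral_Icc_eq_integral_Ioc,
    ← intervalIntegral.integral_of_le (by norm_num),
    intervalIntegral.integral_comp_neg fun t => fderiv ℝ G (y + t • (u - y))]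
  norm_num

theorem exists_hadamard [FiniteDimensional ℝ E] {G : E → ℝ} (hG : ContDiff ℝ ∞ G) (y : E) :
    ∃ H : E → E →L[ℝ] ℝ, ContDiff ℝ ∞ H ∧ H y = fderiv ℝ G y ∧
      ∀ u, G u = G y + H u (u - y) := by
  obtain ⟨H, hH, h⟩ := exists_contDiff_eq_integral_fderiv hG y
  have hc : ∀ u, Continuous fun t : ℝ => fderiv ℝ G (y + t • (u - y)) := fun u =>
    (hG.continuous_fderiv (by simp)).comp (by fun_prop)
  refine ⟨H, hH, by simp [h], fun u => ?_⟩
  rw [h, ContinuousLinearMap.intervalIntegral_apply ((hc u).intervalIntegrable _ _)]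
  have h1 : ∀ t ∈ Set.uIcc (0 : ℝ) 1, HasDerivAt (fun t : ℝ => G (y + t • (u - y)))
      (fderiv ℝ G (y + t • (u - y)) (u - y)) t := by
    intro t _
    have h2 : HasDerivAt (fun t : ℝ => y + t • (u - y)) (u - y) t := by
      simpa using ((hasDerivAt_id t).smul_const (u - y)).const_add y
    exact (hG.differentiable (by simp) _).hasFDerivAt.comp_hasDerivAt t h2
  rw [intervalIntegral.integral_eq_sub_of_hasDerivAt h1
    (((hc u).clm_apply continuous_const).intervalIntegrable _ _)]
  simp

end Hadamard

section PointDerivation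

variable {E : Type*} [NormedAddCommGroup E] [NormedSpace ℝ E]
  {M : Type*} [TopologicalSpace M] [ChartedSpace E M]

theorem contMDiffMap_sum_apply {κ : Type*} (s : Finset κ) (f : κ → C^∞⟮𝓘(ℝ, E), M; ℝ⟯) (x : M) :
    (∑ i ∈ s, f i) x = ∑ i ∈ s, f i x := by
  have h := map_sum (ContMDiffMap.coeFnLinearMap (I := 𝓘(ℝ, E)) (N := M) (n := ∞) (𝕜 := ℝ)
    (V := ℝ)) f s
  exact (congrFun h x).trans (Finset.sum_apply _ _ _)

/-- Derivations at the point `y` of the algebra of smooth functions. -/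
def IsPointDer (y : M) (D : C^∞⟮𝓘(ℝ, E), M; ℝ⟯ →ₗ[ℝ] ℝ) : Prop :=
  ∀ f g, D (f * g) = f y * D g + g y * D f

/-- The value of a vector field at a point. -/
noncomputable def VField.evalAt (Y : VField C^∞⟮𝓘(ℝ, E), M; ℝ⟯) (x : M) :
    C^∞⟮𝓘(ℝ, E), M; ℝ⟯ →ₗ[ℝ] ℝ where
  toFun g := Y g x
  map_add' f g := by rw [map_add]; rfl
  map_smul' c f := by rw [Derivation.map_smul]; rfl

theorem VField.isPointDer_evalAt (Y : VField C^∞⟮𝓘(ℝ, E), M; ℝ⟯) (x : M) :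
    IsPointDer x (Y.evalAt x) := fun f g => by
  change Y (f * g) x = f x * Y g x + g x * Y f x
  rw [Derivation.leibniz]
  rfl

end PointDerivation

section Cutoff

variable {E : Type*} [NormedAddCommGroup E] [NormedSpace ℝ E] [FiniteDimensional ℝ E]
  {M : Type*} [TopologicalSpace M] [ChartedSpace E M] [IsManifold 𝓘(ℝ, E) ∞ M]
  [T2Space M] [SecondCountableTopology M]

open scoped Topology

theorem exists_contMDiffMap_cutoff {s U : Set M} (hs : IsClosed s) (hU : IsOpen U) (h : s ⊆ U) :
    ∃ ψ : C^∞⟮𝓘(ℝ, E), M; ℝ⟯, (∀ᶠ x in 𝓝ˢ s, ψ x = 1) ∧ tsupport ψ ⊆ U := by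
  have := Manifold.locallyCompact_of_finiteDimensional (M := M) 𝓘(ℝ, E)
  obtain ⟨V, hV, hsV, hVU⟩ := normal_exists_closure_subset hs hU h
  obtain ⟨ψ, h1, h0, -⟩ := exists_contMDiffMap_one_nhds_of_subset_interior (n := ⊤) 𝓘(ℝ, E) hs
    (hsV.trans (hV.subset_interior_iff.2 subset_closure))
  refine ⟨ψ, h1, (closure_minimal (fun x hx => ?_) isClosed_closure).trans hVU⟩
  by_contra hx'
  exact hx (h0 x hx')

variable {y : M} {D : C^∞⟮𝓘(ℝ, E), M; ℝ⟯ →ₗ[ℝ] ℝ}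

theorem IsPointDer.map_one (hD : IsPointDer y D) : D 1 = 0 := by
  have h := hD 1 1
  simp only [mul_one, ContMDiffMap.coe_one, Pi.one_apply, one_mul] at h
  linarith

theorem IsPointDer.map_const (hD : IsPointDer y D) (c : ℝ) :
    D (algebraMap ℝ _ c) = 0 := by
  rw [Algebra.algebraMap_eq_smul_one, map_smul, hD.map_one, smul_zero]

/-- Locality: choose `ψ` with `ψ y = 1` and `ψ f = 0` and apply the Leibniz rule. -/
theorem IsPointDer.eq_zero_of_eventuallyEq (hD : IsPointDer y D) {f : C^∞⟮𝓘(ℝ, E), M; ℝ⟯}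
    (hf : ∀ᶠ x in 𝓝 y, f x = 0) : D f = 0 := by
  obtain ⟨U, hU, hUo, hy⟩ := eventually_nhds_iff.1 hf
  obtain ⟨ψ, h1, h2⟩ := exists_contMDiffMap_cutoff (E := E) isClosed_singleton hUo
    (Set.singleton_subset_iff.2 hy)
  have hψ : ψ y = 1 := h1.self_of_nhdsSet y rfl
  have : ψ * f = 0 := by
    ext x
    change ψ x * f x = 0
    by_cases hx : x ∈ U
    · rw [hU x hx, mul_zero]
    · rw [image_eq_zero_of_notMem_tsupport fun h => hx (h2 h), zero_mul]
  have h := hD ψ f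
  rw [this, map_zero, hψ, hf.self_of_nhds] at h
  linarith

theorem IsPointDer.congr (hD : IsPointDer y D) {f g : C^∞⟮𝓘(ℝ, E), M; ℝ⟯}
    (hf : ∀ᶠ x in 𝓝 y, f x = g x) : D f = D g := by
  rw [← sub_eq_zero, ← map_sub]
  refine hD.eq_zero_of_eventuallyEq (hf.mono fun x hx => ?_)
  change f x - g x = 0
  rw [hx, sub_self]

/-- A cut-off function near a point times a function smooth near that point. -/
theorem exists_contMDiffMap_eventuallyEq {U : Set M} (hU : IsOpen U) (hy : y ∈ U) {V : Type*}
    [NormedAddCommGroup V] [NormedSpace ℝ V] {h : M → V}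
    (hh : ContMDiffOn 𝓘(ℝ, E) 𝓘(ℝ, V) ∞ h U) :
    ∃ g : C^∞⟮𝓘(ℝ, E), M; 𝓘(ℝ, V), V⟯, ∀ᶠ x in 𝓝 y, g x = h x := by
  obtain ⟨ψ, h1, h2⟩ := exists_contMDiffMap_cutoff (E := E) isClosed_singleton hU
    (Set.singleton_subset_iff.2 hy)
  refine ⟨⟨fun x => ψ x • h x, contMDiff_of_tsupport fun x hx => ?_⟩, ?_⟩
  · have hx' : x ∈ U := h2 (tsupport_smul_subset_left _ _ hx)
    exact ψ.contMDiff.contMDiffAt.smul (hh.contMDiffAt (hU.mem_nhds hx'))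
  · rw [nhdsSet_singleton] at h1
    filter_upwards [h1] with x hx
    change ψ x • h x = h x
    rw [hx, one_smul]

theorem exists_contDiff_eventuallyEq {U : Set E} (hU : IsOpen U) {y : E} (hy : y ∈ U) {h : E → ℝ}
    (hh : ContDiffOn ℝ ∞ h U) : ∃ g : E → ℝ, ContDiff ℝ ∞ g ∧ ∀ᶠ x in 𝓝 y, g x = h x := by
  obtain ⟨g, hg⟩ := exists_contMDiffMap_eventuallyEq hU hy (contMDiffOn_iff_contDiffOn.2 hh)
  exact ⟨g, contMDiff_iff_contDiff.1 g.contMDiff, hg⟩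

/-- A point derivation is a directional derivative in any chart. -/
theorem IsPointDer.exists_eq_fderiv (hD : IsPointDer y D) {x₀ : M}
    (hy : y ∈ (chartAt E x₀).source) :
    ∃ v : E, ∀ g : C^∞⟮𝓘(ℝ, E), M; ℝ⟯,
      D g = fderiv ℝ (g ∘ (chartAt E x₀).symm) (chartAt E x₀ y) v := by
  set φ := chartAt E x₀ with hφ
  have hφs : ContMDiffOn 𝓘(ℝ, E) 𝓘(ℝ, E) ∞ φ φ.source := contMDiffOn_chart
  have hφt : ContMDiffOn 𝓘(ℝ, E) 𝓘(ℝ, E) ∞ φ.symm φ.target := contMDiffOn_chart_symm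
  let b := Module.finBasis ℝ E
  have hb : ∀ i, ∃ c : C^∞⟮𝓘(ℝ, E), M; ℝ⟯, ∀ᶠ x in 𝓝 y, c x = b.coord i (φ x - φ y) := by
    intro i
    refine exists_contMDiffMap_eventuallyEq φ.open_source hy ?_
    have h1 : ContDiff ℝ ∞ fun u : E => b.coord i (u - φ y) := by
      have := (LinearMap.toContinuousLinearMap (b.coord i)).contDiff (n := ∞)
      exact this.comp (contDiff_id.sub contDiff_const)
    exact h1.contMDiff.comp_contMDiffOn hφs
  choose c hc using hb
  -- The `c i` are the centred chart coordinates, cut off. Hadamard's lemma gives `g = g(y) + ∑ c_i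
  -- k_i` near `y`; since `c_i(y) = 0`, only the terms `k_i(y) D(c_i)` survive.
  refine ⟨∑ i, D (c i) • b i, fun g => ?_⟩
  obtain ⟨G, hG, hGg⟩ := exists_contDiff_eventuallyEq φ.open_target (φ.map_source hy)
    (h := g ∘ φ.symm) (contMDiffOn_iff_contDiffOn.1 (g.contMDiff.comp_contMDiffOn hφt))
  obtain ⟨H, hH, hHy, hHG⟩ := exists_hadamard hG (φ y)
  have hk : ∀ i, ∃ k : C^∞⟮𝓘(ℝ, E), M; ℝ⟯, ∀ᶠ x in 𝓝 y, k x = H (φ x) (b i) := by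
    intro i
    refine exists_contMDiffMap_eventuallyEq φ.open_source hy ?_
    have h1 : ContDiff ℝ ∞ fun u : E => H u (b i) := hH.clm_apply contDiff_const
    exact h1.contMDiff.comp_contMDiffOn hφs
  choose k hk using hk
  have hcont : Filter.Tendsto φ (𝓝 y) (𝓝 (φ y)) := φ.continuousAt hy
  have hgk : ∀ᶠ x in 𝓝 y, g x = (algebraMap ℝ C^∞⟮𝓘(ℝ, E), M; ℝ⟯ (g y) + ∑ i, c i * k i) x := by
    have h1 : ∀ᶠ x in 𝓝 y, ∀ i, c i x = b.coord i (φ x - φ y) := Filter.eventually_all.2 hc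
    have h2 : ∀ᶠ x in 𝓝 y, ∀ i, k i x = H (φ x) (b i) := Filter.eventually_all.2 hk
    have h3 := hcont.eventually hGg
    have h4 := φ.open_source.mem_nhds hy
    filter_upwards [h1, h2, h3, h4] with x h1 h2 h3 h4
    have hsum : (∑ i, c i * k i : C^∞⟮𝓘(ℝ, E), M; ℝ⟯) x = ∑ i, c i x * k i x :=
      contMDiffMap_sum_apply _ _ x
    have hy3 := hGg.self_of_nhds
    simp only [Function.comp, φ.left_inv h4, φ.left_inv hy] at h3 hy3
    change g x = g y + (∑ i, c i * k i : C^∞⟮𝓘(ℝ, E), M; ℝ⟯) x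
    rw [hsum, ← h3, hHG, hy3]
    congr 1
    conv_lhs => rw [← b.sum_repr (φ x - φ y)]
    simp [h1, h2]
  rw [hD.congr hgk, map_add, hD.map_const, zero_add, map_sum, ← Filter.EventuallyEq.fderiv_eq hGg, ← hHy, map_sum]
  refine Finset.sum_congr rfl fun i _ => ?_
  rw [hD, (hc i).self_of_nhds, (hk i).self_of_nhds, sub_self, map_zero, zero_mul, zero_add,
    map_smul, smul_eq_mul, mul_comm]

end Cutoff


/-! ### Finitely many functions with spanning differentials -/

section Immersion

open scoped Topology

variable {E : Type*} [NormedAddCommGroup E] [NormedSpace ℝ E]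
  {M : Type*} [TopologicalSpace M] [ChartedSpace E M]
  {V W : Type*} [NormedAddCommGroup V] [NormedSpace ℝ V] [NormedAddCommGroup W] [NormedSpace ℝ W]

/-- The derivative of `G` at `x` in the chart at `x`. -/
noncomputable def chartDeriv (G : M → V) (x : M) : E →L[ℝ] V :=
  fderiv ℝ (G ∘ (chartAt E x).symm) (chartAt E x x)

variable (E) in
/-- The map `G` is an immersion at `x`. -/
def IsImmersiveAt (G : M → V) (x : M) : Prop :=
  ∀ v : E, chartDeriv G x v = 0 → v = 0

theorem eventuallyEq_comp_chart_symm {G G' : M → V} {x x₀ : M} (hx : x ∈ (chartAt E x₀).source)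
    (h : G =ᶠ[𝓝 x] G') :
    G ∘ (chartAt E x₀).symm =ᶠ[𝓝 (chartAt E x₀ x)] G' ∘ (chartAt E x₀).symm := by
  have hc := (chartAt E x₀).continuousAt_symm ((chartAt E x₀).map_source hx)
  rw [ContinuousAt, (chartAt E x₀).left_inv hx] at hc
  exact hc.eventually h

theorem chartDeriv_congr {G G' : M → V} {x : M} (h : G =ᶠ[𝓝 x] G') :
    (chartDeriv G x : E →L[ℝ] V) = chartDeriv G' x :=
  (eventuallyEq_comp_chart_symm (mem_chart_source E x) h).fderiv_eq

theorem IsImmersiveAt.congr {G G' : M → V} {x : M} (hG : IsImmersiveAt E G x)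
    (h : G =ᶠ[𝓝 x] G') : IsImmersiveAt E G' x := fun v hv =>
  hG v (by rwa [chartDeriv_congr h])

variable [IsManifold 𝓘(ℝ, E) ∞ M]

theorem contDiffOn_comp_chart_symm {G : M → V} (hG : ContMDiff 𝓘(ℝ, E) 𝓘(ℝ, V) ∞ G) (x₀ : M) :
    ContDiffOn ℝ ∞ (G ∘ (chartAt E x₀).symm) (chartAt E x₀).target :=
  contMDiffOn_iff_contDiffOn.1 (hG.comp_contMDiffOn contMDiffOn_chart_symm)

theorem contDiffAt_comp_chart_symm {G : M → V} (hG : ContMDiff 𝓘(ℝ, E) 𝓘(ℝ, V) ∞ G) {x x₀ : M}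
    (hx : x ∈ (chartAt E x₀).source) :
    ContDiffAt ℝ ∞ (G ∘ (chartAt E x₀).symm) (chartAt E x₀ x) :=
  (contDiffOn_comp_chart_symm hG x₀).contDiffAt
    ((chartAt E x₀).open_target.mem_nhds ((chartAt E x₀).map_source hx))

theorem contDiffAt_chart_comp_chart_symm {x x₀ x₁ : M} (hx : x ∈ (chartAt E x₀).source)
    (hx₁ : x ∈ (chartAt E x₁).source) :
    ContDiffAt ℝ ∞ (chartAt E x₀ ∘ (chartAt E x₁).symm) (chartAt E x₁ x) := by
  have h1 : ContMDiffAt 𝓘(ℝ, E) 𝓘(ℝ, E) ∞ (chartAt E x₁).symm (chartAt E x₁ x) :=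
    contMDiffOn_chart_symm.contMDiffAt
      ((chartAt E x₁).open_target.mem_nhds ((chartAt E x₁).map_source hx₁))
  have h2 : ContMDiffAt 𝓘(ℝ, E) 𝓘(ℝ, E) ∞ (chartAt E x₀)
      ((chartAt E x₁).symm (chartAt E x₁ x)) := by
    rw [(chartAt E x₁).left_inv hx₁]
    exact contMDiffOn_chart.contMDiffAt ((chartAt E x₀).open_source.mem_nhds hx)
  exact contMDiffAt_iff_contDiffAt.1 (h2.comp _ h1)

theorem fderiv_chart_change {G : M → V} {x x₀ x₁ : M} (hx : x ∈ (chartAt E x₀).source)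
    (hx₁ : x ∈ (chartAt E x₁).source)
    (hG : DifferentiableAt ℝ (G ∘ (chartAt E x₀).symm) (chartAt E x₀ x)) :
    fderiv ℝ (G ∘ (chartAt E x₁).symm) (chartAt E x₁ x) =
      (fderiv ℝ (G ∘ (chartAt E x₀).symm) (chartAt E x₀ x)).comp
        (fderiv ℝ (chartAt E x₀ ∘ (chartAt E x₁).symm) (chartAt E x₁ x)) := by
  have he : G ∘ (chartAt E x₁).symm =ᶠ[𝓝 (chartAt E x₁ x)]
      (G ∘ (chartAt E x₀).symm) ∘ (chartAt E x₀ ∘ (chartAt E x₁).symm) := by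
    have h1 := (chartAt E x₁).continuousAt_symm ((chartAt E x₁).map_source hx₁)
    rw [ContinuousAt, (chartAt E x₁).left_inv hx₁] at h1
    filter_upwards [h1.eventually ((chartAt E x₀).open_source.mem_nhds hx)] with u hu
    simp only [Function.comp, (chartAt E x₀).left_inv hu]
  have hv : (chartAt E x₀ ∘ (chartAt E x₁).symm) (chartAt E x₁ x) = chartAt E x₀ x := by
    simp only [Function.comp, (chartAt E x₁).left_inv hx₁]
  rw [he.fderiv_eq, fderiv_comp _ (hv ▸ hG)
    ((contDiffAt_chart_comp_chart_symm hx hx₁).differentiableAt (by simp)), hv]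

theorem chartDeriv_comp {G : M → V} (hG : ContMDiff 𝓘(ℝ, E) 𝓘(ℝ, V) ∞ G) (L : V →L[ℝ] W) (x : M) :
    (chartDeriv (L ∘ G) x : E →L[ℝ] W) = L.comp (chartDeriv G x) := by
  unfold chartDeriv
  rw [Function.comp_assoc, fderiv_comp _ L.differentiableAt
    ((contDiffAt_comp_chart_symm hG (mem_chart_source E x)).differentiableAt (by simp)), L.fderiv]

/-- The set is the image of the tangent bundle, covered by countably many charts of dimension `2 dim
M`, under locally Lipschitz maps, which do not raise Hausdorff dimension. -/
theorem dimH_chartDeriv_le [FiniteDimensional ℝ E] [SecondCountableTopology M] {G : M → V}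
    (hG : ContMDiff 𝓘(ℝ, E) 𝓘(ℝ, V) ∞ G) :
    dimH {w : V | ∃ (x : M) (v : E), chartDeriv G x v = w} ≤ (2 * Module.finrank ℝ E : ℕ) := by
  obtain ⟨s, hs, hU⟩ := TopologicalSpace.countable_cover_nhds fun x : M => chart_source_mem_nhds E x
  let Θ : M → E × E → V := fun x₀ q => fderiv ℝ (G ∘ (chartAt E x₀).symm) q.1 q.2
  have hsub : {w : V | ∃ (x : M) (v : E), chartDeriv G x v = w} ⊆
      ⋃ x₀ ∈ s, Θ x₀ '' ((chartAt E x₀).target ×ˢ Set.univ) := by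
    rintro w ⟨x, v, rfl⟩
    obtain ⟨x₀, hx₀, hx⟩ := Set.mem_iUnion₂.1 (hU ▸ Set.mem_univ x)
    refine Set.mem_iUnion₂.2 ⟨x₀, hx₀,
      (chartAt E x₀ x, fderiv ℝ (chartAt E x₀ ∘ (chartAt E x).symm) (chartAt E x x) v),
      ⟨(chartAt E x₀).map_source hx, Set.mem_univ _⟩, ?_⟩
    · rw [chartDeriv, fderiv_chart_change hx (mem_chart_source E x)
        ((contDiffAt_comp_chart_symm hG hx).differentiableAt (by simp))]
      rfl
  refine (dimH_mono hsub).trans ?_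
  rw [dimH_bUnion hs]
  refine iSup₂_le fun x₀ _ => ?_
  refine (dimH_image_le_of_locally_lipschitzOn fun q hq => ?_).trans ?_
  · have h1 : ContDiffAt ℝ ∞ (G ∘ (chartAt E x₀).symm) q.1 :=
      (contDiffOn_comp_chart_symm hG x₀).contDiffAt ((chartAt E x₀).open_target.mem_nhds hq.1)
    have h2 : ContDiffAt ℝ 1 (fderiv ℝ (G ∘ (chartAt E x₀).symm)) q.1 :=
      h1.fderiv_right (by norm_cast)
    have h3 : ContDiffAt ℝ 1 (Θ x₀) q :=
      (h2.comp q contDiffAt_fst).clm_apply contDiffAt_snd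
    obtain ⟨K, t, ht, hK⟩ := h3.exists_lipschitzOnWith
    exact ⟨K, t, mem_nhdsWithin_of_mem_nhds ht, hK⟩
  · refine (dimH_mono (Set.subset_univ _)).trans ?_
    rw [Real.dimH_univ_eq_finrank, Module.finrank_prod, two_mul]

theorem exists_injective_fin_fun {N d : ℕ} (h : N ≤ d) :
    ∃ L : (Fin N → ℝ) →L[ℝ] (Fin d → ℝ), Function.Injective L := by
  obtain ⟨L, hL⟩ := (rank_le_iff_exists_linearMap (R := ℝ) (M := Fin N → ℝ) (M₁ := Fin d → ℝ)).1
    (by simpa using h)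
  exact ⟨LinearMap.toContinuousLinearMap L, hL⟩

theorem exists_ker_eq_span {N : ℕ} {w : Fin (N + 1) → ℝ} (hw : w ≠ 0) :
    ∃ L : (Fin (N + 1) → ℝ) →L[ℝ] (Fin N → ℝ), ∀ v, L v = 0 → ∃ c : ℝ, c • w = v := by
  have h1 : Module.finrank ℝ ((Fin (N + 1) → ℝ) ⧸ (ℝ ∙ w)) = Module.finrank ℝ (Fin N → ℝ) := by
    have := Submodule.finrank_quotient_add_finrank (ℝ ∙ w)
    rw [finrank_span_singleton hw, Module.finrank_fin_fun] at this
    rw [Module.finrank_fin_fun]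
    omega
  let e := LinearEquiv.ofFinrankEq _ _ h1
  refine ⟨LinearMap.toContinuousLinearMap (e.toLinearMap ∘ₗ (ℝ ∙ w).mkQ), fun v hv => ?_⟩
  have h2 : (ℝ ∙ w).mkQ v = 0 := e.map_eq_zero_iff.1 hv
  rw [Submodule.mkQ_apply, Submodule.Quotient.mk_eq_zero] at h2
  exact Submodule.mem_span_singleton.1 h2

variable [FiniteDimensional ℝ E] [SecondCountableTopology M]

/-- A generic projection of an immersion is an immersion. -/
theorem exists_immersive_of_immersive_fin_fun {N : ℕ} {K : Set M} {G : M → Fin N → ℝ}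
    (hG : ContMDiff 𝓘(ℝ, E) 𝓘(ℝ, Fin N → ℝ) ∞ G) (hK : ∀ x ∈ K, IsImmersiveAt E G x) :
    ∃ G' : M → Fin (2 * Module.finrank ℝ E) → ℝ,
      ContMDiff 𝓘(ℝ, E) 𝓘(ℝ, Fin (2 * Module.finrank ℝ E) → ℝ) ∞ G' ∧
        ∀ x ∈ K, IsImmersiveAt E G' x := by
  induction N with
  | zero =>
    obtain ⟨L, hL⟩ := exists_injective_fin_fun (Nat.zero_le (2 * Module.finrank ℝ E))
    refine ⟨L ∘ G, L.contDiff.contMDiff.comp hG, fun x hx v hv => hK x hx v ?_⟩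
    rw [chartDeriv_comp hG] at hv
    exact hL (hv.trans (map_zero L).symm)
  | succ N ih =>
    rcases le_or_gt (N + 1) (2 * Module.finrank ℝ E) with h | h
    · obtain ⟨L, hL⟩ := exists_injective_fin_fun h
      refine ⟨L ∘ G, L.contDiff.contMDiff.comp hG, fun x hx v hv => hK x hx v ?_⟩
      rw [chartDeriv_comp hG] at hv
      exact hL (hv.trans (map_zero L).symm)
    · have hd := (dimH_chartDeriv_le hG).trans_lt (b := ((2 * Module.finrank ℝ E : ℕ) : ENNReal))
        (c := (Module.finrank ℝ (Fin (N + 1) → ℝ) : ENNReal))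
        (by rw [Module.finrank_fin_fun]; exact_mod_cast h)
      -- The vectors tangent to the image are closed under scaling, so a `w` outside them spans a
      -- line meeting them only in zero, and projecting along it preserves immersivity.
      obtain ⟨w, hw⟩ := (dense_compl_of_dimH_lt_finrank hd).nonempty
      rcases K.eq_empty_or_nonempty with rfl | ⟨x₁, -⟩
      · exact ⟨fun _ => 0, contMDiff_const, by simp⟩
      have hw0 : w ≠ 0 := fun h0 => hw ⟨x₁, 0, by rw [map_zero, h0]⟩
      obtain ⟨L, hL⟩ := exists_ker_eq_span hw0
      refine ih (G := L ∘ G) (L.contDiff.contMDiff.comp hG) fun x hx v hv => hK x hx v ?_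
      rw [chartDeriv_comp hG] at hv
      obtain ⟨c, hc⟩ : ∃ c : ℝ, c • w = chartDeriv G x v := hL _ hv
      by_cases h0 : c = 0
      · rw [← hc, h0, zero_smul]
      · refine absurd ⟨x, c⁻¹ • v, ?_⟩ hw
        rw [map_smul, ← hc, smul_smul, inv_mul_cancel₀ h0, one_smul]

variable [T2Space M]

theorem exists_immersive_nhds (x₀ : M) : ∃ g : C^∞⟮𝓘(ℝ, E), M; 𝓘(ℝ, E), E⟯,
    ∀ᶠ x in 𝓝 x₀, IsImmersiveAt E g x := by
  obtain ⟨g, hg⟩ := exists_contMDiffMap_eventuallyEq (E := E) (chartAt E x₀).open_source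
    (mem_chart_source E x₀) (h := chartAt E x₀) contMDiffOn_chart
  refine ⟨g, ?_⟩
  filter_upwards [hg.eventually_nhds, chart_source_mem_nhds E x₀] with x hx hx₀
  have h1 : g ∘ (chartAt E x₀).symm =ᶠ[𝓝 (chartAt E x₀ x)] id := by
    refine (eventuallyEq_comp_chart_symm hx₀ hx).trans ?_
    filter_upwards [(chartAt E x₀).open_target.mem_nhds ((chartAt E x₀).map_source hx₀)] with u hu
    exact (chartAt E x₀).right_inv hu
  have h2 := fderiv_chart_change (G := g) (mem_chart_source E x) hx₀
    ((contDiffAt_comp_chart_symm g.contMDiff (mem_chart_source E x)).differentiableAt (by simp))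
  rw [h1.fderiv_eq, fderiv_id] at h2
  have h3 : Function.Surjective (chartDeriv g x : E →L[ℝ] E).toLinearMap := fun v =>
    ⟨_, (congrArg (fun T : E →L[ℝ] E => T v) h2).symm⟩
  have h4 := LinearMap.injective_iff_surjective.2 h3
  exact fun v hv => h4 (hv.trans (map_zero _).symm)

/-- The target dimension does not depend on `K`; this is what allows infinitely many compact pieces
to be combined. -/
theorem exists_immersive_of_isCompact {K : Set M} (hK : IsCompact K) :
    ∃ G : M → Fin (2 * Module.finrank ℝ E) → ℝ,
      ContMDiff 𝓘(ℝ, E) 𝓘(ℝ, Fin (2 * Module.finrank ℝ E) → ℝ) ∞ G ∧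
        ∀ x ∈ K, IsImmersiveAt E G x := by
  choose g hg using fun x₀ : M => exists_immersive_nhds (E := E) x₀
  obtain ⟨t, -, ht⟩ := hK.elim_nhds_subcover (fun x₀ => {x | IsImmersiveAt E (g x₀) x})
    fun x _ => hg x
  let G : M → t → E := fun x i => g i x
  have hG : ContMDiff 𝓘(ℝ, E) 𝓘(ℝ, t → E) ∞ G := contMDiff_pi_space.2 fun i => (g i).contMDiff
  let e : (t → E) ≃L[ℝ] (Fin (Module.finrank ℝ (t → E)) → ℝ) :=
    ContinuousLinearEquiv.ofFinrankEq (by simp)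
  refine exists_immersive_of_immersive_fin_fun (G := e ∘ G) (K := K)
    (e.contDiff.contMDiff.comp hG) fun x hx v hv => ?_
  obtain ⟨x₀, hx₀, hx₀'⟩ := Set.mem_iUnion₂.1 (ht hx)
  have h1 := chartDeriv_comp hG e.toContinuousLinearMap x
  have h2 : e (chartDeriv G x v) = 0 := by
    rw [← hv]
    exact (congrArg (fun T => T v) h1).symm
  have h3 := chartDeriv_comp hG (ContinuousLinearMap.proj (R := ℝ) (φ := fun _ : t => E) ⟨x₀, hx₀⟩) x
  refine hx₀' v ?_
  rw [show (g x₀ : M → E) = ContinuousLinearMap.proj (R := ℝ) (φ := fun _ : t => E) ⟨x₀, hx₀⟩ ∘ G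
    from rfl, h3, ContinuousLinearMap.comp_apply, e.map_eq_zero_iff.1 h2, map_zero]

end Immersion


section GlobalImmersion

open scoped Topology

variable {E : Type*} [NormedAddCommGroup E] [NormedSpace ℝ E] [FiniteDimensional ℝ E]
  {M : Type*} [TopologicalSpace M] [ChartedSpace E M] [IsManifold 𝓘(ℝ, E) ∞ M]
  [T2Space M] [SecondCountableTopology M]

theorem exists_compact_slabs [LocallyCompactSpace M] : ∃ D O : ℕ → Set M,
    (∀ j, IsCompact (D j)) ∧ (∀ j, IsOpen (O j)) ∧ (∀ j, D j ⊆ O j) ∧ (∀ x, ∃ j, x ∈ D j) ∧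
      (∀ i j, i + 3 ≤ j → Disjoint (O i) (O j)) ∧ LocallyFinite O := by
  -- The shift makes `K 0` empty, so the truncated `K (j - 1)` is harmless at `j = 0`.
  let K := (CompactExhaustion.choice M).shiftr
  have hK0 : K 0 = ∅ := rfl
  refine ⟨fun j => K (j + 1) \ interior (K j), fun j => interior (K (j + 2)) \ K (j - 1),
    fun j => (K.isCompact _).diff isOpen_interior,
    fun j => isOpen_interior.sdiff (K.isCompact _).isClosed, fun j x hx =>
      ⟨K.subset_interior_succ _ hx.1, fun h => ?_⟩, fun x => ?_, fun i j hij => ?_, fun x => ?_⟩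
  · rcases j with - | j
    · exact Set.notMem_empty x h
    · exact hx.2 (K.subset_interior_succ _ h)
  · have h := CompactExhaustion.mem_sdiff_shiftr_find (CompactExhaustion.choice M) x
    exact ⟨_, h.1, fun h' => h.2 (interior_subset h')⟩
  · refine Set.disjoint_left.2 fun x hi hj => hj.2 ?_
    exact K.subset (by omega) (interior_subset hi.1)
  · obtain ⟨k, hk⟩ := K.exists_mem x
    refine ⟨interior (K (k + 1)), isOpen_interior.mem_nhds (K.subset_interior_succ _ hk),
      (Set.finite_lt_nat (k + 2)).subset ?_⟩
    rintro j ⟨y, hy, hy'⟩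
    by_contra h
    exact hy.2 (K.subset (by simp at h; omega) (interior_subset hy'))

variable (E M) in
/-- A manifold has finitely many functions whose differentials span at every point. -/
theorem exists_immersive : ∃ (N : ℕ) (f : Fin N → C^∞⟮𝓘(ℝ, E), M; ℝ⟯), ∀ (x : M) (v : E),
    (∀ i, fderiv ℝ (f i ∘ (chartAt E x).symm) (chartAt E x x) v = 0) → v = 0 := by
  have := Manifold.locallyCompact_of_finiteDimensional (M := M) 𝓘(ℝ, E)
  obtain ⟨D, O, hD, hO, hDO, hcov, hdis, hfin⟩ := exists_compact_slabs (M := M)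
  choose G hG hGi using fun j => exists_immersive_of_isCompact (E := E) (hD j)
  choose l hl1 hl2 using fun j => exists_contMDiffMap_cutoff (E := E) (hD j).isClosed (hO j) (hDO j)
  -- The neighbourhoods of slabs with indices congruent mod `3` are disjoint. Each of the three sums
  -- therefore agrees near any slab of its residue class with the single map `G j`, and finitely
  -- many functions suffice.
  let T : Fin 3 → ℕ → M → Fin (2 * Module.finrank ℝ E) → ℝ :=
    fun r k x => l (3 * k + r) x • G (3 * k + r) x
  have hT0 : ∀ (r : Fin 3) (k : ℕ) (x : M), x ∉ O (3 * k + r) → T r k x = 0 := by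
    intro r k x hx
    have h0 := image_eq_zero_of_notMem_tsupport fun h => hx (hl2 _ h)
    simp only [T, h0, zero_smul]
  have hTs : ∀ r, ContMDiff 𝓘(ℝ, E) 𝓘(ℝ, Fin (2 * Module.finrank ℝ E) → ℝ) ∞
      fun x => ∑ᶠ k, T r k x := by
    intro r
    refine contMDiff_finsum (fun k => (l _).contMDiff.smul (hG _)) ?_
    refine (hfin.comp_injective (g := fun k : ℕ => 3 * k + r) fun a b h => by
      simp at h; omega).subset fun k x hx => ?_
    by_contra h
    exact hx (hT0 r k x h)
  have hTG : ∀ j, ∀ x ∈ D j, ∃ r, (fun y => ∑ᶠ k, T r k y) =ᶠ[𝓝 x] G j := by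
    intro j x hx
    refine ⟨⟨j % 3, Nat.mod_lt _ (by norm_num)⟩, ?_⟩
    filter_upwards [Filter.Eventually.filter_mono (nhds_le_nhdsSet hx) (hl1 j),
      (hO j).mem_nhds (hDO j hx)] with y hy1 hy2
    have hj : 3 * (j / 3) + j % 3 = j := Nat.div_add_mod j 3
    rw [finsum_eq_single _ (j / 3) fun k hk => ?_]
    · simp only [T, hj, hy1, one_smul]
    · refine hT0 _ _ _ fun h => ?_
      rcases lt_or_gt_of_ne hk with h' | h'
      · exact Set.disjoint_left.1 (hdis _ _ (by simp; omega)) h hy2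
      · exact Set.disjoint_left.1 (hdis _ _ (by simp; omega)) hy2 h
  let e : (Fin 3 × Fin (2 * Module.finrank ℝ E)) ≃ Fin _ := finProdFinEquiv
  refine ⟨_, fun a => ⟨fun x => (∑ᶠ k, T (e.symm a).1 k x) (e.symm a).2,
    contMDiff_pi_space.1 (hTs _) _⟩, fun x v hv => ?_⟩
  obtain ⟨j, hj⟩ := hcov x
  obtain ⟨r, hr⟩ := hTG j x hj
  have hi := (hGi j x hj).congr hr.symm
  refine hi v (funext fun i => ?_)
  have h1 := chartDeriv_comp (hTs r) (ContinuousLinearMap.proj (R := ℝ) (φ := fun _ => ℝ) i) x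
  have h2 := hv (e (r, i))
  simp only [Equiv.symm_apply_apply] at h2
  exact (congrArg (fun L : E →L[ℝ] ℝ => L v) h1).symm.trans h2

end GlobalImmersion


/-! ### Construction, gluing and lifting of vector fields -/

section GluedDerivation

variable {E : Type*} [NormedAddCommGroup E] [NormedSpace ℝ E]
  {P : Type*} [TopologicalSpace P] [ChartedSpace E P]

/-- A locally finite family of vector fields has a sum. -/
theorem exists_derivation_eq_finsum {κ : Type*}
    (Z : κ → Derivation ℝ C^∞⟮𝓘(ℝ, E), P; ℝ⟯ C^∞⟮𝓘(ℝ, E), P; ℝ⟯) {S : κ → Set P}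
    (hS : LocallyFinite S) (h : ∀ i g, ∀ p ∉ S i, Z i g p = 0) :
    ∃ Y : Derivation ℝ C^∞⟮𝓘(ℝ, E), P; ℝ⟯ C^∞⟮𝓘(ℝ, E), P; ℝ⟯,
      ∀ g p, Y g p = ∑ᶠ i, Z i g p := by
  have hsub : ∀ g p, Function.support (fun i => Z i g p) ⊆ {i | p ∈ S i} := fun g p i hi => by
    by_contra hp
    exact hi (h i g p hp)
  have hfin : ∀ g p, (Function.support fun i => Z i g p).Finite := fun g p =>
    (hS.point_finite p).subset (hsub g p)
  let T : C^∞⟮𝓘(ℝ, E), P; ℝ⟯ → C^∞⟮𝓘(ℝ, E), P; ℝ⟯ := fun g =>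
    ⟨fun p => ∑ᶠ i, Z i g p, contMDiff_finsum (fun i => (Z i g).contMDiff)
      (hS.subset fun i p hp => by
        by_contra hp'
        exact hp (h i g p hp'))⟩
  have hT : ∀ g p, T g p = ∑ᶠ i, Z i g p := fun _ _ => rfl
  refine ⟨Derivation.mk' (R := ℝ)
    { toFun := T
      map_add' := fun f g => ContMDiffMap.ext fun p => ?_
      map_smul' := fun c f => ContMDiffMap.ext fun p => ?_ }
    fun f g => ContMDiffMap.ext fun p => ?_, fun g p => rfl⟩
  · change T (f + g) p = T f p + T g p
    rw [hT, hT, hT, ← finsum_add_distrib (hfin f p) (hfin g p)]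
    exact finsum_congr fun i => by rw [map_add]; rfl
  · change T (c • f) p = c • T f p
    rw [hT, hT, smul_finsum' _ (hfin f p)]
    exact finsum_congr fun i => by rw [Derivation.map_smul]; rfl
  · change T (f * g) p = f p • T g p + g p • T f p
    rw [hT, hT, hT, smul_finsum' _ (hfin g p),
      smul_finsum' _ (hfin f p), ← finsum_add_distrib]
    · exact finsum_congr fun i => by rw [Derivation.leibniz]; rfl
    · exact (hfin g p).subset fun i hi h0 => hi (by simp only [h0, smul_zero])
    · exact (hfin f p).subset fun i hi h0 => hi (by simp only [h0, smul_zero])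

end GluedDerivation

section LocalDerivation

open scoped Topology

variable {EM EP : Type*} [NormedAddCommGroup EM] [NormedSpace ℝ EM]
  [NormedAddCommGroup EP] [NormedSpace ℝ EP]
  {M P : Type*} [TopologicalSpace M] [ChartedSpace EM M] [IsManifold 𝓘(ℝ, EM) ∞ M]
  [TopologicalSpace P] [ChartedSpace EP P] [IsManifold 𝓘(ℝ, EP) ∞ P]

/-- Differentiation along a family `Ψ p` of local sections, defined where `α p ∈ U`, in the
direction of a base vector field `w` supported in `U`. -/
theorem exists_derivation_along {α : P → M} (hα : ContMDiff 𝓘(ℝ, EP) 𝓘(ℝ, EM) ∞ α) {U : Set M} {x₀ : M}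
    (hUx : U ⊆ (chartAt EM x₀).source) {w : M → EM}
    (hw : ContMDiff 𝓘(ℝ, EM) 𝓘(ℝ, EM) ∞ w) (hwU : tsupport w ⊆ U) {Ψ : P → EM → P}
    (hΨ : ∀ p, α p ∈ U → ContMDiffAt (𝓘(ℝ, EP).prod 𝓘(ℝ, EM)) 𝓘(ℝ, EP) ∞
      (Function.uncurry Ψ) (p, chartAt EM x₀ (α p)))
    (hΨ0 : ∀ p, α p ∈ U → Ψ p (chartAt EM x₀ (α p)) = p) :
    ∃ Z : Derivation ℝ C^∞⟮𝓘(ℝ, EP), P; ℝ⟯ C^∞⟮𝓘(ℝ, EP), P; ℝ⟯, ∀ g p,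
      Z g p = fderiv ℝ (fun u => g (Ψ p u)) (chartAt EM x₀ (α p)) (w (α p)) := by
  have hw0 : ∀ p, α p ∉ U → w (α p) = 0 := fun p hp =>
    image_eq_zero_of_notMem_tsupport fun h => hp (hwU h)
  have hd : ∀ (g : C^∞⟮𝓘(ℝ, EP), P; ℝ⟯) p, α p ∈ U →
      DifferentiableAt ℝ (fun u => g (Ψ p u)) (chartAt EM x₀ (α p)) := by
    intro g p hp
    have h1 : ContMDiffAt 𝓘(ℝ, EM) 𝓘(ℝ, ℝ) ∞ (fun u => g (Ψ p u)) (chartAt EM x₀ (α p)) :=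
      (g.contMDiff.contMDiffAt.comp _ (hΨ p hp)).comp (chartAt EM x₀ (α p))
        (contMDiffAt_const.prodMk contMDiffAt_id)
    exact (contMDiffAt_iff_contDiffAt.1 h1).differentiableAt (by simp)
  have hs : ∀ g : C^∞⟮𝓘(ℝ, EP), P; ℝ⟯, ContMDiff 𝓘(ℝ, EP) 𝓘(ℝ, ℝ) ∞ fun p =>
      fderiv ℝ (fun u => g (Ψ p u)) (chartAt EM x₀ (α p)) (w (α p)) := by
    intro g p
    by_cases hp : α p ∈ U
    · have h1 := ContMDiffAt.mfderiv_apply (m := ∞) (I := 𝓘(ℝ, EM)) (I' := 𝓘(ℝ, ℝ))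
        (J := 𝓘(ℝ, EP)) (J' := 𝓘(ℝ, EP)) (x₀ := p) (fun p u => g (Ψ p u))
        (fun p => chartAt EM x₀ (α p)) id (fun p => w (α p))
        (g.contMDiff.contMDiffAt.comp _ (hΨ p hp))
        ((contMDiffOn_chart.contMDiffAt ((chartAt EM x₀).open_source.mem_nhds (hUx hp))).comp p
          hα.contMDiffAt)
        contMDiffAt_id (hw.comp hα).contMDiffAt (by norm_cast)
      refine h1.congr_of_eventuallyEq (.of_forall fun q => ?_)
      have h2 := inTangentCoordinates_model_space (I := 𝓘(ℝ, EM)) (I' := 𝓘(ℝ, ℝ))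
        (fun p => chartAt EM x₀ (α p)) (fun p => g (Ψ p (chartAt EM x₀ (α p))))
        (fun p => fderiv ℝ (fun u => g (Ψ p u)) (chartAt EM x₀ (α p))) p
      simp only [mfderiv_eq_fderiv, id]
      exact (congrArg (fun L : EM →L[ℝ] ℝ => L (w (α q))) (congrFun h2 q)).symm
    · have h1 : ∀ᶠ q in 𝓝 p, α q ∈ (tsupport w)ᶜ :=
        hα.continuous.continuousAt.eventually
          ((isClosed_tsupport w).isOpen_compl.mem_nhds fun h => hp (hwU h))
      refine (contMDiffAt_const (c := (0 : ℝ))).congr_of_eventuallyEq ?_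
      filter_upwards [h1] with q hq
      rw [image_eq_zero_of_notMem_tsupport hq, map_zero]
  refine ⟨Derivation.mk' (R := ℝ)
    { toFun := fun g => ⟨_, hs g⟩
      map_add' := fun f g => ContMDiffMap.ext fun p => ?_
      map_smul' := fun c f => ContMDiffMap.ext fun p => ?_ }
    fun f g => ContMDiffMap.ext fun p => ?_, fun g p => rfl⟩
  · change fderiv ℝ (fun u => f (Ψ p u) + g (Ψ p u)) _ _ =
      fderiv ℝ (fun u => f (Ψ p u)) _ _ + fderiv ℝ (fun u => g (Ψ p u)) _ _
    by_cases hp : α p ∈ U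
    · rw [fderiv_fun_add (hd f p hp) (hd g p hp)]
      rfl
    · simp only [hw0 p hp, map_zero, add_zero]
  · change fderiv ℝ (fun u => c * f (Ψ p u)) _ _ = c * fderiv ℝ (fun u => f (Ψ p u)) _ _
    by_cases hp : α p ∈ U
    · rw [fderiv_const_mul (hd f p hp)]
      rfl
    · simp only [hw0 p hp, map_zero, mul_zero]
  · change fderiv ℝ (fun u => f (Ψ p u) * g (Ψ p u)) _ _ =
      f p * fderiv ℝ (fun u => g (Ψ p u)) _ _ + g p * fderiv ℝ (fun u => f (Ψ p u)) _ _
    by_cases hp : α p ∈ U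
    · rw [fderiv_fun_mul (hd f p hp) (hd g p hp), hΨ0 p hp]
      rfl
    · simp only [hw0 p hp, map_zero, mul_zero, add_zero]

theorem exists_derivation_chart {U : Set M} {x₀ : M}
    (hUx : U ⊆ (chartAt EM x₀).source) {w : M → EM}
    (hw : ContMDiff 𝓘(ℝ, EM) 𝓘(ℝ, EM) ∞ w) (hwU : tsupport w ⊆ U) :
    ∃ X : Derivation ℝ C^∞⟮𝓘(ℝ, EM), M; ℝ⟯ C^∞⟮𝓘(ℝ, EM), M; ℝ⟯, ∀ g x,
      X g x = fderiv ℝ (g ∘ (chartAt EM x₀).symm) (chartAt EM x₀ x) (w x) := by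
  refine exists_derivation_along (α := id) contMDiff_id hUx hw hwU
    (Ψ := fun _ u => (chartAt EM x₀).symm u) (fun x hx => ?_)
    fun x hx => (chartAt EM x₀).left_inv (hUx hx)
  exact (contMDiffOn_chart_symm.contMDiffAt ((chartAt EM x₀).open_target.mem_nhds
    ((chartAt EM x₀).map_source (hUx hx)))).comp
      ((x, chartAt EM x₀ x) : M × EM) contMDiffAt_snd

/-- A vector field supported in the domain of a local trivialization has a lift. -/
theorem exists_isLift_of_trivialization {EF F : Type*} [NormedAddCommGroup EF] [NormedSpace ℝ EF]
    [TopologicalSpace F] [ChartedSpace EF F] (α : C^∞⟮𝓘(ℝ, EP), P; 𝓘(ℝ, EM), M⟯)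
    {e : Bundle.Trivialization F α}
    (he : ContMDiffOn 𝓘(ℝ, EP) (𝓘(ℝ, EM).prod 𝓘(ℝ, EF)) ∞ e e.source)
    (he' : ContMDiffOn (𝓘(ℝ, EM).prod 𝓘(ℝ, EF)) 𝓘(ℝ, EP) ∞ e.toOpenPartialHomeomorph.symm e.target)
    {U : Set M} {x₀ : M} (hUx : U ⊆ (chartAt EM x₀).source) (hUe : U ⊆ e.baseSet)
    {w : M → EM} (hw : ContMDiff 𝓘(ℝ, EM) 𝓘(ℝ, EM) ∞ w) (hwU : tsupport w ⊆ U) :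
    ∃ Z : Derivation ℝ C^∞⟮𝓘(ℝ, EP), P; ℝ⟯ C^∞⟮𝓘(ℝ, EP), P; ℝ⟯,
      (∀ g p, w (α p) = 0 → Z g p = 0) ∧
      ∀ (g : C^∞⟮𝓘(ℝ, EM), M; ℝ⟯) p, Z (g.comp α) p =
        fderiv ℝ (g ∘ (chartAt EM x₀).symm) (chartAt EM x₀ (α p)) (w (α p)) := by
  have hsm : ∀ p, α p ∈ U → ContMDiffAt 𝓘(ℝ, EM) 𝓘(ℝ, EM) ∞ (chartAt EM x₀).symm
      (chartAt EM x₀ (α p)) := fun p hp =>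
    contMDiffOn_chart_symm.contMDiffAt ((chartAt EM x₀).open_target.mem_nhds
      ((chartAt EM x₀).map_source (hUx hp)))
  -- The local section through `p` moves the base coordinate and keeps the fibre coordinate in the
  -- trivialization fixed.
  let Ψ : P → EM → P := fun p u => e.toOpenPartialHomeomorph.symm ((chartAt EM x₀).symm u, (e p).2)
  have hΨ : ∀ p, α p ∈ U → ContMDiffAt (𝓘(ℝ, EP).prod 𝓘(ℝ, EM)) 𝓘(ℝ, EP) ∞
      (Function.uncurry Ψ) (p, chartAt EM x₀ (α p)) := by
    intro p hp
    have hps : p ∈ e.source := e.mem_source.2 (hUe hp)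
    have h1 : ContMDiffAt (𝓘(ℝ, EP).prod 𝓘(ℝ, EM)) (𝓘(ℝ, EM).prod 𝓘(ℝ, EF)) ∞
        (fun q : P × EM => ((chartAt EM x₀).symm q.2, (e q.1).2)) (p, chartAt EM x₀ (α p)) :=
      ((hsm p hp).comp ((p, chartAt EM x₀ (α p)) : P × EM) contMDiffAt_snd).prodMk
        (contMDiffAt_snd.comp _ ((he.contMDiffAt (e.open_source.mem_nhds hps)).comp
          ((p, chartAt EM x₀ (α p)) : P × EM) contMDiffAt_fst))
    refine ContMDiffAt.comp (p, chartAt EM x₀ (α p)) (he'.contMDiffAt (e.open_target.mem_nhds ?_)) h1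
    exact e.mem_target.2 (by
      simp only [(chartAt EM x₀).left_inv (hUx hp)]
      exact hUe hp)
  have hΨ0 : ∀ p, α p ∈ U → Ψ p (chartAt EM x₀ (α p)) = p := by
    intro p hp
    simp only [Ψ, (chartAt EM x₀).left_inv (hUx hp)]
    exact e.symm_apply_mk_proj (e.mem_source.2 (hUe hp))
  obtain ⟨Z, hZ⟩ := exists_derivation_along α.contMDiff hUx hw hwU hΨ hΨ0
  refine ⟨Z, fun g p h => by rw [hZ, h, map_zero], fun g p => ?_⟩
  rw [hZ]
  by_cases hp : α p ∈ U
  · refine congrArg (fun L : EM →L[ℝ] ℝ => L (w (α p))) (Filter.EventuallyEq.fderiv_eq ?_)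
    have hb : e.baseSet ∈ 𝓝 ((chartAt EM x₀).symm (chartAt EM x₀ (α p))) := by
      rw [(chartAt EM x₀).left_inv (hUx hp)]
      exact e.open_baseSet.mem_nhds (hUe hp)
    filter_upwards [(hsm p hp).continuousAt.eventually hb] with u hu
    change g (α _) = g _
    rw [e.proj_symm_apply' hu]
  · rw [image_eq_zero_of_notMem_tsupport fun h => hp (hwU h), map_zero, map_zero]

end LocalDerivation


/-! ### Local frames -/

section LocalFrame

open scoped Topology

variable {E : Type*} [NormedAddCommGroup E] [NormedSpace ℝ E] [FiniteDimensional ℝ E]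
  {M : Type*} [TopologicalSpace M] [ChartedSpace E M] [IsManifold 𝓘(ℝ, E) ∞ M]

/-- If the differentials of the `f j` span at `x₀`, then near `x₀` the directional derivatives of
the `f j` are the coefficients of the direction with respect to smooth vector fields. -/
theorem exists_local_frame {N : ℕ} (f : Fin N → C^∞⟮𝓘(ℝ, E), M; ℝ⟯) (x₀ : M)
    (hf : ∀ v : E, (∀ j, fderiv ℝ (f j ∘ (chartAt E x₀).symm) (chartAt E x₀ x₀) v = 0) → v = 0) :
    ∃ U : Set M, IsOpen U ∧ x₀ ∈ U ∧ U ⊆ (chartAt E x₀).source ∧ ∀ χ : C^∞⟮𝓘(ℝ, E), M; ℝ⟯,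
      tsupport χ ⊆ U → ∃ w : Fin N → M → E, (∀ j, ContMDiff 𝓘(ℝ, E) 𝓘(ℝ, E) ∞ (w j)) ∧
        (∀ j, tsupport (w j) ⊆ tsupport χ) ∧ (∀ j x, χ x = 0 → w j x = 0) ∧
        ∀ x ∈ U, ∀ v : E, ∑ j, fderiv ℝ (f j ∘ (chartAt E x₀).symm) (chartAt E x₀ x) v • w j x =
          χ x • v := by
  have : CompleteSpace E := FiniteDimensional.complete ℝ E
  set φ := chartAt E x₀ with hφ
  let F : M → Fin N → ℝ := fun x j => f j x
  have hF : ContMDiff 𝓘(ℝ, E) 𝓘(ℝ, Fin N → ℝ) ∞ F := contMDiff_pi_space.2 fun j => (f j).contMDiff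
  have hFφ : ContDiffOn ℝ ∞ (F ∘ φ.symm) φ.target := contDiffOn_comp_chart_symm hF x₀
  let J : M → E →L[ℝ] (Fin N → ℝ) := fun x => fderiv ℝ (F ∘ φ.symm) (φ x)
  have hJ : ∀ x ∈ φ.source, ∀ v j, J x v j = fderiv ℝ (f j ∘ φ.symm) (φ x) v := by
    intro x hx v j
    have h1 := (hFφ.contDiffAt (φ.open_target.mem_nhds (φ.map_source hx))).differentiableAt
      (by simp)
    have h2 := (hasFDerivAt_pi'.1 h1.hasFDerivAt j).fderiv
    exact (congrArg (fun L : E →L[ℝ] ℝ => L v) h2).symm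
  have hJs : ContMDiffOn 𝓘(ℝ, E) 𝓘(ℝ, E →L[ℝ] (Fin N → ℝ)) ∞ J φ.source :=
    (contMDiffOn_iff_contDiffOn.2 (hFφ.fderiv_of_isOpen φ.open_target (by norm_cast))).comp
      contMDiffOn_chart fun x hx => φ.map_source hx
  have hx₀ : x₀ ∈ φ.source := mem_chart_source E x₀
  -- A left inverse `L` of the Jacobian at `x₀` is fixed; `B = L J` is the identity at `x₀`, hence
  -- invertible nearby, and `B⁻¹ L` is a smooth left inverse of `J`. Its columns times `χ` are the
  -- fields `w j`.
  obtain ⟨L', hL'⟩ := LinearMap.exists_leftInverse_of_injective (J x₀).toLinearMap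
    (LinearMap.ker_eq_bot'.2 fun v hv => hf v fun j => by
      rw [← hJ x₀ hx₀ v j]
      exact congrFun hv j)
  let L : (Fin N → ℝ) →L[ℝ] E := LinearMap.toContinuousLinearMap L'
  let B : M → E →L[ℝ] E := fun x => L.comp (J x)
  have hBs : ContMDiffOn 𝓘(ℝ, E) 𝓘(ℝ, E →L[ℝ] E) ∞ B φ.source :=
    ((ContinuousLinearMap.compL ℝ E (Fin N → ℝ) E L).contDiff.contMDiff).comp_contMDiffOn hJs
  have hB0 : B x₀ = 1 := ContinuousLinearMap.ext fun v => LinearMap.congr_fun hL' v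
  let U : Set M := φ.source ∩ B ⁻¹' {T | IsUnit T}
  have hU : IsOpen U := hBs.continuousOn.isOpen_inter_preimage φ.open_source Units.isOpen
  have hBi : ∀ x ∈ U, ContMDiffAt 𝓘(ℝ, E) 𝓘(ℝ, E →L[ℝ] E) ∞ (fun x => Ring.inverse (B x)) x := by
    intro x hx
    obtain ⟨T, hT⟩ := hx.2
    have h1 := contDiffAt_ringInverse ℝ (n := ∞) T
    rw [hT] at h1
    exact h1.contMDiffAt.comp x (hBs.contMDiffAt (φ.open_source.mem_nhds hx.1))
  refine ⟨U, hU, ⟨hx₀, by simp [hB0]⟩, Set.inter_subset_left, fun χ hχ => ?_⟩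
  have hsupp : ∀ j, tsupport (fun x => χ x • Ring.inverse (B x) (L (Pi.single j 1))) ⊆ tsupport χ :=
    fun j => tsupport_smul_subset_left _ _
  refine ⟨fun j x => χ x • Ring.inverse (B x) (L (Pi.single j 1)), fun j => ?_, hsupp,
    fun j x hx => by simp only [hx, zero_smul], fun x hx v => ?_⟩
  · refine contMDiff_of_tsupport fun x hx => ?_
    exact χ.contMDiff.contMDiffAt.smul ((hBi x (hχ (hsupp j hx))).clm_apply contMDiffAt_const)
  · have h1 : ∑ j, J x v j • (Pi.single j 1 : Fin N → ℝ) = J x v := by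
      funext i
      simp [Finset.sum_apply, Pi.single_apply]
    have h2 : Ring.inverse (B x) (B x v) = v :=
      congrArg (fun T : E →L[ℝ] E => T v) (Ring.inverse_mul_cancel _ hx.2)
    calc ∑ j, fderiv ℝ (f j ∘ φ.symm) (φ x) v • χ x • Ring.inverse (B x) (L (Pi.single j 1))
        = χ x • Ring.inverse (B x) (L (∑ j, J x v j • (Pi.single j 1 : Fin N → ℝ))) := by
          simp only [map_sum, map_smul, Finset.smul_sum, hJ x hx.1 v]
          exact Finset.sum_congr rfl fun j _ => smul_comm _ _ _
      _ = χ x • v := by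
          rw [h1]
          exact congrArg (χ x • ·) h2

end LocalFrame

/-! ### Vanishing of forms above the dimension -/

section Rank

variable {E : Type*} [NormedAddCommGroup E] [NormedSpace ℝ E] [FiniteDimensional ℝ E]
  {M : Type*} [TopologicalSpace M] [ChartedSpace E M] [IsManifold 𝓘(ℝ, E) ∞ M]
  [T2Space M] [SecondCountableTopology M]

/-- There are no forms of degree larger than the dimension. -/
theorem LiftedFrame.subsingleton_dForm_of_finrank_lt {A ι : Type*} [CommRing A] [Algebra ℝ A]
    [Algebra C^∞⟮𝓘(ℝ, E), M; ℝ⟯ A] [Fintype ι] (Φ : LiftedFrame C^∞⟮𝓘(ℝ, E), M; ℝ⟯ A ι)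
    {m : ℕ} (h : Module.finrank ℝ E < m) : Subsingleton (DForm C^∞⟮𝓘(ℝ, E), M; ℝ⟯ m) := by
  refine subsingleton_of_forall_eq 0 fun η => AlternatingMap.ext fun Y => ContMDiffMap.ext fun x => ?_
  choose v hv using fun k => (VField.isPointDer_evalAt (Y k) x).exists_eq_fderiv (mem_chart_source E x)
  have hdep : ¬ LinearIndependent ℝ v := fun hl => by
    have := hl.fintype_card_le_finrank
    rw [Fintype.card_fin] at this
    omega
  obtain ⟨c, hc, k, hk⟩ := Fintype.not_linearIndependent_iff.1 hdep
  have hY0 : ∀ g, ∑ i, c i * Y i g x = 0 := by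
    intro g
    have h1 : ∀ i, Y i g x = fderiv ℝ (g ∘ (chartAt E x).symm) (chartAt E x x) (v i) := fun i =>
      hv i g
    simp only [h1, ← smul_eq_mul, ← map_smul, ← map_sum, hc, map_zero]
  -- the combination `V` of the fields vanishes at `x`
  let V : VField C^∞⟮𝓘(ℝ, E), M; ℝ⟯ := ∑ i, (algebraMap ℝ C^∞⟮𝓘(ℝ, E), M; ℝ⟯ (c i)) • Y i
  have hVx : ∀ g, V g x = 0 := by
    intro g
    have h1 : V g = ∑ i, algebraMap ℝ C^∞⟮𝓘(ℝ, E), M; ℝ⟯ (c i) * Y i g := by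
      simp only [V]
      rw [← Derivation.coeFnAddMonoidHom_apply, map_sum, Finset.sum_apply]
      rfl
    rw [h1, contMDiffMap_sum_apply]
    exact hY0 g
  -- The frame makes forms pointwise: the coefficients `V(f_j)` vanish at `x`, hence so does any
  -- value of `η` with `V` among the arguments. By alternation, putting `V` in slot `k` gives `c k *
  -- η Y`.
  have hV : V = ∑ j, V (Φ.f j) • Φ.X j := (Φ.sum_smul_X V).symm
  have h2 : η (Function.update Y k V) x = 0 := by
    have h3 : η (Function.update Y k V) = ∑ j, V (Φ.f j) * η (Function.update Y k (Φ.X j)) := by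
      conv_lhs => rw [hV]
      rw [AlternatingMap.map_update_sum]
      exact Finset.sum_congr rfl fun j _ => η.map_update_smul ..
    rw [h3, contMDiffMap_sum_apply]
    refine Finset.sum_eq_zero fun j _ => ?_
    change V (Φ.f j) x * _ = 0
    rw [hVx, zero_mul]
  have h4 : η (Function.update Y k V) = algebraMap ℝ C^∞⟮𝓘(ℝ, E), M; ℝ⟯ (c k) * η Y := by
    rw [AlternatingMap.map_update_sum, Finset.sum_eq_single k]
    · rw [AlternatingMap.map_update_smul, Function.update_eq_self]
      rfl
    · intro i _ hi
      rw [AlternatingMap.map_update_smul,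
        η.map_eq_zero_of_eq _ (i := k) (j := i) (by simp [hi]) hi.symm, smul_zero]
    · simp
  rw [h4] at h2
  exact (mul_eq_zero.1 (h2 : c k * η Y x = 0)).resolve_left hk

end Rank


/-! ### The global lifted frame of a fibre bundle -/

section Frame

open scoped Topology

variable {EM EF EP : Type*}
  [NormedAddCommGroup EM] [NormedSpace ℝ EM] [FiniteDimensional ℝ EM]
  [NormedAddCommGroup EF] [NormedSpace ℝ EF]
  [NormedAddCommGroup EP] [NormedSpace ℝ EP]
  {M F P : Type*}
  [TopologicalSpace M] [ChartedSpace EM M] [IsManifold 𝓘(ℝ, EM) ∞ M]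
  [T2Space M] [SecondCountableTopology M]
  [TopologicalSpace F] [ChartedSpace EF F]
  [TopologicalSpace P] [ChartedSpace EP P] [IsManifold 𝓘(ℝ, EP) ∞ P]

/-- The local frames come multiplied by the functions `ρ_i` of a partition of unity, so their
expansions add up to the identity. Lifting is done piece by piece. The expansion is stated for point
derivations of the base so that it applies both to fields on `M` and to fields on `P` acting on
pulled-back functions. -/
theorem exists_frame_lift (α : C^∞⟮𝓘(ℝ, EP), P; 𝓘(ℝ, EM), M⟯) (hα : IsSmoothFiberBundle EF F α) :
    ∃ (N : ℕ) (f : Fin N → C^∞⟮𝓘(ℝ, EM), M; ℝ⟯)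
      (X : Fin N → Derivation ℝ C^∞⟮𝓘(ℝ, EM), M; ℝ⟯ C^∞⟮𝓘(ℝ, EM), M; ℝ⟯)
      (H : Fin N → Derivation ℝ C^∞⟮𝓘(ℝ, EP), P; ℝ⟯ C^∞⟮𝓘(ℝ, EP), P; ℝ⟯),
      (∀ x D, IsPointDer x D → ∀ g, D g = ∑ j, D (f j) * X j g x) ∧
      ∀ j g p, H j (g.comp α) p = X j g (α p) := by
  have := Manifold.locallyCompact_of_finiteDimensional (M := M) 𝓘(ℝ, EM)
  obtain ⟨N, f, hf⟩ := exists_immersive EM M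
  choose e hxe he he' using hα
  choose U hU hxU hUx hfr using fun x₀ => exists_local_frame f x₀ (hf x₀)
  obtain ⟨ρ, hρ⟩ := SmoothPartitionOfUnity.exists_isSubordinate 𝓘(ℝ, EM) isClosed_univ
    (fun x₀ => U x₀ ∩ (e x₀).baseSet) (fun x₀ => (hU x₀).inter (e x₀).open_baseSet)
    fun x _ => Set.mem_iUnion.2 ⟨x, hxU x, hxe x⟩
  choose w hw hwU hw0 hwe using fun x₀ =>
    hfr x₀ (ρ x₀) ((hρ x₀).trans Set.inter_subset_left)
  have hρU : ∀ i, tsupport (ρ i) ⊆ U i ∩ (e i).baseSet := hρ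
  choose Xl hXl using fun i j => exists_derivation_chart (hUx i) (hw i j)
    ((hwU i j).trans ((hρU i).trans Set.inter_subset_left))
  choose Hl hHl0 hHl using fun i j => exists_isLift_of_trivialization α (he i) (he' i)
    (Set.inter_subset_left.trans (hUx i)) Set.inter_subset_right (hw i j)
    ((hwU i j).trans (hρU i))
  have hXl0 : ∀ i j g, ∀ x ∉ Function.support (ρ i), Xl i j g x = 0 := fun i j g x hx => by
    rw [hXl, hw0 i j x (Function.notMem_support.1 hx), map_zero]
  choose X hX using fun j => exists_derivation_eq_finsum (fun i => Xl i j) ρ.locallyFinite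
    fun i => hXl0 i j
  choose H hH using fun j => exists_derivation_eq_finsum (fun i => Hl i j)
    (ρ.locallyFinite.preimage_continuous α.contMDiff.continuous)
    fun i g p hp => hHl0 i j g p (hw0 i j _ (Function.notMem_support.1 hp))
  refine ⟨N, f, X, H, fun x D hD g => ?_, fun j g p => ?_⟩
  · have hloc : ∀ i, ∑ j, D (f j) * Xl i j g x = ρ i x * D g := by
      intro i
      by_cases hx : x ∈ U i
      · obtain ⟨v, hv⟩ := hD.exists_eq_fderiv (hUx i hx)
        simp only [hv, hXl, ← smul_eq_mul, ← map_smul, ← map_sum]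
        rw [hwe i x hx v]
      · have h0 : x ∉ Function.support (ρ i) := fun h => hx (hρU i (subset_tsupport _ h)).1
        simp only [hXl0 i _ g x h0, Function.notMem_support.1 h0, mul_zero, zero_mul,
          Finset.sum_const_zero]
    let t := (ρ.locallyFinite.point_finite x).toFinset
    have ht : ∀ {u : M → ℝ}, (∀ i, ρ i x = 0 → u i = 0) → ∑ᶠ i, u i = ∑ i ∈ t, u i := by
      intro u hu
      refine finsum_eq_sum_of_support_subset _ fun i hi => ?_
      simp only [t, Set.Finite.coe_toFinset]
      exact fun h => hi (hu i h)
    have hone : ∑ i ∈ t, ρ i x = 1 := by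
      rw [← ht fun i h => h, ρ.sum_eq_one (Set.mem_univ x)]
    have hXt : ∀ j, X j g x = ∑ i ∈ t, Xl i j g x := fun j => by
      rw [hX, ht fun i h => hXl0 i j g x (Function.notMem_support.2 h)]
    simp only [hXt, Finset.mul_sum]
    rw [Finset.sum_comm, Finset.sum_congr rfl fun i _ => hloc i, ← Finset.sum_mul, hone, one_mul]
  · rw [hH, hX]
    exact finsum_congr fun i => by rw [hHl, hXl]

theorem exists_liftedFrame (α : C^∞⟮𝓘(ℝ, EP), P; 𝓘(ℝ, EM), M⟯) (hα : IsSmoothFiberBundle EF F α) :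
    ∃ N : ℕ, Nonempty (LiftedFrame C^∞⟮𝓘(ℝ, EM), M; ℝ⟯ (TotalFun α) (Fin N)) := by
  obtain ⟨N, f, X, H, hX, hH⟩ := exists_frame_lift α hα
  refine ⟨N, ⟨⟨f, X, H, fun Y g => ContMDiffMap.ext fun x => ?_, fun W g => ?_,
    fun j g => ContMDiffMap.ext fun p => hH j g p⟩⟩⟩
  · rw [contMDiffMap_sum_apply]
    exact hX x _ (Y.isPointDer_evalAt x) g
  · let W' : VField C^∞⟮𝓘(ℝ, EP), P; ℝ⟯ := W
    refine ContMDiffMap.ext (f := W' (g.comp α)) fun p => ?_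
    -- The push-forward of `W` at `p`: a derivation at `α p`, though `W` need not be projectable.
    let D : C^∞⟮𝓘(ℝ, EM), M; ℝ⟯ →ₗ[ℝ] ℝ :=
      { toFun := fun g => W' (g.comp α) p
        map_add' := fun f g => (W'.evalAt p).map_add (f.comp α) (g.comp α)
        map_smul' := fun c f => (W'.evalAt p).map_smul c (f.comp α) }
    have hD : IsPointDer (α p) D := fun f g => W'.isPointDer_evalAt p (f.comp α) (g.comp α)
    refine (hX (α p) D hD g).trans ?_
    exact (contMDiffMap_sum_apply Finset.univ
      (fun j => W' ((f j).comp α) * ((X j g).comp α : C^∞⟮𝓘(ℝ, EP), P; ℝ⟯)) p).symm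

end Frame


/-! ### Assembly -/

instance TotalFun.instIsScalarTower {EM EP : Type*} [NormedAddCommGroup EM] [NormedSpace ℝ EM]
    [NormedAddCommGroup EP] [NormedSpace ℝ EP] {M P : Type*} [TopologicalSpace M]
    [ChartedSpace EM M] [TopologicalSpace P] [ChartedSpace EP P]
    (α : C^∞⟮𝓘(ℝ, EP), P; 𝓘(ℝ, EM), M⟯) :
    IsScalarTower ℝ C^∞⟮𝓘(ℝ, EM), M; ℝ⟯ (TotalFun α) :=
  IsScalarTower.of_algebraMap_eq fun _ => rfl

theorem LiftedFrame.nonempty_omegaH_equiv_E2_prod_of_eq {A₀ A ι : Type*} [CommRing A₀] [CommRing A]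
    [Algebra ℝ A₀] [Algebra ℝ A] [Algebra A₀ A] [Fintype ι] [IsScalarTower ℝ A₀ A] {r n : ℕ}
    (Ψ : LiftedFrame A₀ A ι) (hs : ∀ m, r + 1 < m → Subsingleton (DForm A₀ m))
    {d : ∀ p q : ℕ, E1 A₀ A p q →ₗ[ℝ] E1 A₀ A (p + 1) q} (hd : d = Ψ.d1) (hn : r + 1 = n) (q : ℕ) :
    Nonempty (OmegaH A₀ A r (q + 1) ≃ₗ[ℝ] E2 d n q × LinearMap.ker (d r (q + 1))) := by
  subst hn
  exact Ψ.nonempty_omegaH_equiv_E2_prod hs hd q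

/-- The algebraic core of the result: all that is used of the bundle is a lifted frame and the
vanishing of base forms above degree `n`. -/
theorem affine_cohomology_of_frame {A₀ A : Type*} [CommRing A₀] [CommRing A]
    [Algebra ℝ A₀] [Algebra ℝ A] [Algebra A₀ A] [IsScalarTower ℝ A₀ A]
    (h : ∃ N : ℕ, Nonempty (LiftedFrame A₀ A (Fin N)))
    (n : ℕ) (hn1 : 1 ≤ n) (hs : ∀ m, n < m → Subsingleton (DForm A₀ m)) :
    -- the differentials `d_1^{p,q}` exist and are uniquely determined
    (∃! d₁ : ∀ p q : ℕ, E1 A₀ A p q →ₗ[ℝ]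
        E1 A₀ A (p + 1) q, IsGaussManinD d₁) ∧
    ∀ d₁ : ∀ p q : ℕ, E1 A₀ A p q →ₗ[ℝ]
        E1 A₀ A (p + 1) q, IsGaussManinD d₁ →
      -- degree `0`, where `VH^{-1} = 0`
      Nonempty (OmegaH A₀ A (n - 1) 0 ≃ₗ[ℝ]
        LinearMap.ker (d₁ (n - 1) 0)) ∧
      -- degree `q + 1`
      ∀ q : ℕ,
        (∃ (f : CokerD d₁ (n - 1) q →ₗ[ℝ]
              OmegaH A₀ A (n - 1) (q + 1))
            (g : OmegaH A₀ A (n - 1) (q + 1) →ₗ[ℝ]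
              LinearMap.ker (d₁ (n - 1) (q + 1))),
          Function.Injective f ∧ Function.Exact f g ∧ Function.Surjective g) ∧
        Nonempty (OmegaH A₀ A (n - 1) (q + 1) ≃ₗ[ℝ]
          CokerD d₁ (n - 1) q × LinearMap.ker (d₁ (n - 1) (q + 1))) ∧
        Nonempty (OmegaH A₀ A (n - 1) (q + 1) ≃ₗ[ℝ]
          E2 d₁ n q × LinearMap.ker (d₁ (n - 1) (q + 1))) := by
  obtain ⟨N, ⟨Φ⟩⟩ := h
  have hr : n - 1 + 1 = n := Nat.sub_add_cancel hn1
  have hs' : ∀ m, n - 1 + 1 < m → Subsingleton (DForm A₀ m) := fun m hm => hs m (by omega)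
  refine ⟨LiftedFrame.existsUnique_isGaussManinD Φ, fun d₁ hd => ?_⟩
  have hd' := Φ.eq_d1 hd
  refine ⟨Φ.nonempty_omegaH_zero_equiv hs' hd', fun q => ⟨?_, ?_, ?_⟩⟩
  · exact Φ.exists_shortExact hs' hd' q
  · exact Φ.nonempty_omegaH_equiv_prod hs' hd' q
  · exact Φ.nonempty_omegaH_equiv_E2_prod_of_eq hs' hd' hr q

theorem mainTheorem4
    {EM EF EP : Type*}
    [NormedAddCommGroup EM] [NormedSpace ℝ EM] [FiniteDimensional ℝ EM]
    [NormedAddCommGroup EF] [NormedSpace ℝ EF] [FiniteDimensional ℝ EF]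
    [NormedAddCommGroup EP] [NormedSpace ℝ EP] [FiniteDimensional ℝ EP]
    {M F P : Type*}
    [TopologicalSpace M] [ChartedSpace EM M] [IsManifold 𝓘(ℝ, EM) ∞ M]
    [T2Space M] [SecondCountableTopology M]
    [TopologicalSpace F] [ChartedSpace EF F] [IsManifold 𝓘(ℝ, EF) ∞ F]
    [T2Space F] [SecondCountableTopology F]
    [TopologicalSpace P] [ChartedSpace EP P] [IsManifold 𝓘(ℝ, EP) ∞ P]
    [T2Space P] [SecondCountableTopology P]
    (α : C^∞⟮𝓘(ℝ, EP), P; 𝓘(ℝ, EM), M⟯) (hα : IsSmoothFiberBundle EF F α)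
    (n : ℕ) (hn : Module.finrank ℝ EM = n) (hn1 : 1 ≤ n) :
    -- the differentials `d_1^{p,q}` exist and are uniquely determined
    (∃! d₁ : ∀ p q : ℕ, E1 C^∞⟮𝓘(ℝ, EM), M; ℝ⟯ (TotalFun α) p q →ₗ[ℝ]
        E1 C^∞⟮𝓘(ℝ, EM), M; ℝ⟯ (TotalFun α) (p + 1) q, IsGaussManinD d₁) ∧
    ∀ d₁ : ∀ p q : ℕ, E1 C^∞⟮𝓘(ℝ, EM), M; ℝ⟯ (TotalFun α) p q →ₗ[ℝ]
        E1 C^∞⟮𝓘(ℝ, EM), M; ℝ⟯ (TotalFun α) (p + 1) q, IsGaussManinD d₁ →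
      -- degree `0`, where `VH^{-1} = 0`
      Nonempty (OmegaH C^∞⟮𝓘(ℝ, EM), M; ℝ⟯ (TotalFun α) (n - 1) 0 ≃ₗ[ℝ]
        LinearMap.ker (d₁ (n - 1) 0)) ∧
      -- degree `q + 1`
      ∀ q : ℕ,
        (∃ (f : CokerD d₁ (n - 1) q →ₗ[ℝ]
              OmegaH C^∞⟮𝓘(ℝ, EM), M; ℝ⟯ (TotalFun α) (n - 1) (q + 1))
            (g : OmegaH C^∞⟮𝓘(ℝ, EM), M; ℝ⟯ (TotalFun α) (n - 1) (q + 1) →ₗ[ℝ]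
              LinearMap.ker (d₁ (n - 1) (q + 1))),
          Function.Injective f ∧ Function.Exact f g ∧ Function.Surjective g) ∧
        Nonempty (OmegaH C^∞⟮𝓘(ℝ, EM), M; ℝ⟯ (TotalFun α) (n - 1) (q + 1) ≃ₗ[ℝ]
          CokerD d₁ (n - 1) q × LinearMap.ker (d₁ (n - 1) (q + 1))) ∧
        Nonempty (OmegaH C^∞⟮𝓘(ℝ, EM), M; ℝ⟯ (TotalFun α) (n - 1) (q + 1) ≃ₗ[ℝ]
          E2 d₁ n q × LinearMap.ker (d₁ (n - 1) (q + 1))) := by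
  exact affine_cohomology_of_frame (exists_liftedFrame α hα) n hn1
    fun m hm => by
      obtain ⟨N, ⟨Φ⟩⟩ := exists_liftedFrame α hα
      exact Φ.subsingleton_dForm_of_finrank_lt (hn ▸ hm)
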